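/- Let $V$ be a simple Euclidean Jordan algebra of dimension $n$ with unit $\mathbf{e}$, let $c_1,\dots,c_r$ be a Jordan frame of $V$ (so $r$ is the rank), and put $\operatorname{tr}(x)=\frac rn\operatorname{Tr}L(x)$ and $(x|y)=\operatorname{tr}(xy)$, where $L(x)$ is multiplication by $x$; both are extended complex (bi)linearly to $V_{\mathbb C}$. If $r>1$ let $\lambda=\frac d2$, where $d=\dim V_{12}$ is the dimension of the Peirce space $V_{12}=\{x: c_1x=c_2x=\frac12x\}$; if $r=1$ let $\lambda>0$ be arbitrary. Let $L_{\mathbb C}=\operatorname{Str}(V_{\mathbb C})_0$ be the identity component of the structure group of $V_{\mathbb C}$ and $\mathbb X=L_{\mathbb C}\cdot c_1\subseteq V_{\mathbb C}$. Let $\mathcal P(\mathbb X)$ (resp. $\mathcal P^m(\mathbb X)$) be the space of restrictions to $\mathbb X$ of holomorphic polynomials (resp. homogeneous holomorphic polynomials of degree $m$) on $V_{\mathbb C}$. Let $P(x,y)=L(x)L(y)+L(y)L(x)-L(xy)$ and, in coordinates $z=\sum_\alpha z_\alpha e_\alpha$ with respect to an orthonormal basis $(e_\alpha)$ of $(V,(-|-))$,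 $$\mathcal B_{\mathbf e}p(z)=\sum_{\alpha,\beta}\frac{\partial^2p}{\partial z_\alpha\partial z_\beta}(z)\,(P(e_\alpha,e_\beta)z|\mathbf e)+\lambda\sum_\alpha\frac{\partial p}{\partial z_\alpha}(z)\,(e_\alpha|\mathbf e).$$ If a polynomial $p$ vanishes on $\mathbb X$, so does $\mathcal B_{\mathbf e}p$; hence $\mathcal B_{\mathbf e}$ acts on $\mathcal P(\mathbb X)$. Put $\mathcal H^m(\mathbb X)=\{p\in\mathcal P^m(\mathbb X):\mathcal B_{\mathbf e}p=0\}$. Then for every $m\ge0$, every $p\in\mathcal P^m(\mathbb X)$ decomposes uniquely as $$p=\sum_{k=0}^m\operatorname{tr}(z)^k\,h_{m-k},\qquad h_{m-k}\in\mathcal H^{m-k}(\mathbb X),$$ and the $h_{m-k}$ are given by $$h_{m-k}=\sum_{j=0}^{m-k}(-1)^j\frac{\Gamma(r\lambda+2m-2k)\,\Gamma(r\lambda+2m-2k-j-1)}{j!\,k!\,\Gamma(r\lambda+2m-k)\,\Gamma(r\lambda+2m-2k-1)}\operatorname{tr}(z)^j\,\mathcal B_{\mathbf e}^{k+j}p,$$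 where for $j=0$ the quotient $\Gamma(r\lambda+2m-2k-j-1)/\Gamma(r\lambda+2m-2k-1)$ is read as $1$ (this matters only for $k=m$ and $r\lambda=1$). Hence $$\mathcal P(\mathbb X)=\bigoplus_{k,m=0}^\infty\operatorname{tr}(z)^k\,\mathcal H^m(\mathbb X).$$ Moreover, let $d_m$ be the dimension of the space $\mathcal P^{(m,0,\dots,0)}(V_{\mathbb C})$ spanned by the polynomials $z\mapsto(gz|c_1)^m$, $g\in L_{\mathbb C}$, and put $d_{-1}=0$. Then, for every $m\ge0$, $\mathcal P^{(m,0,\dots,0)}(V_{\mathbb C})$ and $\mathcal H^m(\mathbb X)$ are finite-dimensional, and $$d_m=\frac{(\frac nr)_m(r\lambda)_m}{m!\,(\lambda)_m},\qquad \dim\mathcal H^m(\mathbb X)=d_m-d_{m-1},$$ where $(a)_m=a(a+1)\cdots(a+m-1)$. -/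

import Mathlib

open scoped TensorProduct

noncomputable section

namespace JordanFock

/-! ### Euclidean Jordan algebras -/

/-- A simple Euclidean Jordan algebra: a finite-dimensional unital commutative real algebra that
satisfies the Jordan identity, admits an associative inner product, and is simple
(nonzero, with no nontrivial ideals). -/
structure IsSimpleEuclideanJordan (V : Type*) [NonAssocCommRing V] [Module ℝ V]
    [IsScalarTower ℝ V V] [SMulCommClass ℝ V V] : Prop where
  finiteDimensional : FiniteDimensional ℝ V
  jordan : IsCommJordan V
  euclidean : ∃ B : LinearMap.BilinForm ℝ V, (∀ x y, B x y = B y x) ∧ (∀ x, x ≠ 0 → 0 < B x x) ∧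
    ∀ x y z, B (x * y) z = B y (x * z)
  simple : IsSimpleRing V

section Algebra

variable (K : Type*) [CommRing K] {A : Type*} [NonAssocRing A] [Module K A]
  [IsScalarTower K A A] [SMulCommClass K A A]

/-- Left multiplication `L(x)`. -/
def leftMul (x : A) : Module.End K A := LinearMap.mul K A x

/-- The polarized quadratic representation `P(x, y) = L(x) L(y) + L(y) L(x) - L(x y)`. -/
def quadRep₂ (x y : A) : Module.End K A :=
  leftMul K x * leftMul K y + leftMul K y * leftMul K x - leftMul K (x * y)

/-- The quadratic representation `P(x) = 2 L(x)² - L(x²)`. -/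
def quadRep (x : A) : Module.End K A :=
  2 * leftMul K x ^ 2 - leftMul K (x * x)

end Algebra

variable {V : Type*} [NonAssocCommRing V] [Module ℝ V] [IsScalarTower ℝ V V] [SMulCommClass ℝ V V]

/-- A primitive idempotent: a nonzero idempotent that is not the sum of two nonzero orthogonal
idempotents. -/
def IsPrimitiveIdempotent (c : V) : Prop :=
  c ≠ 0 ∧ c * c = c ∧
    ∀ a b : V, a * a = a → b * b = b → a * b = 0 → a + b = c → a = 0 ∨ b = 0

/-- A Jordan frame `c₁, …, c_r`: a complete system of orthogonal primitive idempotents.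
Its length `r` is the rank of `V`. -/
structure IsJordanFrame {r : ℕ} (c : Fin r → V) : Prop where
  primitive : ∀ i, IsPrimitiveIdempotent (c i)
  orthogonal : ∀ i j, i ≠ j → c i * c j = 0
  complete : ∑ i, c i = 1

/-- The Peirce space `V(c, 1/2) ∩ V(c', 1/2)`; for two distinct members `c = c_i`, `c' = c_j` of a
Jordan frame it is `V_ij`. -/
def peirceSpace (c c' : V) : Submodule ℝ V :=
  LinearMap.ker (leftMul ℝ c - (1 / 2 : ℝ) • 1) ⊓ LinearMap.ker (leftMul ℝ c' - (1 / 2 : ℝ) • 1)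

/-- The parameter `λ` attached to a Jordan frame: `λ = d / 2` with `d = dim V₁₂` if `r > 1`, and an
arbitrary positive number if `r = 1`. -/
def IsWallachParameter {r : ℕ} [NeZero r] (c : Fin r → V) (lam : ℝ) : Prop :=
  (1 < r ∧ lam = (Module.finrank ℝ (peirceSpace (c 0) (c 1)) : ℝ) / 2) ∨ (r = 1 ∧ 0 < lam)

/-- The Jordan trace `tr(x) = (r / n) Tr L(x)`, where `n = dim V` and `r` is the rank. -/
def jordanTrace (r : ℕ) : V →ₗ[ℝ] ℝ :=
  ((r : ℝ) / (Module.finrank ℝ V : ℝ)) • (LinearMap.trace ℝ V ∘ₗ LinearMap.mul ℝ V)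

/-- The trace form `(x | y) = tr(x y) = (r / n) Tr L(x y)`. -/
def traceForm (r : ℕ) : LinearMap.BilinForm ℝ V :=
  (LinearMap.mul ℝ V).compr₂ (jordanTrace r)

/-! ### The complexification and the orbit `𝕏` -/

/-- The `ℂ`-bilinear extension of the trace form to `V_ℂ = ℂ ⊗ V`. -/
def traceFormC (r : ℕ) : LinearMap.BilinForm ℂ (ℂ ⊗[ℝ] V) :=
  LinearMap.BilinForm.baseChange ℂ (traceForm (V := V) r)

/-- The structure group `Str(V_ℂ)`: all invertible `g` with `P(g z) = g P(z) g^*` for all `z`,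
where `g^*` is the adjoint of `g` with respect to the trace form. -/
def structureGroup (V : Type*) [NonAssocCommRing V] [Module ℝ V] [IsScalarTower ℝ V V]
    [SMulCommClass ℝ V V] (r : ℕ) : Set (Module.End ℂ (ℂ ⊗[ℝ] V)) :=
  {g | IsUnit g ∧ ∃ g' : Module.End ℂ (ℂ ⊗[ℝ] V),
    (∀ x y, traceFormC r (g' x) y = traceFormC r x (g y)) ∧
    ∀ z, quadRep ℂ (g z) = g * quadRep ℂ z * g'}

/-- The group `L_ℂ = Str(V_ℂ)₀`: the connected component of the identity in `Str(V_ℂ)`. The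
topology is the usual one on the endomorphisms of a finite-dimensional complex space. -/
def structureGroupZero (V : Type*) [NonAssocCommRing V] [Module ℝ V] [IsScalarTower ℝ V V]
    [SMulCommClass ℝ V V] (r : ℕ) : Set (Module.End ℂ (ℂ ⊗[ℝ] V)) :=
  @connectedComponentIn _ (moduleTopology ℂ (Module.End ℂ (ℂ ⊗[ℝ] V))) (structureGroup V r) 1

/-- The orbit `𝕏 = L_ℂ · c₁` of a primitive idempotent `c₁ ∈ V`. -/
def orbitX (r : ℕ) (c₁ : V) : Set (ℂ ⊗[ℝ] V) :=
  {z | ∃ g ∈ structureGroupZero V r, g (1 ⊗ₜ[ℝ] c₁) = z}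

/-! ### Polynomials

Holomorphic polynomials on `V_ℂ` are written in the coordinates `z = ∑ z_α e_α` of a basis
`(e_α)` of `V`. -/

variable {ι : Type*}

/-- The value at `z ∈ V_ℂ` of a polynomial in the coordinates of `z`. -/
def evalAt (e : Module.Basis ι ℝ V) (z : ℂ ⊗[ℝ] V) : MvPolynomial ι ℂ →ₐ[ℂ] ℂ :=
  MvPolynomial.aeval fun α => (e.baseChange ℂ).repr z α

/-- Restriction of polynomials on `V_ℂ` to `𝕏`. -/
def restrictX (e : Module.Basis ι ℝ V) (r : ℕ) (c₁ : V) :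
    MvPolynomial ι ℂ →ₗ[ℂ] (orbitX r c₁ → ℂ) :=
  LinearMap.pi fun z => (evalAt e (z : ℂ ⊗[ℝ] V)).toLinearMap

/-- The space `𝒫(𝕏)` of restrictions to `𝕏` of holomorphic polynomials on `V_ℂ`. -/
def polyX (e : Module.Basis ι ℝ V) (r : ℕ) (c₁ : V) : Submodule ℂ (orbitX r c₁ → ℂ) :=
  LinearMap.range (restrictX e r c₁)

/-- The trace `tr(z) = ∑ tr(e_α) z_α` as a polynomial. -/
def trPoly [Fintype ι] (e : Module.Basis ι ℝ V) (r : ℕ) : MvPolynomial ι ℂ :=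
  ∑ α, MvPolynomial.C (jordanTrace r (e α) : ℂ) * MvPolynomial.X α

/-- The trace as a function on `𝕏`. -/
def trX [Fintype ι] (e : Module.Basis ι ℝ V) (r : ℕ) (c₁ : V) : orbitX r c₁ → ℂ :=
  restrictX e r c₁ (trPoly e r)

/-- The component `(v | ℬ_λ)` in direction `v ∈ V` of the Bessel operator
`ℬ_λ = P(∂/∂z) z + λ ∂/∂z`, in the coordinates of a basis `(e_α)` that is orthonormal for the trace
form:
`(v | ℬ_λ p)(z) = ∑_{α,β} (∂²p/∂z_α∂z_β)(z) (P(e_α, e_β) z | v) + λ ∑_α (∂p/∂z_α)(z) (e_α | v)`,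
where `(P(e_α, e_β) z | v) = ∑_γ z_γ (P(e_α, e_β) e_γ | v)`. -/
def besselComponent [Fintype ι] (e : Module.Basis ι ℝ V) (r : ℕ) (lam : ℝ) (v : V) :
    MvPolynomial ι ℂ →ₗ[ℂ] MvPolynomial ι ℂ :=
  (∑ α, ∑ β,
    LinearMap.mulLeft ℂ (∑ γ,
        MvPolynomial.C (traceForm r (quadRep₂ ℝ (e α) (e β) (e γ)) v : ℂ) * MvPolynomial.X γ) ∘ₗ
      (MvPolynomial.pderiv α).toLinearMap ∘ₗ (MvPolynomial.pderiv β).toLinearMap) +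
  (lam : ℂ) • ∑ α, (traceForm r (e α) v : ℂ) • (MvPolynomial.pderiv α).toLinearMap

/-- The operator `ℬ_𝐞 = (𝐞 | ℬ_λ)`, where `𝐞` is the unit of `V`. -/
def besselE [Fintype ι] (e : Module.Basis ι ℝ V) (r : ℕ) (lam : ℝ) :
    MvPolynomial ι ℂ →ₗ[ℂ] MvPolynomial ι ℂ :=
  besselComponent e r lam 1

/-- The space `ℋ^m(𝕏)` of harmonic polynomials: the restrictions to `𝕏` of homogeneous polynomials
`p` of degree `m` with `ℬ_𝐞 p = 0` on `𝕏`. -/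
def harmonicX [Fintype ι] (e : Module.Basis ι ℝ V) (r : ℕ) (c₁ : V) (lam : ℝ) (m : ℕ) :
    Submodule ℂ (orbitX r c₁ → ℂ) :=
  (MvPolynomial.homogeneousSubmodule ι ℂ m ⊓
    LinearMap.ker (restrictX e r c₁ ∘ₗ besselE e r lam)).map (restrictX e r c₁)

/-- The space `tr^k ℋ^m(𝕏)`. -/
def trHarmonicX [Fintype ι] (e : Module.Basis ι ℝ V) (r : ℕ) (c₁ : V) (lam : ℝ) (k m : ℕ) :
    Submodule ℂ (orbitX r c₁ → ℂ) :=
  (harmonicX e r c₁ lam m).map (LinearMap.mulLeft ℂ (trX e r c₁ ^ k))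

/-- The quotient `Γ(a - j) / Γ(a)`, read as `1` for `j = 0` also if `a` is a pole of `Γ`. -/
def gammaQuot (a : ℝ) (j : ℕ) : ℝ :=
  if j = 0 then 1 else Real.Gamma (a - j) / Real.Gamma a

/-- The coefficient of `tr^j ℬ_𝐞^(k+j) p` in the harmonic polynomial `h_(m-k)`. -/
def harmonicCoeff (r : ℕ) (lam : ℝ) (m k j : ℕ) : ℝ :=
  (-1) ^ j * Real.Gamma (r * lam + 2 * m - 2 * k) /
      ((j.factorial : ℝ) * (k.factorial : ℝ) * Real.Gamma (r * lam + 2 * m - k)) *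
    gammaQuot (r * lam + 2 * m - 2 * k - 1) j

/-- The polynomial
`∑_{j=0}^{m-k} (-1)^j Γ(rλ+2m-2k) Γ(rλ+2m-2k-j-1) / (j! k! Γ(rλ+2m-k) Γ(rλ+2m-2k-1)) tr^j ℬ_𝐞^(k+j) p`
for `k ≤ m`. -/
def harmonicPart [Fintype ι] (e : Module.Basis ι ℝ V) (r : ℕ) (lam : ℝ) (m k : ℕ)
    (p : MvPolynomial ι ℂ) : MvPolynomial ι ℂ :=
  ∑ j ∈ Finset.range (m - k + 1),
    (harmonicCoeff r lam m k j : ℂ) • (trPoly e r ^ j * (besselE e r lam ^ (k + j)) p)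

/-- The space `𝒫^(m,0,…,0)(V_ℂ)`: the span of the polynomials `z ↦ Δ₁(g z)^m`, `g ∈ L_ℂ`, where
`Δ₁(z) = (z | c₁)` is the first principal minor. -/
def polyTop (e : Module.Basis ι ℝ V) (r : ℕ) (c₁ : V) (m : ℕ) :
    Submodule ℂ (MvPolynomial ι ℂ) :=
  Submodule.span ℂ {q | ∃ g ∈ structureGroupZero V r,
    ∀ z : ℂ ⊗[ℝ] V, evalAt e z q = traceFormC r (g z) (1 ⊗ₜ[ℝ] c₁) ^ m}

/-- `d_m = dim 𝒫^(m,0,…,0)(V_ℂ)`. -/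
def dimTop (e : Module.Basis ι ℝ V) (r : ℕ) (c₁ : V) (m : ℕ) : ℕ :=
  Module.finrank ℂ (polyTop e r c₁ m)

end JordanFock

end

noncomputable section

namespace JordanFock

set_option linter.unusedSectionVars false

/-! On the coordinate ring of `𝕏` (polynomials modulo those vanishing on the orbit) let `A` be
multiplication by `tr` and `B` the operator induced by `ℬ_𝐞`. In degree `m` one has `BA - AB = 2m +
rλ`, so `A` and `B` generate an `sl₂`-action with lowest weights `rλ + 2m > 0`. The ring is
therefore a direct sum of lowest weight modules, generated by the kernels of `B`. This is the
decomposition, and the Gamma quotients are the coefficients of the projections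
(`IsLadder.sum_ladderPart`, `IsLadder.iSupIndep_harmonic`). Moreover `BA` is injective, hence `B`
maps each degree onto the preceding one, which gives `dim ℋ^m` as a difference.

The Jordan-theoretic core is that the Bessel operators respect vanishing on `𝕏`
(`IsJordanFrame.besselComponent_vanishing`). For `u` in the half-space of `c = c_i`, a unipotent
element of the structure group moves `c` along `c + t u + t² (u² - c u²)`; translating by `g ∈ L_ℂ`
gives curves in `𝕏` through `g c`. A polynomial `p` vanishing on `𝕏` thus satisfies `p''(u,v) + 2
p'(uv - c(uv)) = 0` for half-space directions. At `x` the Bessel operator is `∑ p''(e_α, {x, e_α,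
v}) + λ p'(v)`. Its vanishing is checked on the Peirce components of `v`, and on the zero-space it
amounts to the identity `sum_halfProj`. That identity needs all `V_ij` to have dimension `2λ`, which
follows from simplicity (`IsJordanFrame.finrank_eq`).

For the dimensions, let `ℬ_α` be the component of the Bessel operator along `e_α`. Both `∑ z_α ℬ_α`
and `∑ ℬ_α z_α` are scalars on each degree, because `P(x) y = (x|y) x` on `𝕏`. Equality of traces
gives a two-term recursion for `dim 𝒫^m(𝕏)` (`finrank_gradedPart_succ`). Finally `𝒫^(m,0,…,0)` is
the Fischer image of the span of the evaluations at points of `𝕏`, so it has the same dimension as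
`𝒫^m(𝕏)` (`finrank_polyTop`). -/

/-- A commutative algebra satisfying the linearized Jordan identity. -/
structure IsLinearJordan (A : Type*) [NonAssocRing A] : Prop where
  comm : ∀ x y : A, x * y = y * x
  lin : ∀ a b d x : A, a * d * b * x + a * (b * (d * x)) + d * (b * (a * x)) =
    a * b * (d * x) + b * d * (a * x) + a * d * (b * x)

/-! ### Jordan triple identities and the fundamental formula. -/

section JordanIdentities

variable {K A : Type*} [Field K] [NonAssocRing A] [Module K A]
  [IsScalarTower K A A] [SMulCommClass K A A]

theorem leftMul_apply (x y : A) : leftMul K x y = x * y := rfl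

theorem quadRep₂_apply (x y z : A) :
    quadRep₂ K x y z = x * (y * z) + y * (x * z) - x * y * z := by
  simp [quadRep₂, leftMul_apply]

theorem quadRep_apply (x z : A) : quadRep K x z = x * (x * z) + x * (x * z) - x * x * z := by
  simp [quadRep, leftMul_apply, pow_two, two_mul]

theorem quadRep₂_self (x : A) : quadRep₂ K x x = quadRep K x := by
  ext z; rw [quadRep₂_apply, quadRep_apply]

/-- The quadratic representation as a trilinear map `(x, y, z) ↦ P(x, z) y`. -/
def triple (x y z : A) : A := x * y * z + x * (y * z) - y * (x * z)

theorem triple_add_right (x y z w : A) : triple x y (z + w) = triple x y z + triple x y w := by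
  simp only [triple, mul_add]; abel

theorem triple_add_left (x y z w : A) : triple (x + w) y z = triple x y z + triple w y z := by
  simp only [triple, mul_add, add_mul]; abel

theorem triple_sub_right (x y z w : A) : triple x y (z - w) = triple x y z - triple x y w := by
  simp only [triple, mul_sub]; abel

theorem triple_sub_left (x y z w : A) : triple (x - w) y z = triple x y z - triple w y z := by
  simp only [triple, mul_sub, sub_mul]; abel

theorem triple_add_mid (x y z w : A) : triple x (y + w) z = triple x y z + triple x w z := by
  simp only [triple, mul_add, add_mul]; abel

theorem triple_sub_mid (x y z w : A) : triple x (y - w) z = triple x y z - triple x w z := by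
  simp only [triple, mul_sub, sub_mul]; abel

/-- The commutator of two pairs in the Lie algebra of the structure group is again such a pair. -/
theorem lie_triple {M M' N N' : A → A}
    (hM : ∀ u v w, M (triple u v w) = triple (M u) v w - triple u (M' v) w + triple u v (M w))
    (hN : ∀ u v w, N (triple u v w) = triple (N u) v w - triple u (N' v) w + triple u v (N w))
    (hMa : ∀ x y, M (x + y) = M x + M y) (hMs : ∀ x y, M (x - y) = M x - M y)
    (hNa : ∀ x y, N (x + y) = N x + N y) (hNs : ∀ x y, N (x - y) = N x - N y) (u v w : A) :
    M (N (triple u v w)) - N (M (triple u v w)) =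
      triple (M (N u) - N (M u)) v w - triple u (N' (M' v) - M' (N' v)) w +
        triple u v (M (N w) - N (M w)) := by
  simp only [hM, hN, hMa, hMs, hNa, hNs, triple_sub_mid, triple_sub_left, triple_sub_right]
  abel

namespace IsLinearJordan

variable (hA : IsLinearJordan A)
include hA

/-- The identity `[L(ab), L(d)] + [L(bd), L(a)] + [L(ad), L(b)] = 0`. -/
theorem lie_sum (a b d x : A) :
    a * b * (d * x) + b * d * (a * x) + a * d * (b * x) =
      d * (a * b * x) + a * (b * d * x) + b * (a * d * x) := by
  have h := hA.lin a x d b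
  rw [hA.comm (a * d * x) b, hA.comm x (d * b), hA.comm x (a * b), hA.comm d b, hA.comm x b,
    hA.comm x d, hA.comm a x] at h
  rw [hA.comm (d * x) (a * b), hA.comm x a, hA.comm (a * x) (b * d)] at h
  linear_combination (norm := abel) -h

theorem triple_symm (x y z : A) : triple x y z = triple z y x := by
  simp only [triple]
  rw [hA.comm (x * y) z, hA.comm (z * y) x, hA.comm x y, hA.comm z y, hA.comm z x]
  abel

theorem triple_eq (x y z : A) : triple x y z = quadRep₂ K x z y := by
  rw [quadRep₂_apply, triple, hA.comm (x * y) z, hA.comm y (x * z), hA.comm y z]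
  abel

theorem quadRep_eq (x y : A) : quadRep K x y = triple x y x := by
  rw [hA.triple_eq (K := K), quadRep₂_self]

/-- Multiplications lie in the Lie algebra of the structure group. -/
theorem mul_triple (a u v w : A) : a * triple u v w =
    triple (a * u) v w - triple u (a * v) w + triple u v (a * w) := by
  have e1 (u v w : A) : triple u v w = u * (w * v) + w * (u * v) - u * w * v := by
    rw [triple, hA.comm (u * v) w, hA.comm v (u * w), hA.comm v w]; abel
  have h1 := hA.lin a u w v
  have h2 := hA.lin a w u v
  have h3 := hA.lie_sum a u w v
  rw [hA.comm w u] at h2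
  rw [hA.comm (a * w) u] at h1
  simp only [e1, mul_add, mul_sub]
  linear_combination (norm := abel) h1 + h2 + h3

/-- The five-linear identity of Jordan triple systems. The map `z ↦ {x, y, z}` is `L(xy) + [L(x),
L(y)]`; multiplications satisfy the rule by `mul_triple` and brackets inherit it by `lie_triple`,
with the sign of the bracket reversed in the middle slot, which turns `(x, y)` into `(y, x)` there.
-/
theorem triple_triple (x y u v w : A) : triple x y (triple u v w) =
    triple (triple x y u) v w - triple u (triple y x v) w + triple u v (triple x y w) := by
  have h1 := hA.mul_triple (x * y) u v w
  have h2 := lie_triple (hA.mul_triple x) (hA.mul_triple y) (mul_add x) (mul_sub x) (mul_add y)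
    (mul_sub y) u v w
  have e (x y z : A) : triple x y z = x * y * z + (x * (y * z) - y * (x * z)) := by
    rw [triple]; abel
  have e' : triple y x v = x * y * v - (x * (y * v) - y * (x * v)) := by
    rw [triple, hA.comm y x]; abel
  rw [e x y (triple u v w), e x y u, e x y w, e']
  simp only [triple_sub_mid, triple_sub_left, triple_sub_right, triple_add_left, triple_add_right]
    at h1 h2 ⊢
  linear_combination (norm := abel) h1 + h2

/-- Two instances of the five-linear identity, with `y` and `v` exchanged, show that three times the
antisymmetrization of the left side in `y`, `v` vanishes; either instance then gives the formula. -/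
theorem triple_quad_right [CharZero K] (x y v : A) :
    triple x y (triple x v x) = triple x (triple y x v) x := by
  have h1 := hA.triple_triple x y x v x
  have h2 := hA.triple_triple x v x y x
  rw [hA.triple_symm (triple x y x)] at h1
  rw [hA.triple_symm (triple x v x), hA.triple_symm v x y] at h2
  have h3 : (3 : K) • (triple x y (triple x v x) - triple x v (triple x y x)) = 0 := by
    linear_combination (norm := module) h1 - h2
  have h4 := (smul_eq_zero.1 h3).resolve_left (by norm_num)
  linear_combination (norm := abel) 2 • h4 - h1

theorem two_triple_triple (x y z : A) :
    triple x y (triple x y z) + triple x y (triple x y z) =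
      triple (triple x y x) y z + triple x (triple y z y) x := by
  have h := hA.triple_triple z y x y x
  rw [hA.triple_symm (triple z y x), hA.triple_symm z y x, hA.triple_symm z y] at h
  linear_combination (norm := abel) -h

/-- The fundamental formula `P(P(x) y) = P(x) P(y) P(x)`. -/
theorem fundamental [CharZero K] (x y v : A) :
    triple (triple x y x) v (triple x y x) = triple x (triple y (triple x v x) y) x := by
  have h1 := hA.triple_triple x y (triple x y x) v x
  have h2 (v : A) := hA.triple_triple x y x v x
  have h3 (v : A) : triple (triple x y x) v x = triple x (triple y x v) x := by
    have h4 := h2 v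
    rw [hA.triple_quad_right (K := K)] at h4
    have h5 : (2 : K) • (triple (triple x y x) v x - triple x (triple y x v) x) = 0 := by
      rw [hA.triple_symm x v (triple x y x)] at h4
      linear_combination (norm := module) -h4
    exact sub_eq_zero.1 ((smul_eq_zero.1 h5).resolve_left (by norm_num))
  rw [h3, h3, hA.triple_quad_right (K := K), hA.triple_quad_right (K := K),
    hA.triple_symm (triple x (triple y x y) x), hA.triple_quad_right (K := K),
    hA.triple_symm v x] at h1
  -- All terms are now of the form `P(x)(…)`; what remains is `P(x)` applied to `two_triple_triple`
  -- with `x` and `y` exchanged.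
  have h4 := congrArg (fun z => triple x z x) (hA.two_triple_triple y x v)
  simp only [triple_add_mid] at h4
  linear_combination (norm := abel) -h1 + h4

theorem quadRep_quadRep [CharZero K] (x y : A) :
    quadRep K (quadRep K x y) = quadRep K x * quadRep K y * quadRep K x := by
  ext v
  simp only [hA.quadRep_eq, Module.End.mul_apply]
  exact hA.fundamental (K := K) x y v

end IsLinearJordan
end JordanIdentities

theorem exists_eigenbasis {V : Type*} [AddCommGroup V] [Module ℝ V] [FiniteDimensional ℝ V]
    (B : LinearMap.BilinForm ℝ V) (hsymm : ∀ x y, B x y = B y x) (hpos : ∀ x, x ≠ 0 → 0 < B x x)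
    (S : Module.End ℝ V) (hS : ∀ x y, B (S x) y = B x (S y)) :
    ∃ (b : Module.Basis (Fin (Module.finrank ℝ V)) ℝ V) (μ : Fin (Module.finrank ℝ V) → ℝ),
      ∀ i, S (b i) = μ i • b i := by
  let core : InnerProductSpace.Core ℝ V :=
    { inner := fun x y => B x y
      conj_inner_symm := fun x y => by simp [hsymm x y]
      re_inner_nonneg := fun x => by
        by_cases hx : x = 0
        · simp [hx]
        · simpa using (hpos x hx).le
      add_left := fun x y z => by simp
      smul_left := fun x y r => by simp
      definite := fun x hx => by
        by_contra h
        exact (hpos x h).ne' hx }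
  let _ : NormedAddCommGroup V := core.toNormedAddCommGroup
  let _ : InnerProductSpace ℝ V := InnerProductSpace.ofCore core.toCore
  have hsym : LinearMap.IsSymmetric S := fun x y => hS x y
  exact ⟨(hsym.eigenvectorBasis rfl).toBasis, hsym.eigenvalues rfl, fun i => by
    simp [hsym.apply_eigenvectorBasis rfl i]⟩

/-! ### The associative trace form and the Peirce calculus of one idempotent. -/

section Peirce

variable {V : Type*} [NonAssocCommRing V] [Module ℝ V] [IsScalarTower ℝ V V] [SMulCommClass ℝ V V]

/-- Mathlib's linearized identity is a sum of commutators with a factor 2, which is cancelled over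
`ℝ`. Reading it with another of the four variables as the argument gives `lin`. -/
theorem IsSimpleEuclideanJordan.isLinearJordan (hV : IsSimpleEuclideanJordan V) :
    IsLinearJordan V := by
  have := hV.jordan
  have key (a b d x : V) : a * (b * d * x) + b * (d * a * x) + d * (a * b * x) =
      b * d * (a * x) + d * a * (b * x) + a * b * (d * x) := by
    have h : 2 • (a * (b * d * x) - b * d * (a * x) + (b * (d * a * x) - d * a * (b * x)) +
        (d * (a * b * x) - a * b * (d * x))) = 0 :=
      congrArg (fun f : AddMonoid.End V => f x) (two_nsmul_lie_lmul_lmul_add_add_eq_zero a b d)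
    have h2 : (2 : ℝ) • (a * (b * d * x) + b * (d * a * x) + d * (a * b * x) -
      (b * d * (a * x) + d * a * (b * x) + a * b * (d * x))) = 0 := by
      linear_combination (norm := module) h
    exact sub_eq_zero.1 ((smul_eq_zero.1 h2).resolve_left (by norm_num))
  refine ⟨mul_comm, fun a b d x => ?_⟩
  have h := key a d x b
  simp only [mul_comm _ b] at h ⊢
  simp only [mul_comm x] at h
  rw [mul_comm (b * d), mul_comm (b * a)]
  linear_combination (norm := abel) h

theorem traceForm_apply (r : ℕ) (x y : V) : traceForm r x y = jordanTrace r (x * y) := rfl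

theorem traceForm_symm (r : ℕ) (x y : V) : traceForm r x y = traceForm r y x := by
  rw [traceForm_apply, traceForm_apply, mul_comm]

theorem jordanTrace_apply (r : ℕ) (x : V) : jordanTrace r x =
    (r : ℝ) / Module.finrank ℝ V * LinearMap.trace ℝ V (leftMul ℝ x) := rfl

/-- The operator `L((xy)z) - L(y(xz))` is a sum of two commutators, so its trace is zero. -/
theorem traceForm_mul_left (hJ : IsLinearJordan V) (r : ℕ) (x y z : V) :
    traceForm r (x * y) z = traceForm r y (x * z) := by
  have h : leftMul ℝ (x * y * z) - leftMul ℝ (y * (x * z)) =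
      leftMul ℝ x * (leftMul ℝ y * leftMul ℝ z) - leftMul ℝ y * leftMul ℝ z * leftMul ℝ x
      + (leftMul ℝ z * leftMul ℝ y * leftMul ℝ x - leftMul ℝ x * (leftMul ℝ z * leftMul ℝ y)) := by
    ext w
    have h1 := hJ.lin x z y w
    have h2 := hJ.lin x y z w
    simp only [LinearMap.sub_apply, LinearMap.add_apply, Module.End.mul_apply, leftMul_apply]
    rw [mul_comm z y] at h1
    rw [mul_comm (x * z) y] at h2
    linear_combination (norm := abel) h1 - h2
  have h' := congrArg (LinearMap.trace ℝ V) h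
  rw [map_sub, map_add, map_sub, map_sub, LinearMap.trace_mul_comm ℝ (leftMul ℝ x),
    LinearMap.trace_mul_comm ℝ (leftMul ℝ x), sub_self, sub_self, add_zero] at h'
  rw [traceForm_apply, traceForm_apply, jordanTrace_apply, jordanTrace_apply, sub_eq_zero.1 h']

theorem traceForm_mul_right (hJ : IsLinearJordan V) (r : ℕ) (x y z : V) :
    traceForm r (x * y) z = traceForm r x (y * z) := by
  rw [mul_comm, traceForm_mul_left hJ]

namespace IsLinearJordan

variable (hJ : IsLinearJordan V) {f : V} (hf : f * f = f)
include hJ hf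

/-- This is `L(f)(2 L(f) - 1)(L(f) - 1) = 0`, so only the eigenvalues `0`, `1/2`, `1` occur. -/
theorem peirce_cubic (x : V) : f * x + (2 : ℝ) • (f * (f * (f * x))) = (3 : ℝ) • (f * (f * x)) := by
  have h := hJ.lin f f f x
  simp only [hf] at h
  linear_combination (norm := module) h

/-- Mainly used for `α = β`, where it says that the product has no half-space component. -/
theorem peirce_mul {u v : V} {α β : ℝ} (hu : f * u = α • u) (hv : f * v = β • v) :
    f * (f * (u * v)) - f * (u * v) + ((α - β) ^ 2) • (u * v) = 0 := by
  have h := hJ.lin f f u v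
  rw [hf, hu, hv, mul_comm (α • u) f, mul_smul_comm α f, mul_smul_comm β f, hu, hv] at h
  simp only [smul_mul_assoc, mul_smul_comm] at h
  linear_combination (norm := module) h

/-- `lie_sum` produces the commutator with the factor `1 - 2α`, hence the exclusion of the
half-space. -/
theorem peirce_commute {x : V} {α : ℝ} (hα : α ≠ 1 / 2) (hx : f * x = α • x) (v : V) :
    f * (x * v) = x * (f * v) := by
  have h := hJ.lie_sum f f x v
  rw [hf, hx] at h
  simp only [smul_mul_assoc, mul_smul_comm] at h
  have h2 : (1 - 2 * α) • (f * (x * v) - x * (f * v)) = 0 := by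
    linear_combination (norm := module) h
  exact sub_eq_zero.1 ((smul_eq_zero.1 h2).resolve_left fun h => hα (by linarith))

theorem peirce_one_commute {x : V} (hx : f * x = x) (v : V) : f * (x * v) = x * (f * v) :=
  hJ.peirce_commute hf (α := 1) (by norm_num) (by simpa) v

theorem peirce_zero_commute {x : V} (hx : f * x = 0) (v : V) : f * (x * v) = x * (f * v) :=
  hJ.peirce_commute hf (α := 0) (by norm_num) (by simpa) v

theorem peirce_one_mul_zero {x y : V} (hx : f * x = x) (hy : f * y = 0) : x * y = 0 := by
  have h1 := hJ.peirce_one_commute hf hx y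
  have h2 := hJ.peirce_zero_commute hf hy x
  rwa [hy, mul_zero, mul_comm x, h2, hx, mul_comm] at h1

theorem peirce_half_mul_half {u v : V} (hu : f * u = (1 / 2 : ℝ) • u)
    (hv : f * v = (1 / 2 : ℝ) • v) : f * (f * (u * v)) = f * (u * v) := by
  have h := hJ.peirce_mul hf hu hv
  simpa [sub_eq_zero] using h

/-- On the Peirce half-space, `x ↦ 2 L(x)` is a Jordan homomorphism from the zero-space. -/
theorem peirce_half_mul_mul {a b v : V} (ha : f * a = 0) (hb : f * b = 0)
    (hv : f * v = (1 / 2 : ℝ) • v) : a * b * v = a * (b * v) + b * (a * v) := by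
  have h := hJ.lin a b f v
  have h1 := hJ.peirce_zero_commute hf ha v
  have h2 := hJ.peirce_zero_commute hf hb (a * v)
  rw [mul_comm a f, ha, mul_comm b f, hb, hv, h2, h1, hv] at h
  simp only [mul_smul_comm, zero_mul, zero_add, add_zero] at h
  have h3 : (1 / 2 : ℝ) • (a * b * v - (a * (b * v) + b * (a * v))) = 0 := by
    linear_combination (norm := module) -h
  exact sub_eq_zero.1 ((smul_eq_zero.1 h3).resolve_left (by norm_num))

/-- Multiplications by powers of `x` commute with multiplication by `x`, inside the Peirce
one-space of `f`. -/
theorem leftMul_pow_commute {x : V} (hx : f * x = x) (k : ℕ) (v : V) :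
    x * ((leftMul ℝ x ^ k) f * v) = (leftMul ℝ x ^ k) f * (x * v) := by
  -- The powers start at `f`, the unit of the Peirce one-space. Two consecutive powers are carried
  -- through the induction because the recursion for `L(x^(k+2))` involves both.
  have key (k : ℕ) : (∀ v, x * ((leftMul ℝ x ^ k) f * v) = (leftMul ℝ x ^ k) f * (x * v)) ∧
      ∀ v, x * ((leftMul ℝ x ^ (k + 1)) f * v) = (leftMul ℝ x ^ (k + 1)) f * (x * v) := by
    induction k with
    | zero =>
      refine ⟨fun v => ?_, fun v => ?_⟩
      · simpa using (hJ.peirce_one_commute hf hx v).symm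
      · simp [leftMul_apply, mul_comm x f, hx]
    | succ k ih =>
      refine ⟨ih.2, fun v => ?_⟩
      have hsq (v : V) : x * (x * x * v) = x * x * (x * v) := by
        have h := hJ.lie_sum x x x v
        have h2 : (3 : ℝ) • (x * (x * x * v) - x * x * (x * v)) = 0 := by
          linear_combination (norm := module) -h
        exact sub_eq_zero.1 ((smul_eq_zero.1 h2).resolve_left (by norm_num))
      obtain ⟨ih1, ih2⟩ := ih
      have hk (v : V) : (leftMul ℝ x ^ (k + 2)) f * v =
          x * x * ((leftMul ℝ x ^ k) f * v) + (leftMul ℝ x ^ (k + 1)) f * (x * v) +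
          (leftMul ℝ x ^ (k + 1)) f * (x * v) - x * (x * ((leftMul ℝ x ^ k) f * v)) -
            (leftMul ℝ x ^ k) f * (x * (x * v)) := by
        have h := hJ.lin x x ((leftMul ℝ x ^ k) f) v
        have e1 : x * (leftMul ℝ x ^ k) f = (leftMul ℝ x ^ (k + 1)) f := by
          rw [pow_succ']; rfl
        have e2 : x * (leftMul ℝ x ^ (k + 1)) f = (leftMul ℝ x ^ (k + 2)) f := by
          rw [pow_succ' _ (k + 1)]; rfl
        rw [e1, mul_comm _ x, e2] at h
        linear_combination (norm := abel) h
      rw [hk, hk, mul_sub, mul_sub, mul_add, mul_add, hsq, ih2, ih1, ih1, ih1]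
  exact (key k).1 v

end IsLinearJordan

end Peirce

theorem commute_aeval_right {K M : Type*} [Field K] [AddCommGroup M] [Module K M]
    {T S : Module.End K M} (h : Commute T S) (p : Polynomial K) :
    Commute T (Polynomial.aeval S p) := by
  induction p using Polynomial.induction_on' with
  | add p q hp hq => simpa using hp.add_right hq
  | monomial n a =>
    rw [Polynomial.aeval_monomial]
    exact (Algebra.commute_algebraMap_right a T).mul_right (h.pow_right n)

section

variable {V : Type*} [NonAssocCommRing V] [Module ℝ V] [IsScalarTower ℝ V V] [SMulCommClass ℝ V V]

/-- The Peirce one-space of a primitive idempotent is one-dimensional. -/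
theorem IsPrimitiveIdempotent.eq_smul [FiniteDimensional ℝ V] (hJ : IsLinearJordan V) {r : ℕ}
    (hpos : ∀ x : V, x ≠ 0 → 0 < traceForm r x x) {f : V} (hf : IsPrimitiveIdempotent f) {x : V}
    (hx : f * x = x) : ∃ μ : ℝ, x = μ • f := by
  obtain ⟨hf0, hff, hprim⟩ := hf
  obtain ⟨b, μ, hb⟩ := exists_eigenbasis (traceForm (V := V) r) (traceForm_symm r) hpos
    (leftMul ℝ x) fun y z => by
      rw [leftMul_apply, leftMul_apply, traceForm_mul_left hJ]
  have hbp (p : Polynomial ℝ) (i) :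
      (Polynomial.aeval (leftMul ℝ x) p) (b i) = p.eval (μ i) • b i :=
    Module.End.aeval_apply_of_hasEigenvector ⟨Module.End.mem_eigenspace_iff.2 (hb i), b.ne_zero i⟩
  have hext {p q : Polynomial ℝ} (h : ∀ i, p.eval (μ i) = q.eval (μ i)) :
      Polynomial.aeval (leftMul ℝ x) p = Polynomial.aeval (leftMul ℝ x) q :=
    b.ext fun i => by rw [hbp, hbp, h]
  have hfx : Commute (leftMul ℝ f) (leftMul ℝ x) :=
    LinearMap.ext fun v => hJ.peirce_one_commute hff hx v
  have hpf (p : Polynomial ℝ) :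
      f * (Polynomial.aeval (leftMul ℝ x) p) f = (Polynomial.aeval (leftMul ℝ x) p) f := by
    have := congrArg (fun T : Module.End ℝ V => T f) (commute_aeval_right hfx p).eq
    simpa [leftMul_apply, hff] using this
  have hpx (p : Polynomial ℝ) :
      Commute (leftMul ℝ ((Polynomial.aeval (leftMul ℝ x) p) f)) (leftMul ℝ x) := by
    refine LinearMap.ext fun v => ?_
    simp only [Module.End.mul_apply, leftMul_apply]
    induction p using Polynomial.induction_on' with
    | add p q hp hq => simp [add_mul, mul_add, hp, hq]
    | monomial n a =>
      simp only [Polynomial.aeval_monomial, Module.End.mul_apply, Module.algebraMap_end_apply,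
        smul_mul_assoc, mul_smul_comm, hJ.leftMul_pow_commute hff hx]
  obtain ⟨i, hi⟩ : ∃ i, b.repr f i ≠ 0 := by
    by_contra! h
    exact hf0 (b.repr.map_eq_zero_iff.1 (Finsupp.ext h))
  -- The Lagrange polynomial `q` is `1` at the eigenvalue `μ i` and `0` at the others, so `q(L(x))`
  -- is a spectral projection. The element `a = q(L(x)) f` is nonzero because `f` has a component
  -- along `b i`.
  let s := Finset.univ.image μ
  let q := Lagrange.basis s id (μ i)
  have hq (j) : q.eval (μ j) = if μ j = μ i then 1 else 0 := by
    split_ifs with h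
    · rw [h]
      exact Lagrange.eval_basis_self Function.injective_id.injOn
        (Finset.mem_image_of_mem _ (Finset.mem_univ _))
    · exact Lagrange.eval_basis_of_ne (v := id) (Ne.symm h)
        (Finset.mem_image_of_mem _ (Finset.mem_univ _))
  set a := (Polynomial.aeval (leftMul ℝ x) q) f with ha
  have haf : f * a = a := hpf q
  have ha0 : a ≠ 0 := by
    intro h0
    have h1 : b.repr a i = b.repr f i := by
      rw [ha]
      conv_lhs => rw [← b.sum_repr f]
      simp only [map_sum, map_smul, hbp, Finsupp.coe_finsetSum, Finset.sum_apply,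
        Finsupp.coe_smul, Pi.smul_apply, b.repr_self, smul_eq_mul]
      rw [Finset.sum_eq_single i]
      · simp [hq]
      · intro j _ hj; simp [hj]
      · simp
    rw [h0] at h1
    exact hi (by simpa using h1.symm)
  -- `L(a)` commutes with `L(x)`, hence with `q(L(x))`, so `a a = q(L(x)) (a f) = q(L(x))² f = a`.
  -- Primitivity then forces `a = f`.
  have haa : a * a = a := by
    have h1 := congrArg (fun T : Module.End ℝ V => T f) (commute_aeval_right (hpx q) q).eq
    simp only [Module.End.mul_apply, leftMul_apply] at h1
    rw [← ha, mul_comm a f, haf] at h1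
    rw [h1, ha, ← Module.End.mul_apply, ← map_mul]
    rw [hext (p := q * q) (q := q) fun j => by simp [hq]]
  have hfa : a = f := by
    have h1 := hprim a (f - a) haa ?_ ?_ (by abel)
    · exact (sub_eq_zero.1 (h1.resolve_left ha0)).symm
    · rw [mul_sub, sub_mul, sub_mul, hff, haa, mul_comm a f, haf]; abel
    · rw [mul_sub, haa, mul_comm a f, haf, sub_self]
  refine ⟨μ i, ?_⟩
  -- On the spectrum `X q = μ_i q`; applied to `f = a` this reads `x f = μ_i f`.
  have h2 : Polynomial.aeval (leftMul ℝ x) (Polynomial.X * q) =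
      Polynomial.aeval (leftMul ℝ x) (Polynomial.C (μ i) * q) := hext fun j => by
    simp only [Polynomial.eval_mul, Polynomial.eval_X, Polynomial.eval_C, hq]
    split_ifs with h <;> simp [h]
  have h3 := congrArg (fun T : Module.End ℝ V => T f) h2
  simp only [map_mul, Polynomial.aeval_X, Polynomial.aeval_C, Module.End.mul_apply,
    Module.algebraMap_end_apply, leftMul_apply] at h3
  rw [← ha, hfa, mul_comm, hx] at h3
  exact h3

end

/-! ### Peirce spaces of a Jordan frame and their common dimension. -/

section

variable {V : Type*} [NonAssocCommRing V] [Module ℝ V] [IsScalarTower ℝ V V] [SMulCommClass ℝ V V]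


theorem mem_peirceSpace {a b x : V} :
    x ∈ peirceSpace a b ↔ a * x = (1 / 2 : ℝ) • x ∧ b * x = (1 / 2 : ℝ) • x := by
  simp [peirceSpace, leftMul_apply, sub_eq_zero]

theorem peirceSpace_comm (a b : V) : peirceSpace a b = peirceSpace b a := inf_comm _ _

namespace IsJordanFrame

variable {r : ℕ} {c : Fin r → V} (hc : IsJordanFrame c)
include hc

theorem idem (i : Fin r) : c i * c i = c i := (hc.primitive i).2.1

theorem ne_zero (i : Fin r) : c i ≠ 0 := (hc.primitive i).1

theorem sum_mul (x : V) : ∑ i, c i * x = x := by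
  rw [← Finset.sum_mul, hc.complete, one_mul]

variable (hJ : IsLinearJordan V)
include hJ

theorem mul_left_comm (i j : Fin r) (x : V) : c i * (c j * x) = c j * (c i * x) := by
  by_cases h : i = j
  · rw [h]
  · exact hJ.peirce_zero_commute (hc.idem i) (hc.orthogonal i j h) x

theorem two_mul_mul_mul {i j : Fin r} (h : i ≠ j) (x : V) :
    (2 : ℝ) • (c i * (c i * (c j * x))) = c i * (c j * x) := by
  have h1 := hJ.lin (c i) (c i) (c j) x
  rw [hc.orthogonal i j h, hc.idem, hc.mul_left_comm hJ j i, hc.mul_left_comm hJ j i] at h1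
  simp only [zero_mul] at h1
  linear_combination (norm := module) h1

/-- For `i ≠ j`, `4 L(c_i) L(c_j)` is a projection onto the Peirce space `V_ij`. -/
theorem isProj {i j : Fin r} (h : i ≠ j) :
    LinearMap.IsProj (peirceSpace (c i) (c j)) ((4 : ℝ) • (leftMul ℝ (c i) * leftMul ℝ (c j))) where
  map_mem x := by
    have h1 := hc.two_mul_mul_mul hJ h x
    have h2 := hc.two_mul_mul_mul hJ h.symm x
    rw [hc.mul_left_comm hJ j i] at h2
    rw [mem_peirceSpace]
    simp only [LinearMap.smul_apply, Module.End.mul_apply, leftMul_apply, mul_smul_comm]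
    constructor
    · linear_combination (norm := module) (2 : ℝ) • h1
    · linear_combination (norm := module) (2 : ℝ) • h2
  map_id x hx := by
    rw [mem_peirceSpace] at hx
    simp only [LinearMap.smul_apply, Module.End.mul_apply, leftMul_apply, hx.1, hx.2, mul_smul_comm]
    module

variable {i j k : Fin r}

theorem mul_eq_self {u : V} (hij : i ≠ j) (hu : u ∈ peirceSpace (c i) (c j)) :
    (c i + c j) * (c i + c j) = c i + c j ∧ (c i + c j) * u = u := by
  rw [mem_peirceSpace] at hu
  refine ⟨?_, ?_⟩
  · simp only [add_mul, mul_add, hc.idem, hc.orthogonal i j hij, hc.orthogonal j i hij.symm]; abel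
  · rw [add_mul, hu.1, hu.2]; module

theorem mul_eq_zero {u : V} (hij : i ≠ j) (hki : k ≠ i) (hkj : k ≠ j)
    (hu : u ∈ peirceSpace (c i) (c j)) : c k * u = 0 := by
  obtain ⟨h1, h2⟩ := hc.mul_eq_self hJ hij hu
  rw [mul_comm]
  refine hJ.peirce_one_mul_zero h1 h2 ?_
  rw [add_mul, hc.orthogonal i k hki.symm, hc.orthogonal j k hkj.symm, add_zero]

theorem mul_mem {u v : V} (hij : i ≠ j) (hjk : j ≠ k) (hik : i ≠ k)
    (hu : u ∈ peirceSpace (c i) (c j)) (hv : v ∈ peirceSpace (c j) (c k)) :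
    u * v ∈ peirceSpace (c i) (c k) := by
  have h1 := hJ.peirce_zero_commute (hc.idem i) (hc.mul_eq_zero hJ hjk hij hik hv) u
  have h2 := hJ.peirce_zero_commute (hc.idem k) (hc.mul_eq_zero hJ hij hik.symm hjk.symm hu) v
  rw [mem_peirceSpace] at *
  rw [hu.1, mul_smul_comm, mul_comm v u] at h1
  rw [hv.2, mul_smul_comm] at h2
  exact ⟨h1, h2⟩

variable [FiniteDimensional ℝ V] (hpos : ∀ x : V, x ≠ 0 → 0 < traceForm r x x)
include hpos

/-- By primitivity `c_i u²` and `c_j u²` lie on the lines through `c_i` and `c_j`, and pairing with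
`c_i`, `c_j` finds the coefficients. The norms `(c_i | c_i)` stay in the formula, since their value
`1` is only known once `Tr L(c_i)` has been computed. -/
theorem mul_self_eq {u : V} (hij : i ≠ j) (hu : u ∈ peirceSpace (c i) (c j)) :
    ∃ μ ν : ℝ, u * u = μ • c i + ν • c j ∧
      μ * traceForm r (c i) (c i) = 1 / 2 * traceForm r u u ∧
      ν * traceForm r (c j) (c j) = 1 / 2 * traceForm r u u := by
  obtain ⟨h1, h2⟩ := hc.mul_eq_self hJ hij hu
  rw [mem_peirceSpace] at hu
  obtain ⟨μ, hμ⟩ := (hc.primitive i).eq_smul hJ hpos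
    (hJ.peirce_half_mul_half (hc.idem i) hu.1 hu.1)
  obtain ⟨ν, hν⟩ := (hc.primitive j).eq_smul hJ hpos
    (hJ.peirce_half_mul_half (hc.idem j) hu.2 hu.2)
  refine ⟨μ, ν, ?_, ?_, ?_⟩
  · rw [← hμ, ← hν, ← add_mul, hJ.peirce_one_commute h1 h2, h2]
  · have := congrArg (fun x => traceForm r x (c i)) hμ
    simp only [map_smul, LinearMap.smul_apply, smul_eq_mul] at this
    rw [← this, traceForm_mul_left hJ, hc.idem, traceForm_mul_right hJ, mul_comm u, hu.1]
    simp
  · have := congrArg (fun x => traceForm r x (c j)) hν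
    simp only [map_smul, LinearMap.smul_apply, smul_eq_mul] at this
    rw [← this, traceForm_mul_left hJ, hc.idem, traceForm_mul_right hJ, mul_comm u, hu.2]
    simp

/-- On `V_jk` the zero-space of `c_k` acts by `L(u²) = 2 L(u)²`, and `u²` acts there through its
`c_j`-coefficient, which is nonzero by positivity. So a nonzero `u ∈ V_ij` embeds `V_jk` into
`V_ik`. -/
theorem mul_mul_eq {u : V} (hij : i ≠ j) (hjk : j ≠ k) (hik : i ≠ k) (hu0 : u ≠ 0)
    (hu : u ∈ peirceSpace (c i) (c j)) :
    ∃ ν : ℝ, ν ≠ 0 ∧ ∀ v ∈ peirceSpace (c j) (c k), u * (u * v) = ν • v := by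
  obtain ⟨μ, ν, h, -, hν⟩ := hc.mul_self_eq hJ hpos hij hu
  have hν0 : ν ≠ 0 := by
    rintro rfl
    have := hpos u hu0
    linarith
  refine ⟨ν / 4, by simpa using hν0, fun v hv => ?_⟩
  have hz := hc.mul_eq_zero hJ hij hik.symm hjk.symm hu
  have hiv := hc.mul_eq_zero hJ hjk hij hik hv
  rw [mem_peirceSpace] at hv
  have h1 := hJ.peirce_half_mul_mul (hc.idem k) hz hz hv.2
  rw [h, add_mul, smul_mul_assoc, smul_mul_assoc, hiv, hv.1] at h1
  linear_combination (norm := module) -(1 / 2 : ℝ) • h1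

theorem finrank_le (hij : i ≠ j) (hjk : j ≠ k) (hik : i ≠ k)
    (h : peirceSpace (c i) (c j) ≠ ⊥) :
    Module.finrank ℝ (peirceSpace (c j) (c k)) ≤ Module.finrank ℝ (peirceSpace (c i) (c k)) := by
  obtain ⟨u, hu, hu0⟩ := Submodule.exists_mem_ne_zero_of_ne_bot h
  obtain ⟨ν, hν, h⟩ := hc.mul_mul_eq hJ hpos hij hjk hik hu0 hu
  refine LinearMap.finrank_le_finrank_of_injective
    (f := (leftMul ℝ u).restrict fun v hv => hc.mul_mem hJ hij hjk hik hu hv) ?_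
  rw [injective_iff_map_eq_zero]
  rintro ⟨v, hv⟩ h0
  have h1 : u * v = 0 := congrArg Subtype.val h0
  have h2 := h v hv
  rw [h1, mul_zero] at h2
  exact Subtype.ext ((smul_eq_zero.1 h2.symm).resolve_left hν)

theorem peirceSpace_ne_bot_trans (hij : i ≠ j) (hjk : j ≠ k) (hik : i ≠ k)
    (h : peirceSpace (c i) (c j) ≠ ⊥) (h' : peirceSpace (c j) (c k) ≠ ⊥) :
    peirceSpace (c i) (c k) ≠ ⊥ := by
  intro h0
  have := hc.finrank_le hJ hpos hij hjk hik h
  rw [h0, finrank_bot, Nat.le_zero, Submodule.finrank_eq_zero] at this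
  exact h' this

/-- Let `S` be the set of indices linked to `i` by a nonzero Peirce space; linkage is transitive. No
`V_kl` joins `S` to its complement, so the idempotent `f = ∑_{k ∈ S} c_k` has no half-space and its
one-space is an ideal. It contains `c_i`, so by simplicity it is everything and `f = 1`. -/
theorem peirceSpace_ne_bot [hS : IsSimpleRing V] (hij : i ≠ j) : peirceSpace (c i) (c j) ≠ ⊥ := by
  classical
  let R : Fin r → Prop := fun k => k = i ∨ peirceSpace (c i) (c k) ≠ ⊥
  let S := Finset.univ.filter R
  suffices h : j ∈ S by
    rcases (Finset.mem_filter.1 h).2 with h | h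
    · exact absurd h.symm hij
    · exact h
  let f := ∑ k ∈ S, c k
  have hcf (k) : c k * f = if k ∈ S then c k else 0 := by
    simp only [f, Finset.mul_sum]
    rw [Finset.sum_congr rfl fun l _ => show c k * c l = if l = k then c k else 0 by
      split_ifs with h
      · rw [h, hc.idem]
      · exact hc.orthogonal k l (Ne.symm h)]
    simp
  have hff : f * f = f := by
    conv_lhs => enter [1]; simp only [f]
    rw [Finset.sum_mul]
    exact Finset.sum_congr rfl fun k hk => by rw [hcf, if_pos hk]
  have hdis {k l : Fin r} (hk : k ∈ S) (hl : l ∉ S) (x : V) : c k * (c l * x) = 0 := by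
    have hkl : k ≠ l := fun h => hl (h ▸ hk)
    have hb : peirceSpace (c k) (c l) = ⊥ := by
      by_contra hb
      refine hl (Finset.mem_filter.2 ⟨Finset.mem_univ _, ?_⟩)
      rcases (Finset.mem_filter.1 hk).2 with h | h
      · exact Or.inr (h ▸ hb)
      · by_cases hki : k = i
        · exact Or.inr (hki ▸ hb)
        by_cases hli : l = i
        · exact Or.inl hli
        exact Or.inr (hc.peirceSpace_ne_bot_trans hJ hpos (Ne.symm hki) hkl (Ne.symm hli) h hb)
    have h1 := (hc.isProj hJ hkl).map_mem x
    rw [hb, Submodule.mem_bot, LinearMap.smul_apply] at h1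
    exact (smul_eq_zero.1 h1).resolve_left (by norm_num)
  have hfff (x : V) : f * (f * x) = f * x := by
    have h1 : x = f * x + ∑ l ∈ Sᶜ, c l * x := by
      conv_lhs => rw [← hc.sum_mul x, ← Finset.sum_add_sum_compl S, ← Finset.sum_mul]
    have h2 : f * ∑ l ∈ Sᶜ, c l * x = 0 := by
      simp only [f, Finset.mul_sum, Finset.sum_mul]
      exact Finset.sum_eq_zero fun l hl => Finset.sum_eq_zero fun k hk =>
        hdis hk (Finset.mem_compl.1 hl) x
    conv_rhs => rw [h1, mul_add, h2, add_zero]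
  have hmul {x y : V} (hx : f * x = x) : f * (x * y) = x * y := by
    have h1 : x * (y - f * y) = 0 := hJ.peirce_one_mul_zero hff hx (by rw [mul_sub, hfff, sub_self])
    rw [mul_sub, sub_eq_zero] at h1
    rw [hJ.peirce_one_commute hff hx, ← h1]
  let I : TwoSidedIdeal V := TwoSidedIdeal.mk' {x | f * x = x} (mul_zero f)
    (fun {x y} hx hy => by
      rw [Set.mem_ofPred_eq] at *
      rw [mul_add, hx, hy])
    (fun {x} hx => by
      rw [Set.mem_ofPred_eq] at *
      rw [mul_neg, hx])
    (fun {x y} hy => by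
      rw [Set.mem_ofPred_eq] at *
      rw [mul_comm x y, hmul hy]) (fun {x y} hx => hmul hx)
  have hI (x : V) : x ∈ I ↔ f * x = x := TwoSidedIdeal.mem_mk' _ _ _ _ _ _ _
  have hiS : i ∈ S := Finset.mem_filter.2 ⟨Finset.mem_univ _, Or.inl rfl⟩
  rcases eq_bot_or_eq_top I with h | h
  · have h1 : c i ∈ I := by rw [hI, mul_comm, hcf, if_pos hiS]
    rw [h] at h1
    exact absurd h1 (hc.ne_zero i)
  · have h1 : (1 : V) ∈ I := by rw [h]; trivial
    rw [hI, mul_one] at h1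
    by_contra hj
    have h2 := hcf j
    rw [h1, mul_one, if_neg hj] at h2
    exact hc.ne_zero j h2

/-- Since no `V_ij` vanishes, `finrank_le` holds in both directions; any two index pairs are joined
by changing one index at a time. -/
theorem finrank_eq [IsSimpleRing V] {i' j' : Fin r} (hij : i ≠ j) (hij' : i' ≠ j') :
    Module.finrank ℝ (peirceSpace (c i) (c j)) = Module.finrank ℝ (peirceSpace (c i') (c j')) := by
  have hne {i j : Fin r} (h : i ≠ j) := hc.peirceSpace_ne_bot hJ hpos h
  have key {i j k : Fin r} (hik : i ≠ k) (hjk : j ≠ k) :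
      Module.finrank ℝ (peirceSpace (c i) (c k)) = Module.finrank ℝ (peirceSpace (c j) (c k)) := by
    by_cases hij : i = j
    · rw [hij]
    exact le_antisymm (hc.finrank_le hJ hpos (Ne.symm hij) hik hjk (hne (Ne.symm hij)))
      (hc.finrank_le hJ hpos hij hjk hik (hne hij))
  have key' {i j k : Fin r} (hik : i ≠ k) (hjk : i ≠ j) :
      Module.finrank ℝ (peirceSpace (c i) (c k)) = Module.finrank ℝ (peirceSpace (c i) (c j)) := by
    rw [peirceSpace_comm, peirceSpace_comm (c i)]
    exact key hik.symm hjk.symm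
  by_cases h : i' = j
  · subst h
    rw [peirceSpace_comm]
    exact key' hij.symm hij'
  · rw [key hij h, key' h hij']

end IsJordanFrame
end

/-! ### Orthonormal bases, traces on Peirce spaces and the parameter `λ`. -/

section Orthonormal

variable {K M N ι : Type*} [Field K] [AddCommGroup M] [Module K M] [AddCommGroup N] [Module K N]
  [Fintype ι]

/-- A basis that is orthonormal for a bilinear form. -/
def IsOrthonormalBasis (F : LinearMap.BilinForm K M) (b : Module.Basis ι K M) : Prop :=
  (∀ α, F (b α) (b α) = 1) ∧ ∀ α β, α ≠ β → F (b α) (b β) = 0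

variable {F : LinearMap.BilinForm K M} {b : Module.Basis ι K M} (hb : IsOrthonormalBasis F b)
include hb

theorem IsOrthonormalBasis.repr_eq (x : M) (α : ι) : b.repr x α = F x (b α) := by
  conv_rhs => rw [← b.sum_repr x]
  rw [map_sum, LinearMap.sum_apply, Finset.sum_eq_single α]
  · simp [hb.1]
  · intro β _ h; simp [hb.2 β α h]
  · simp

theorem IsOrthonormalBasis.sum_eq (x : M) : ∑ α, F x (b α) • b α = x := by
  conv_rhs => rw [← b.sum_repr x]
  simp only [hb.repr_eq]

theorem IsOrthonormalBasis.trace_eq (T : Module.End K M) :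
    LinearMap.trace K M T = ∑ α, F (T (b α)) (b α) := by
  classical
  rw [LinearMap.trace_eq_matrix_trace K b, Matrix.trace]
  exact Finset.sum_congr rfl fun α _ => by
    rw [Matrix.diag_apply, LinearMap.toMatrix_apply, hb.repr_eq]

/-- The tensor `∑ b_α ⊗ b_α` is dual to the form, so an operator on one factor equals its adjoint on
the other. -/
theorem IsOrthonormalBasis.sum_adjoint (B : M →ₗ[K] M →ₗ[K] N) {A A' : Module.End K M}
    (hA : ∀ x y, F (A x) y = F x (A' y)) (hsymm : ∀ x y, F x y = F y x) :
    ∑ α, B (A (b α)) (b α) = ∑ α, B (b α) (A' (b α)) := by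
  have h1 (α) : B (A (b α)) (b α) = ∑ β, F (A (b α)) (b β) • B (b β) (b α) := by
    conv_lhs => rw [← hb.sum_eq (A (b α))]
    simp
  have h2 (β) : B (b β) (A' (b β)) = ∑ α, F (A (b α)) (b β) • B (b β) (b α) := by
    conv_lhs => rw [← hb.sum_eq (A' (b β))]
    simp [hA, hsymm _ (A' (b β))]
  simp only [h1, h2]
  exact Finset.sum_comm

theorem IsOrthonormalBasis.sum_mul (x y : M) : ∑ α, F x (b α) * F y (b α) = F x y := by
  conv_rhs => rw [← hb.sum_eq y]
  simp [mul_comm]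

end Orthonormal

section

variable {V : Type*} [NonAssocCommRing V] [Module ℝ V] [IsScalarTower ℝ V V] [SMulCommClass ℝ V V]

/-- An orthonormal basis turns the form into a sum of squares; this is the source of all positivity.
-/
theorem IsOrthonormalBasis.pos {ι : Type*} [Fintype ι] {r : ℕ} {e : Module.Basis ι ℝ V}
    (he : IsOrthonormalBasis (traceForm r) e) (x : V) (hx : x ≠ 0) : 0 < traceForm r x x := by
  rw [← he.sum_mul]
  refine lt_of_le_of_ne (Finset.sum_nonneg fun α _ => mul_self_nonneg _) fun h => hx ?_
  have h1 := (Finset.sum_eq_zero_iff_of_nonneg fun α _ => mul_self_nonneg _).1 h.symm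
  rw [← he.sum_eq x]
  exact Finset.sum_eq_zero fun α hα => by rw [mul_self_eq_zero.1 (h1 α hα), zero_smul]

theorem traceForm_one (r : ℕ) (x : V) : traceForm r x 1 = jordanTrace r x := by
  rw [traceForm_apply, mul_one]

/-- The projection `4 L(f) (1 - L(f))` onto the Peirce half-space of an idempotent. -/
def halfProj (f : V) : Module.End ℝ V := (4 : ℝ) • (leftMul ℝ f - leftMul ℝ f * leftMul ℝ f)

theorem halfProj_apply (f x : V) : halfProj f x = (4 : ℝ) • (f * x - f * (f * x)) := rfl

theorem halfProj_symm (hJ : IsLinearJordan V) (r : ℕ) (f x y : V) :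
    traceForm r (halfProj f x) y = traceForm r x (halfProj f y) := by
  simp only [halfProj_apply, map_smul, map_sub, LinearMap.smul_apply, LinearMap.sub_apply,
    traceForm_mul_left hJ]

theorem mul_halfProj (hJ : IsLinearJordan V) {f : V} (hf : f * f = f) (x : V) :
    f * halfProj f x = (1 / 2 : ℝ) • halfProj f x := by
  have h := hJ.peirce_cubic hf x
  simp only [halfProj_apply, mul_smul_comm, mul_sub]
  linear_combination (norm := module) (-2 : ℝ) • h

theorem halfProj_of_mem {f x : V} (hx : f * x = (1 / 2 : ℝ) • x) : halfProj f x = x := by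
  simp only [halfProj_apply, hx, mul_smul_comm]
  module


namespace IsJordanFrame

variable {r : ℕ} {c : Fin r → V} (hc : IsJordanFrame c) (hJ : IsLinearJordan V) {lam : ℝ}
  (hlam : ∀ i j, i ≠ j → (Module.finrank ℝ (peirceSpace (c i) (c j)) : ℝ) = 2 * lam)
  [FiniteDimensional ℝ V]
include hc hJ hlam

/-- The parameter enters only through `hlam`, which is vacuous for `r = 1`; both cases of the
Wallach parameter are thereby treated together. -/
theorem trace_proj {i j : Fin r} (h : i ≠ j) :
    LinearMap.trace ℝ V ((4 : ℝ) • (leftMul ℝ (c i) * leftMul ℝ (c j))) = 2 * lam := by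
  rw [(hc.isProj hJ h).trace, hlam i j h]

theorem halfProj_eq (i : Fin r) : halfProj (c i) =
    ∑ j ∈ Finset.univ.erase i, (4 : ℝ) • (leftMul ℝ (c i) * leftMul ℝ (c j)) := by
  ext x
  have h := hc.sum_mul x
  rw [← Finset.add_sum_erase _ _ (Finset.mem_univ i)] at h
  rw [halfProj_apply, ← Finset.smul_sum, ← Finset.mul_sum]
  simp only [LinearMap.smul_apply, Module.End.mul_apply, leftMul_apply, LinearMap.sum_apply]
  rw [← mul_sub]
  congr 2
  linear_combination (norm := abel) -h

variable (hpos : ∀ x : V, x ≠ 0 → 0 < traceForm r x x)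
include hpos

/-- `L(c_i)` is the projection to the line `ℝ c_i`, given by `2 L(c_i)² - L(c_i)`, plus half the
projection to the half-space `⨁_{j ≠ i} V_ij`, of dimension `2 (r - 1) λ`. -/
theorem trace_leftMul (i : Fin r) : LinearMap.trace ℝ V (leftMul ℝ (c i)) = 1 + (r - 1) * lam := by
  have h1 : LinearMap.IsProj (Submodule.span ℝ {c i})
      ((2 : ℝ) • (leftMul ℝ (c i) * leftMul ℝ (c i)) - leftMul ℝ (c i)) := by
    constructor
    · intro x
      obtain ⟨μ, hμ⟩ := (hc.primitive i).eq_smul (x := (2 : ℝ) • (c i * (c i * x)) - c i * x)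
        hJ hpos (by
          rw [mul_sub, mul_smul_comm]
          linear_combination (norm := module) hJ.peirce_cubic (hc.idem i) x)
      exact Submodule.mem_span_singleton.2 ⟨μ, hμ.symm⟩
    · intro x hx
      obtain ⟨μ, rfl⟩ := Submodule.mem_span_singleton.1 hx
      simp only [LinearMap.sub_apply, LinearMap.smul_apply, Module.End.mul_apply, leftMul_apply,
        mul_smul_comm, hc.idem]
      module
  have h2 := h1.trace
  rw [finrank_span_singleton (hc.ne_zero i)] at h2
  have h3 : leftMul ℝ (c i) = ((2 : ℝ) • (leftMul ℝ (c i) * leftMul ℝ (c i)) - leftMul ℝ (c i)) +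
      (1 / 2 : ℝ) • halfProj (c i) := by
    rw [halfProj]; module
  rw [h3, map_add, h2, map_smul, hc.halfProj_eq hJ hlam, map_sum,
    Finset.sum_congr rfl fun j hj => hc.trace_proj hJ hlam (Finset.ne_of_mem_erase hj).symm,
    Finset.sum_const, Finset.card_erase_of_mem (Finset.mem_univ i), Finset.card_univ,
    Fintype.card_fin, nsmul_eq_mul, Nat.cast_sub (Nat.one_le_iff_ne_zero.2 i.pos.ne')]
  simp only [smul_eq_mul]
  push_cast
  ring

theorem finrank_eq_mul : (Module.finrank ℝ V : ℝ) = r * (1 + (r - 1) * lam) := by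
  have h : (1 : Module.End ℝ V) = ∑ i, leftMul ℝ (c i) := by
    ext x; simp [leftMul_apply, hc.sum_mul]
  rw [← LinearMap.trace_one, h, map_sum,
    Finset.sum_congr rfl fun i _ => hc.trace_leftMul hJ hlam hpos i]
  simp only [Finset.sum_const, Finset.card_univ, Fintype.card_fin, nsmul_eq_mul]

theorem jordanTrace_eq_one (i : Fin r) : jordanTrace r (c i) = 1 := by
  have hV : Nontrivial V := ⟨c i, 0, hc.ne_zero i⟩
  have hn : (Module.finrank ℝ V : ℝ) ≠ 0 := by exact_mod_cast Module.finrank_pos.ne'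
  rw [jordanTrace_apply, hc.trace_leftMul hJ hlam hpos, div_mul_eq_mul_div,
    ← hc.finrank_eq_mul hJ hlam hpos, div_self hn]

theorem traceForm_self (i : Fin r) : traceForm r (c i) (c i) = 1 := by
  rw [traceForm_apply, hc.idem, hc.jordanTrace_eq_one hJ hlam hpos]

theorem jordanTrace_one : jordanTrace r (1 : V) = r := by
  rw [← hc.complete, map_sum, Finset.sum_congr rfl fun i _ => hc.jordanTrace_eq_one hJ hlam hpos i]
  simp

theorem eq_traceForm_smul {i : Fin r} {x : V} (hx : c i * x = x) :
    x = traceForm r x (c i) • c i := by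
  obtain ⟨μ, rfl⟩ := (hc.primitive i).eq_smul hJ hpos hx
  simp [hc.traceForm_self hJ hlam hpos]

variable {ι : Type*} [Fintype ι] {e : Module.Basis ι ℝ V}
  (he : IsOrthonormalBasis (traceForm r) e)
include he

/-- For `u ∈ V_ij` one has `(y u | u) = (y | u²) = ½ (u|u) (y | c_j)`, the `c_i`-part of `u²` being
orthogonal to `y`. Summing over `V_ij`, of dimension `2λ`, gives the trace. -/
theorem trace_leftMul_mul_proj {i j : Fin r} (h : i ≠ j) {y : V} (hy : c i * y = 0) :
    LinearMap.trace ℝ V (leftMul ℝ y * ((4 : ℝ) • (leftMul ℝ (c i) * leftMul ℝ (c j)))) =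
      lam * traceForm r y (c j) := by
  set p := (4 : ℝ) • (leftMul ℝ (c i) * leftMul ℝ (c j)) with hp
  have hproj : LinearMap.IsProj _ p := hc.isProj hJ h
  have hpp : p * p = p := LinearMap.ext fun x => hproj.map_id _ (hproj.map_mem x)
  have hsymm (x z : V) : traceForm r (p x) z = traceForm r x (p z) := by
    simp only [hp, LinearMap.smul_apply, map_smul, Module.End.mul_apply, leftMul_apply,
      traceForm_mul_left hJ, hc.mul_left_comm hJ j i]
  have hterm (x : V) : traceForm r (p (y * p x)) x =
      1 / 2 * traceForm r y (c j) * traceForm r (p x) x := by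
    obtain ⟨μ, ν, h1, h2, h3⟩ := hc.mul_self_eq hJ hpos h (hproj.map_mem x)
    rw [hc.traceForm_self hJ hlam hpos, mul_one] at h2 h3
    have h4 : traceForm r (p x) (p x) = traceForm r (p x) x := by
      rw [hsymm, ← Module.End.mul_apply, hpp, hsymm]
    have h5 : traceForm r y (c i) = 0 := by
      rw [← hc.idem i, ← traceForm_mul_left hJ, hy]; simp
    rw [hsymm, traceForm_mul_right hJ, h1, h2, h3, h4]
    simp only [map_add, map_smul, smul_eq_mul, h5]
    ring
  have h1 : LinearMap.trace ℝ V (leftMul ℝ y * p) =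
      LinearMap.trace ℝ V (p * (leftMul ℝ y * p)) := by
    rw [LinearMap.trace_mul_comm ℝ p, mul_assoc, hpp]
  rw [h1, he.trace_eq]
  simp only [Module.End.mul_apply, leftMul_apply, hterm]
  rw [← Finset.mul_sum, ← he.trace_eq, hc.trace_proj hJ hlam h]
  ring

theorem trace_leftMul_mul_halfProj {i : Fin r} {y : V} (hy : c i * y = 0) :
    LinearMap.trace ℝ V (leftMul ℝ y * halfProj (c i)) = lam * jordanTrace r y := by
  rw [hc.halfProj_eq hJ hlam, Finset.mul_sum, map_sum, Finset.sum_congr rfl fun j hj =>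
    hc.trace_leftMul_mul_proj hJ hlam hpos he (Finset.ne_of_mem_erase hj).symm hy,
    ← Finset.mul_sum, ← map_sum, ← traceForm_one, ← hc.complete,
    ← Finset.add_sum_erase _ _ (Finset.mem_univ i), map_add]
  rw [← hc.idem i, ← traceForm_mul_left hJ, hy]
  simp

/-- The identity that singles out the Wallach parameter. -/
theorem sum_halfProj {i : Fin r} {v : V} (hv : c i * v = 0) :
    ∑ α, (2 : ℝ) • (halfProj (c i) (e α) * (v * halfProj (c i) (e α)) -
      c i * (halfProj (c i) (e α) * (v * halfProj (c i) (e α)))) = lam • v := by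
  have hf := hc.idem i
  set p := halfProj (c i) with hp
  have hup (x : V) : c i * p x = (1 / 2 : ℝ) • p x := mul_halfProj hJ hf x
  have hpp : p * p = p := LinearMap.ext fun x => halfProj_of_mem (hup x)
  have hvu (x : V) : c i * (v * p x) = (1 / 2 : ℝ) • (v * p x) := by
    rw [hJ.peirce_zero_commute hf hv, hup, mul_smul_comm]
  set Y := ∑ α, (2 : ℝ) • (p (e α) * (v * p (e α)) - c i * (p (e α) * (v * p (e α)))) with hY
  -- Both sides lie in the zero-space of `c_i`, so it suffices to pair them with elements `w` of
  -- that space.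
  have hY0 : c i * (Y - lam • v) = 0 := by
    rw [mul_sub, mul_smul_comm, hv, smul_zero, sub_zero, hY, Finset.mul_sum]
    refine Finset.sum_eq_zero fun α _ => ?_
    rw [mul_smul_comm, mul_sub, hJ.peirce_half_mul_half hf (hup _) (hvu _), sub_self, smul_zero]
  -- The factor `2` matches `L(vw) = L(v)L(w) + L(w)L(v)` on the half-space, so the pairing becomes
  -- the trace of `L(vw)` on the half-space, already computed.
  have key (w : V) (hw : c i * w = 0) : traceForm r Y w = lam * traceForm r v w := by
    have hvw : c i * (v * w) = 0 := by rw [hJ.peirce_zero_commute hf hv, hw, mul_zero]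
    have h1 (x : V) : traceForm r ((2 : ℝ) • (p x * (v * p x) - c i * (p x * (v * p x)))) w =
        traceForm r ((p * (leftMul ℝ (v * w) * p)) x) x := by
      rw [map_smul, map_sub, LinearMap.smul_apply, LinearMap.sub_apply,
        traceForm_mul_left hJ r (c i), hw, Module.End.mul_apply, halfProj_symm hJ,
        Module.End.mul_apply, leftMul_apply, hJ.peirce_half_mul_mul hf hv hw (hup x)]
      simp only [map_add, LinearMap.add_apply, map_zero, sub_zero, smul_eq_mul]
      have e1 : traceForm r (p x * (v * p x)) w = traceForm r (w * (v * p x)) (p x) := by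
        rw [traceForm_mul_left hJ, mul_comm (p x) w, ← traceForm_mul_left hJ]
      have e2 : traceForm r (v * (w * p x)) (p x) = traceForm r (w * (v * p x)) (p x) := by
        rw [traceForm_mul_left hJ, traceForm_symm, ← traceForm_mul_left hJ]
      rw [e1, e2]; ring
    rw [hY, map_sum, LinearMap.sum_apply]
    simp only [h1]
    rw [← he.trace_eq, LinearMap.trace_mul_comm, mul_assoc, hpp,
      hc.trace_leftMul_mul_halfProj hJ hlam hpos he hvw, traceForm_apply]
  have h0 : traceForm r (Y - lam • v) (Y - lam • v) = 0 := by
    have := key _ hY0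
    rw [map_sub (traceForm (V := V) r), LinearMap.sub_apply, this, map_smul (traceForm (V := V) r), LinearMap.smul_apply, smul_eq_mul, sub_self]
  by_contra hne
  exact (hpos _ (sub_ne_zero.2 hne)).ne' h0

end IsJordanFrame

end

/-! ### Adjoints, the complexification and the structure group. -/

section Adjoint

variable {K M ι : Type*} [Field K] [AddCommGroup M] [Module K M] [Fintype ι] [DecidableEq ι]

/-- The adjoint of an endomorphism with respect to an orthonormal basis. -/
def adjointMap (b : Module.Basis ι K M) : Module.End K M →ₗ[K] Module.End K M :=
  (Matrix.toLin b b).toLinearMap ∘ₗ (Matrix.transposeLinearEquiv ι ι K K).toLinearMap ∘ₗ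
    (LinearMap.toMatrix b b).toLinearMap

variable {F : LinearMap.BilinForm K M} {b : Module.Basis ι K M} (hb : IsOrthonormalBasis F b)
  (hsymm : ∀ x y, F x y = F y x)
include hb hsymm

theorem adjointMap_apply (T : Module.End K M) (x y : M) :
    F (adjointMap b T x) y = F x (T y) := by
  have h : F ∘ₗ adjointMap b T = F.compl₂ T := by
    refine b.ext fun α => b.ext fun β => ?_
    rw [LinearMap.comp_apply, LinearMap.compl₂_apply, ← hb.repr_eq, hsymm, ← hb.repr_eq,
      ← LinearMap.toMatrix_apply b b T]
    simp [adjointMap, Matrix.toLin_self, Finsupp.single_apply]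
  exact congrArg (fun G => G x y) h

omit [Fintype ι] [DecidableEq ι] in
theorem eq_of_forall_form [Fintype ι] {x y : M} (h : ∀ z, F x z = F y z) : x = y := by
  rw [← hb.sum_eq x, ← hb.sum_eq y]
  simp only [h]

theorem eq_adjointMap {T T' : Module.End K M} (h : ∀ x y, F (T' x) y = F x (T y)) :
    T' = adjointMap b T :=
  LinearMap.ext fun x => eq_of_forall_form hb hsymm fun z => by
    rw [h, adjointMap_apply hb hsymm]

theorem adjointMap_mul (S T : Module.End K M) :
    adjointMap b (S * T) = adjointMap b T * adjointMap b S :=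
  (eq_adjointMap hb hsymm fun x y => by
    simp only [Module.End.mul_apply, adjointMap_apply hb hsymm]).symm

theorem adjointMap_one : adjointMap b (1 : Module.End K M) = 1 :=
  (eq_adjointMap hb hsymm fun x y => by simp).symm

theorem adjointMap_adjointMap (T : Module.End K M) : adjointMap b (adjointMap b T) = T :=
  (eq_adjointMap hb hsymm fun x y => by
    rw [hsymm, ← adjointMap_apply hb hsymm, hsymm]).symm

end Adjoint

section Complexification

variable {V : Type*} [NonAssocCommRing V] [Module ℝ V] [IsScalarTower ℝ V V] [SMulCommClass ℝ V V]

theorem tmul_eq_smul (z : ℂ) (v : V) : z ⊗ₜ[ℝ] v = z • ((1 : ℂ) ⊗ₜ[ℝ] v) := by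
  rw [TensorProduct.smul_tmul', smul_eq_mul, mul_one]

theorem one_tmul_mul (v w : V) : (1 : ℂ) ⊗ₜ[ℝ] v * (1 : ℂ) ⊗ₜ[ℝ] w = 1 ⊗ₜ[ℝ] (v * w) := by
  rw [Algebra.TensorProduct.tmul_mul_tmul, mul_one]

/-- Identities that are `ℂ`-linear in an argument need only be checked on real vectors. -/
theorem real_induction {p : ℂ ⊗[ℝ] V → Prop} (z : ℂ ⊗[ℝ] V) (h1 : ∀ v : V, p (1 ⊗ₜ v))
    (hs : ∀ (a : ℂ) x, p x → p (a • x)) (ha : ∀ x y, p x → p y → p (x + y)) : p z := by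
  induction z using TensorProduct.induction_on with
  | zero => simpa using hs 0 _ (h1 0)
  | tmul a v => rw [tmul_eq_smul]; exact hs _ _ (h1 v)
  | add x y hx hy => exact ha _ _ hx hy

theorem IsLinearJordan.complexify (hJ : IsLinearJordan V) : IsLinearJordan (ℂ ⊗[ℝ] V) where
  comm x y := by
    induction x using real_induction with
    | ha x x' h h' => rw [add_mul, mul_add, h, h']
    | hs a x h => rw [smul_mul_assoc, mul_smul_comm, h]
    | h1 v =>
      induction y using real_induction with
      | ha x x' h h' => rw [add_mul, mul_add, h, h']
      | hs a x h => rw [smul_mul_assoc, mul_smul_comm, h]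
      | h1 w => rw [one_tmul_mul, one_tmul_mul, mul_comm]
  lin a b d x := by
    induction a using real_induction with
    | ha y z h h' =>
      simp only [add_mul, mul_add]; linear_combination (norm := abel) h + h'
    | hs s y h =>
      simp only [smul_mul_assoc, mul_smul_comm]; linear_combination (norm := module) s • h
    | h1 a =>
    induction b using real_induction with
    | ha y z h h' =>
      simp only [add_mul, mul_add]; linear_combination (norm := abel) h + h'
    | hs s y h =>
      simp only [smul_mul_assoc, mul_smul_comm]; linear_combination (norm := module) s • h
    | h1 b =>
    induction d using real_induction with
    | ha y z h h' =>
      simp only [add_mul, mul_add]; linear_combination (norm := abel) h + h'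
    | hs s y h =>
      simp only [smul_mul_assoc, mul_smul_comm]; linear_combination (norm := module) s • h
    | h1 d =>
    induction x using real_induction with
    | ha y z h h' =>
      simp only [mul_add]; linear_combination (norm := abel) h + h'
    | hs s y h =>
      simp only [mul_smul_comm]; linear_combination (norm := module) s • h
    | h1 x => simp only [one_tmul_mul, ← TensorProduct.tmul_add, hJ.lin a b d x]

theorem traceFormC_tmul (r : ℕ) (v w : V) :
    traceFormC r ((1 : ℂ) ⊗ₜ[ℝ] v) (1 ⊗ₜ[ℝ] w) = (traceForm r v w : ℂ) := by
  simp [traceFormC]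

theorem traceFormC_symm (r : ℕ) (x y : ℂ ⊗[ℝ] V) : traceFormC r x y = traceFormC r y x := by
  induction x using real_induction with
  | ha x x' h h' => simp only [map_add, LinearMap.add_apply, h, h']
  | hs a x h => simp only [map_smul, LinearMap.smul_apply, h]
  | h1 v =>
    induction y using real_induction with
    | ha x x' h h' => simp only [map_add, LinearMap.add_apply, h, h']
    | hs a x h => simp only [map_smul, LinearMap.smul_apply, h]
    | h1 w => rw [traceFormC_tmul, traceFormC_tmul, traceForm_symm]

theorem traceFormC_mul_left (hJ : IsLinearJordan V) (r : ℕ) (x y z : ℂ ⊗[ℝ] V) :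
    traceFormC r (x * y) z = traceFormC r y (x * z) := by
  induction x using real_induction with
  | ha x x' h h' => simp only [map_add, LinearMap.add_apply, add_mul, h, h']
  | hs a x h => simp only [map_smul, LinearMap.smul_apply, smul_mul_assoc, h]
  | h1 v =>
  induction y using real_induction with
  | ha x x' h h' => simp only [map_add, LinearMap.add_apply, mul_add, h, h']
  | hs a x h => simp only [map_smul, LinearMap.smul_apply, mul_smul_comm, h]
  | h1 w =>
  induction z using real_induction with
  | ha x x' h h' => simp only [map_add, mul_add, h, h']
  | hs a x h => simp only [map_smul, mul_smul_comm, h]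
  | h1 z => rw [one_tmul_mul, one_tmul_mul, traceFormC_tmul, traceFormC_tmul, traceForm_mul_left hJ]

theorem IsOrthonormalBasis.complexify {ι : Type*} [Fintype ι] {r : ℕ} {e : Module.Basis ι ℝ V}
    (he : IsOrthonormalBasis (traceForm r) e) :
    IsOrthonormalBasis (traceFormC r) (e.baseChange ℂ) := by
  refine ⟨fun α => ?_, fun α β h => ?_⟩
  · rw [Module.Basis.baseChange_apply, traceFormC_tmul, he.1]; simp
  · rw [Module.Basis.baseChange_apply, Module.Basis.baseChange_apply, traceFormC_tmul, he.2 α β h]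
    simp

theorem quadRep_smul {K A : Type*} [Field K] [NonAssocRing A] [Module K A]
    [IsScalarTower K A A] [SMulCommClass K A A] (s : K) (x : A) :
    quadRep K (s • x) = (s * s) • quadRep K x := by
  ext z
  simp only [quadRep_apply, LinearMap.smul_apply, smul_mul_assoc, mul_smul_comm]
  module

end Complexification

section StructureGroup

variable {V : Type*} [NonAssocCommRing V] [Module ℝ V] [IsScalarTower ℝ V V] [SMulCommClass ℝ V V]
  {r : ℕ} {ι : Type*} [Fintype ι] [DecidableEq ι] {e : Module.Basis ι ℝ V}
  (he : IsOrthonormalBasis (traceForm r) e)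
include he

theorem mem_structureGroup_iff {g : Module.End ℂ (ℂ ⊗[ℝ] V)} : g ∈ structureGroup V r ↔
    IsUnit g ∧ ∀ z, quadRep ℂ (g z) = g * quadRep ℂ z * adjointMap (e.baseChange ℂ) g := by
  constructor
  · rintro ⟨h, g', h1, h2⟩
    rw [eq_adjointMap he.complexify (traceFormC_symm r) h1] at h2
    exact ⟨h, h2⟩
  · rintro ⟨h, h1⟩
    exact ⟨h, _, adjointMap_apply he.complexify (traceFormC_symm r) g, h1⟩

theorem mul_mem_structureGroup {g h : Module.End ℂ (ℂ ⊗[ℝ] V)} (hg : g ∈ structureGroup V r)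
    (hh : h ∈ structureGroup V r) : g * h ∈ structureGroup V r := by
  rw [mem_structureGroup_iff he] at *
  refine ⟨hg.1.mul hh.1, fun z => ?_⟩
  rw [Module.End.mul_apply, hg.2, hh.2, adjointMap_mul he.complexify (traceFormC_symm r)]
  simp only [mul_assoc]

theorem smul_mem_structureGroup {g : Module.End ℂ (ℂ ⊗[ℝ] V)} (hg : g ∈ structureGroup V r)
    {s : ℂ} (hs : s ≠ 0) : s • g ∈ structureGroup V r := by
  rw [mem_structureGroup_iff he] at *
  refine ⟨(hg.1.smul (Units.mk0 s hs) :), fun z => ?_⟩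
  rw [LinearMap.smul_apply, quadRep_smul, hg.2, map_smul]
  simp only [smul_mul_assoc, mul_smul_comm, smul_smul]

/-- Since `P(g 𝐞) = g g^*`, the adjoint is `g^* = g⁻¹ P(g 𝐞)`; the fundamental formula evaluates `P`
of such a composite. -/
theorem adjoint_mem_structureGroup (hJ : IsLinearJordan V) {g : Module.End ℂ (ℂ ⊗[ℝ] V)}
    (hg : g ∈ structureGroup V r) : adjointMap (e.baseChange ℂ) g ∈ structureGroup V r := by
  rw [mem_structureGroup_iff he] at *
  obtain ⟨hu, hP⟩ := hg
  obtain ⟨⟨g, gi, h1, h2⟩, rfl⟩ := hu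
  dsimp only at hP ⊢
  have hb := he.complexify
  have hs := traceFormC_symm (V := V) r
  rw [adjointMap_adjointMap hb hs]
  set g' := adjointMap (e.baseChange ℂ) g with hg'
  set gi' := adjointMap (e.baseChange ℂ) gi with hgi'
  have h3 : g' * gi' = 1 := by rw [hg', hgi', ← adjointMap_mul hb hs, h2, adjointMap_one hb hs]
  have h4 : gi' * g' = 1 := by rw [hg', hgi', ← adjointMap_mul hb hs, h1, adjointMap_one hb hs]
  have hPi (w) : quadRep ℂ (gi w) = gi * quadRep ℂ w * gi' := by
    have h := hP (gi w)
    rw [← Module.End.mul_apply, h1, Module.End.one_apply] at h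
    rw [h]
    calc quadRep ℂ (gi w) = (gi * g) * quadRep ℂ (gi w) * (g' * gi') := by
          rw [h2, h3, one_mul, mul_one]
      _ = _ := by simp only [mul_assoc]
  have hone : quadRep ℂ (g 1) = g * g' := by
    rw [hP]
    have : quadRep ℂ (1 : ℂ ⊗[ℝ] V) = 1 := by ext z; simp [quadRep_apply]
    rw [this, mul_one]
  refine ⟨⟨⟨g', gi', h3, h4⟩, rfl⟩, fun z => ?_⟩
  have h5 : g' z = gi (quadRep ℂ (g 1) z) := by
    rw [hone, ← Module.End.mul_apply, ← mul_assoc, h2, one_mul]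
  rw [h5, hPi, hJ.complexify.quadRep_quadRep, hone]
  calc gi * (g * g' * quadRep ℂ z * (g * g')) * gi' =
        (gi * g) * g' * quadRep ℂ z * g * (g' * gi') := by simp only [mul_assoc]
    _ = _ := by rw [h2, h3, one_mul, mul_one]

theorem one_mem_structureGroup : (1 : Module.End ℂ (ℂ ⊗[ℝ] V)) ∈ structureGroup V r := by
  rw [mem_structureGroup_iff he]
  refine ⟨isUnit_one, fun z => ?_⟩
  rw [adjointMap_one he.complexify (traceFormC_symm r)]
  simp

theorem structureGroupZero_subset : structureGroupZero V r ⊆ structureGroup V r :=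
  @connectedComponentIn_subset _ (moduleTopology ℂ (Module.End ℂ (ℂ ⊗[ℝ] V))) _ _

theorem one_mem_structureGroupZero :
    (1 : Module.End ℂ (ℂ ⊗[ℝ] V)) ∈ structureGroupZero V r :=
  @mem_connectedComponentIn _ (moduleTopology ℂ (Module.End ℂ (ℂ ⊗[ℝ] V))) _ _
    (one_mem_structureGroup he)

theorem adjoint_mem_structureGroupZero (hJ : IsLinearJordan V) {g : Module.End ℂ (ℂ ⊗[ℝ] V)}
    (hg : g ∈ structureGroupZero V r) :
    adjointMap (e.baseChange ℂ) g ∈ structureGroupZero V r := by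
  let _ : TopologicalSpace (Module.End ℂ (ℂ ⊗[ℝ] V)) := moduleTopology ℂ _
  have : IsModuleTopology ℂ (Module.End ℂ (ℂ ⊗[ℝ] V)) := ⟨rfl⟩
  have := IsModuleTopology.toContinuousAdd ℂ (Module.End ℂ (ℂ ⊗[ℝ] V))
  have hc : Continuous (adjointMap (e.baseChange ℂ)) :=
    IsModuleTopology.continuous_of_linearMap _
  have h1 : IsPreconnected (adjointMap (e.baseChange ℂ) '' structureGroupZero V r) :=
    isPreconnected_connectedComponentIn.image _ hc.continuousOn
  refine h1.subset_connectedComponentIn (x := 1) ?_ ?_ (Set.mem_image_of_mem _ hg)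
  · exact ⟨1, one_mem_structureGroupZero he, adjointMap_one he.complexify (traceFormC_symm r)⟩
  · rintro _ ⟨h, hh, rfl⟩
    exact adjoint_mem_structureGroup he hJ (structureGroupZero_subset he hh)

-- Elements are moved within `L_ℂ` along polynomial paths lying in the structure group. Degree two
-- covers both the scalings and the unipotent exponentials.
omit he in
theorem quadratic_path_mem {s : Set ℂ} (hs : IsPreconnected s)
    (A B C : Module.End ℂ (ℂ ⊗[ℝ] V))
    (hS : ∀ t ∈ s, A + t • B + t ^ 2 • C ∈ structureGroup V r) {t₀ t₁ : ℂ} (h0 : t₀ ∈ s)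
    (h1 : t₁ ∈ s) (hg : A + t₀ • B + t₀ ^ 2 • C ∈ structureGroupZero V r) :
    A + t₁ • B + t₁ ^ 2 • C ∈ structureGroupZero V r := by
  let _ : TopologicalSpace (Module.End ℂ (ℂ ⊗[ℝ] V)) := moduleTopology ℂ _
  have : IsModuleTopology ℂ (Module.End ℂ (ℂ ⊗[ℝ] V)) := ⟨rfl⟩
  have := IsModuleTopology.toContinuousAdd ℂ (Module.End ℂ (ℂ ⊗[ℝ] V))
  have hc : Continuous fun t : ℂ => A + t • B + t ^ 2 • C := by fun_prop
  have h2 : IsPreconnected ((fun t : ℂ => A + t • B + t ^ 2 • C) '' s) :=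
    hs.image _ hc.continuousOn
  have h3 := h2.subset_connectedComponentIn (Set.mem_image_of_mem _ h0)
    (F := structureGroup V r) (by rintro _ ⟨t, ht, rfl⟩; exact hS t ht) (Set.mem_image_of_mem _ h1)
  have h4 : connectedComponentIn (structureGroup V r) 1 = connectedComponentIn _ _ :=
    connectedComponentIn_eq hg
  rw [structureGroupZero, h4]
  exact h3

/-- The set `ℂ ∖ {0}` is connected, so `t • g` joins `g` to `s • g`. This makes `𝕏` a cone. -/
theorem smul_mem_structureGroupZero {g : Module.End ℂ (ℂ ⊗[ℝ] V)}
    (hg : g ∈ structureGroupZero V r) {s : ℂ} (hs : s ≠ 0) : s • g ∈ structureGroupZero V r := by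
  have h := quadratic_path_mem (s := {0}ᶜ) (r := r)
    (isConnected_compl_singleton_of_one_lt_rank (by simp) (0 : ℂ)).isPreconnected 0 g 0
    (fun t ht => by
      simpa using smul_mem_structureGroup he (structureGroupZero_subset he hg) ht)
    (t₀ := 1) (t₁ := s) (by simp) hs (by simpa using hg)
  simpa using h

end StructureGroup

/-! ### Unipotent elements of the structure group and curves in the orbit. -/

section UnipotentExp

variable {K A : Type*} [Field K] [NonAssocRing A] [Module K A]
  [IsScalarTower K A A] [SMulCommClass K A A]

theorem triple_smul_left (s : K) (x y z : A) : triple (s • x) y z = s • triple x y z := by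
  simp only [triple, smul_mul_assoc, mul_smul_comm, smul_sub, smul_add]

theorem triple_smul_right (s : K) (x y z : A) : triple x y (s • z) = s • triple x y z := by
  simp only [triple, mul_smul_comm, smul_sub, smul_add]

theorem triple_smul_mid (s : K) (x y z : A) : triple x (s • y) z = s • triple x y z := by
  simp only [triple, smul_mul_assoc, mul_smul_comm, smul_sub, smul_add]

variable [CharZero K]

/-- The exponential `1 + t N + t² N² / 2` of an endomorphism with `N³ = 0`. -/
def unipotentExp (N : Module.End K A) (t : K) : Module.End K A :=
  1 + t • N + t ^ 2 • ((1 / 2 : K) • (N * N))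

theorem unipotentExp_apply (N : Module.End K A) (t : K) (z : A) :
    unipotentExp N t z = z + t • N z + t ^ 2 • ((1 / 2 : K) • N (N z)) := rfl

theorem unipotentExp_mul_neg {N : Module.End K A} (h3 : ∀ z, N (N (N z)) = 0) (t : K) :
    unipotentExp N t * unipotentExp N (-t) = 1 := by
  ext z
  simp only [Module.End.mul_apply, unipotentExp_apply, map_add, map_smul, h3, Module.End.one_apply,
    smul_zero, map_zero]
  module

theorem isUnit_unipotentExp {N : Module.End K A} (h3 : ∀ z, N (N (N z)) = 0) (t : K) :
    IsUnit (unipotentExp N t) :=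
  ⟨⟨_, _, unipotentExp_mul_neg h3 t, by
    simpa using unipotentExp_mul_neg h3 (-t)⟩, rfl⟩

/-- `A1` to `A4` are multiples of the coefficients of `t, …, t⁴`. Each follows from the one before
by applying `N` and adding the instance at `N' v`; nilpotency removes the cubic terms. -/
theorem triple_unipotentExp {N N' : Module.End K A}
    (hN : ∀ u v w, N (triple u v w) = triple (N u) v w - triple u (N' v) w + triple u v (N w))
    (h3 : ∀ z, N (N (N z)) = 0) (h3' : ∀ z, N' (N' (N' z)) = 0) (t : K) (z v : A) :
    triple (unipotentExp N t z) v (unipotentExp N t z) =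
      unipotentExp N t (triple z (unipotentExp N' t v) z) := by
  have z1 (y w : A) : triple 0 y w = 0 := by simp [triple]
  have z3 (y w : A) : triple w y 0 = 0 := by simp [triple]
  have z2 (y w : A) : triple w 0 y = 0 := by simp [triple]
  have A1 (v) : triple (N z) v z + triple z v (N z) = N (triple z v z) + triple z (N' v) z := by
    rw [hN]; abel
  have A2 (v) : triple (N (N z)) v z + (2 : K) • triple (N z) v (N z) + triple z v (N (N z)) =
      N (N (triple z v z)) + (2 : K) • N (triple z (N' v) z) + triple z (N' (N' v)) z := by
    have e1 := congrArg N (A1 v)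
    have e2 := A1 (N' v)
    simp only [map_add] at e1
    rw [hN (N z), hN z v (N z)] at e1
    linear_combination (norm := module) e1 + e2
  have A3 (v) : (3 : K) • (triple (N (N z)) v (N z) + triple (N z) v (N (N z))) =
      (3 : K) • N (N (triple z (N' v) z)) + (3 : K) • N (triple z (N' (N' v)) z) := by
    have e1 := congrArg N (A2 v)
    have e2 := A2 (N' v)
    simp only [map_add, map_smul] at e1
    rw [hN (N (N z)), hN (N z) v (N z), hN z v (N (N z)), h3, z1, z3, h3] at e1
    rw [h3', z2] at e2
    linear_combination (norm := module) e1 + e2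
  have A4 (v) : (6 : K) • triple (N (N z)) v (N (N z)) =
      (6 : K) • N (N (triple z (N' (N' v)) z)) := by
    have e1 := congrArg N (A3 v)
    have e2 := A3 (N' v)
    simp only [map_add, map_smul] at e1
    rw [hN (N (N z)), hN (N z) v (N (N z)), h3, z1, z3, h3] at e1
    rw [h3', z2, map_zero] at e2
    linear_combination (norm := module) e1 + e2
  simp only [unipotentExp_apply, triple_add_left, triple_add_right, triple_add_mid,
    triple_smul_left, triple_smul_right, triple_smul_mid, map_add, map_smul]
  linear_combination (norm := skip) t • A1 v + (t ^ 2 / 2) • A2 v + (t ^ 3 / 6) • A3 v +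
    (t ^ 4 / 24) • A4 v
  module

end UnipotentExp

section Frobenius

variable {V : Type*} [NonAssocCommRing V] [Module ℝ V] [IsScalarTower ℝ V V] [SMulCommClass ℝ V V]

/-- `z ↦ {x, y, z}` as an endomorphism. -/
def tripleMap {K A : Type*} [Field K] [NonAssocRing A] [Module K A]
    [IsScalarTower K A A] [SMulCommClass K A A] (x y : A) : Module.End K A where
  toFun := triple x y
  map_add' := triple_add_right x y
  map_smul' s := triple_smul_right s x y

theorem tripleMap_apply {K A : Type*} [Field K] [NonAssocRing A] [Module K A]
    [IsScalarTower K A A] [SMulCommClass K A A] (x y z : A) :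
    tripleMap (K := K) x y z = triple x y z := rfl

theorem peirce_decomposition (hJ : IsLinearJordan V) {f : V} (hf : f * f = f) (z : V) :
    ∃ a b d : V, z = a + b + d ∧ f * a = a ∧ f * b = (1 / 2 : ℝ) • b ∧ f * d = 0 := by
  have h := hJ.peirce_cubic hf z
  refine ⟨(2 : ℝ) • (f * (f * z)) - f * z, halfProj f z,
    z - (3 : ℝ) • (f * z) + (2 : ℝ) • (f * (f * z)), ?_, ?_, mul_halfProj hJ hf z, ?_⟩
  · rw [halfProj_apply]; module
  · simp only [mul_sub, mul_smul_comm]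
    linear_combination (norm := module) h
  · simp only [mul_sub, mul_add, mul_smul_comm]
    linear_combination (norm := module) h

variable (hJ : IsLinearJordan V) {f u : V} (hf : f * f = f) (hu : f * u = (1 / 2 : ℝ) • u)
include hJ hf hu

/-- The map lowers the Peirce eigenvalue by `1/2`: one-space to half-space to zero-space to `0`. -/
theorem triple_half_cube (z : V) :
    triple ((2 : ℝ) • u) f (triple ((2 : ℝ) • u) f (triple ((2 : ℝ) • u) f z)) = 0 := by
  have e (z : V) : triple ((2 : ℝ) • u) f z = u * z + (2 : ℝ) • (u * (f * z) - f * (u * z)) := by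
    rw [triple, mul_comm _ f]
    simp only [smul_mul_assoc, mul_smul_comm, hu]
    module
  have h0 {z : V} (hz : f * z = 0) : triple ((2 : ℝ) • u) f z = 0 := by
    have h := hJ.peirce_zero_commute hf hz u
    rw [hu, mul_smul_comm] at h
    rw [e, hz, mul_zero, mul_comm u z, h]
    module
  have hh {z : V} (hz : f * z = (1 / 2 : ℝ) • z) : f * triple ((2 : ℝ) • u) f z = 0 := by
    have h := hJ.peirce_half_mul_half hf hu hz
    rw [e, hz]
    simp only [mul_add, mul_sub, mul_smul_comm, h]
    module
  have h1 {z : V} (hz : f * z = z) :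
      f * triple ((2 : ℝ) • u) f z = (1 / 2 : ℝ) • triple ((2 : ℝ) • u) f z := by
    have h := hJ.peirce_one_commute hf hz u
    rw [hu, mul_smul_comm, mul_comm z u] at h
    rw [e, hz]
    simp only [mul_add, mul_sub, mul_smul_comm, h]
    module
  obtain ⟨a, b, d, rfl, ha, hb, hd⟩ := peirce_decomposition hJ hf z
  simp only [triple_add_right]
  rw [h0 (hh (h1 ha)), h0 (hh hb), h0 hd]
  simp [triple]

/-- The partner map raises the eigenvalue by `1/2` instead. -/
theorem triple_half_cube' (z : V) :
    triple f ((2 : ℝ) • u) (triple f ((2 : ℝ) • u) (triple f ((2 : ℝ) • u) z)) = 0 := by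
  have e (z : V) : triple f ((2 : ℝ) • u) z = u * z - (2 : ℝ) • (u * (f * z) - f * (u * z)) := by
    rw [triple]
    simp only [smul_mul_assoc, mul_smul_comm, hu]
    module
  have h1 {z : V} (hz : f * z = z) : triple f ((2 : ℝ) • u) z = 0 := by
    have h := hJ.peirce_one_commute hf hz u
    rw [hu, mul_smul_comm, mul_comm z u] at h
    rw [e, hz, h]
    module
  have hh {z : V} (hz : f * z = (1 / 2 : ℝ) • z) :
      f * triple f ((2 : ℝ) • u) z = triple f ((2 : ℝ) • u) z := by
    have h := hJ.peirce_half_mul_half hf hu hz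
    rw [e, hz]
    simp only [mul_sub, mul_smul_comm, h]
    module
  have h0 {z : V} (hz : f * z = 0) :
      f * triple f ((2 : ℝ) • u) z = (1 / 2 : ℝ) • triple f ((2 : ℝ) • u) z := by
    have h := hJ.peirce_zero_commute hf hz u
    rw [hu, mul_smul_comm, mul_comm z u] at h
    rw [e, hz]
    simp only [mul_sub, mul_smul_comm, h, mul_zero]
    module
  obtain ⟨a, b, d, rfl, ha, hb, hd⟩ := peirce_decomposition hJ hf z
  simp only [triple_add_right]
  rw [h1 (hh (h0 hd)), h1 (hh hb), h1 ha]
  simp [triple]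

theorem triple_half_idem : triple ((2 : ℝ) • u) f f = u := by
  rw [triple, mul_comm _ f]
  simp only [smul_mul_assoc, mul_smul_comm, hu, mul_comm u f, hf]
  module

theorem triple_half_self : triple ((2 : ℝ) • u) f u = (2 : ℝ) • (u * u - f * (u * u)) := by
  rw [triple, mul_comm _ f]
  simp only [smul_mul_assoc, mul_smul_comm, hu]
  module

end Frobenius

section Orbit

variable {V : Type*} [NonAssocCommRing V] [Module ℝ V] [IsScalarTower ℝ V V] [SMulCommClass ℝ V V]

theorem one_tmul_smul (s : ℝ) (v : V) : (1 : ℂ) ⊗ₜ[ℝ] (s • v) = (s : ℂ) • ((1 : ℂ) ⊗ₜ[ℝ] v) := by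
  rw [← TensorProduct.smul_tmul, tmul_eq_smul, Complex.real_smul, mul_one]

theorem triple_one_tmul (u v w : V) : triple ((1 : ℂ) ⊗ₜ[ℝ] u) (1 ⊗ₜ v) (1 ⊗ₜ w) =
    1 ⊗ₜ[ℝ] triple u v w := by
  simp only [triple, one_tmul_mul, TensorProduct.tmul_add, TensorProduct.tmul_sub]

theorem traceFormC_triple (hJ : IsLinearJordan V) (r : ℕ) (u v x y : ℂ ⊗[ℝ] V) :
    traceFormC r (triple u v x) y = traceFormC r x (triple v u y) := by
  have hc := hJ.complexify.comm
  simp only [triple, map_add, map_sub, LinearMap.add_apply, LinearMap.sub_apply,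
    traceFormC_mul_left hJ, hc v u]

variable {r : ℕ} {ι : Type*} [Fintype ι] {e : Module.Basis ι ℝ V}
  (he : IsOrthonormalBasis (traceForm r) e) (hJ : IsLinearJordan V) {f u : V}
  (hf : f * f = f) (hu : f * u = (1 / 2 : ℝ) • u)
include he hJ hf hu

theorem unipotentExp_mem_structureGroup (t : ℂ) : unipotentExp
    (tripleMap ((1 : ℂ) ⊗ₜ[ℝ] ((2 : ℝ) • u)) (1 ⊗ₜ f)) t ∈ structureGroup V r := by
  have h3 (z : ℂ ⊗[ℝ] V) : tripleMap (K := ℂ) ((1 : ℂ) ⊗ₜ[ℝ] ((2 : ℝ) • u)) (1 ⊗ₜ f)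
      (tripleMap (K := ℂ) ((1 : ℂ) ⊗ₜ[ℝ] ((2 : ℝ) • u)) (1 ⊗ₜ f)
      (tripleMap (K := ℂ) ((1 : ℂ) ⊗ₜ[ℝ] ((2 : ℝ) • u)) (1 ⊗ₜ f) z)) = 0 := by
    induction z using real_induction with
    | ha x y hx hy => simp only [map_add, hx, hy, add_zero]
    | hs s x hx => simp only [map_smul, hx, smul_zero]
    | h1 v => simp only [tripleMap_apply, triple_one_tmul, triple_half_cube hJ hf hu,
        TensorProduct.tmul_zero]
  have h3' (z : ℂ ⊗[ℝ] V) : tripleMap (K := ℂ) ((1 : ℂ) ⊗ₜ[ℝ] f) (1 ⊗ₜ ((2 : ℝ) • u))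
      (tripleMap (K := ℂ) ((1 : ℂ) ⊗ₜ[ℝ] f) (1 ⊗ₜ ((2 : ℝ) • u))
      (tripleMap (K := ℂ) ((1 : ℂ) ⊗ₜ[ℝ] f) (1 ⊗ₜ ((2 : ℝ) • u)) z)) = 0 := by
    induction z using real_induction with
    | ha x y hx hy => simp only [map_add, hx, hy, add_zero]
    | hs s x hx => simp only [map_smul, hx, smul_zero]
    | h1 v => simp only [tripleMap_apply, triple_one_tmul, triple_half_cube' hJ hf hu,
        TensorProduct.tmul_zero]
  refine ⟨isUnit_unipotentExp h3 t,
    unipotentExp (tripleMap ((1 : ℂ) ⊗ₜ[ℝ] f) (1 ⊗ₜ ((2 : ℝ) • u))) t, fun x y => ?_, fun z => ?_⟩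
  · simp only [unipotentExp_apply, map_add, map_smul, LinearMap.add_apply, LinearMap.smul_apply,
      tripleMap_apply, traceFormC_triple hJ]
  · refine LinearMap.ext fun v => ?_
    simp only [Module.End.mul_apply, hJ.complexify.quadRep_eq]
    exact triple_unipotentExp (fun a b d => hJ.complexify.triple_triple _ _ a b d) h3 h3' t z v

theorem unipotentExp_apply_idem (t : ℂ) : unipotentExp
    (tripleMap ((1 : ℂ) ⊗ₜ[ℝ] ((2 : ℝ) • u)) (1 ⊗ₜ f)) t (1 ⊗ₜ f) =
      1 ⊗ₜ f + t • 1 ⊗ₜ u + t ^ 2 • 1 ⊗ₜ (u * u - f * (u * u)) := by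
  rw [unipotentExp_apply]
  simp only [tripleMap_apply, triple_one_tmul, triple_half_idem hJ hf hu, triple_half_self hJ hf hu]
  rw [one_tmul_smul, smul_smul (1 / 2 : ℂ)]
  norm_num

theorem mul_unipotentExp_mem {g : Module.End ℂ (ℂ ⊗[ℝ] V)} (hg : g ∈ structureGroupZero V r)
    (t : ℂ) : g * unipotentExp (tripleMap ((1 : ℂ) ⊗ₜ[ℝ] ((2 : ℝ) • u)) (1 ⊗ₜ f)) t ∈
      structureGroupZero V r := by
  classical
  set N : Module.End ℂ (ℂ ⊗[ℝ] V) := tripleMap ((1 : ℂ) ⊗ₜ[ℝ] ((2 : ℝ) • u)) (1 ⊗ₜ f)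
  have h (t : ℂ) : g * unipotentExp N t = g + t • (g * N) +
      t ^ 2 • (g * ((1 / 2 : ℂ) • (N * N))) := by
    rw [unipotentExp, mul_add, mul_add, mul_one, mul_smul_comm, mul_smul_comm]
  rw [h]
  refine quadratic_path_mem (s := Set.univ) isPreconnected_univ _ _ _ (fun t _ => ?_)
    (Set.mem_univ 0) (Set.mem_univ t) (by simpa using hg)
  rw [← h]
  exact mul_mem_structureGroup he (structureGroupZero_subset he hg)
    (unipotentExp_mem_structureGroup he hJ hf hu t)

/-- The quadratic term involves the zero-space component of `u²`; it links second derivatives along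
the half-space to first derivatives along the zero-space. -/
theorem orbit_curve_mem {g : Module.End ℂ (ℂ ⊗[ℝ] V)} (hg : g ∈ structureGroupZero V r)
    (t : ℂ) : g (1 ⊗ₜ f) + t • g (1 ⊗ₜ u) + t ^ 2 • g (1 ⊗ₜ (u * u - f * (u * u))) ∈
      orbitX r f := by
  refine ⟨_, mul_unipotentExp_mem he hJ hf hu hg t, ?_⟩
  rw [Module.End.mul_apply, unipotentExp_apply_idem he hJ hf hu, map_add, map_add, map_smul,
    map_smul]

end Orbit

/-! ### Second-order tangency at an idempotent of the frame. -/

section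

variable {V : Type*} [NonAssocCommRing V] [Module ℝ V] [IsScalarTower ℝ V V] [SMulCommClass ℝ V V]

namespace IsJordanFrame

variable {r : ℕ} {c : Fin r → V} (hc : IsJordanFrame c) (hJ : IsLinearJordan V) {lam : ℝ}
  (hlam : ∀ i j, i ≠ j → (Module.finrank ℝ (peirceSpace (c i) (c j)) : ℝ) = 2 * lam)
  [FiniteDimensional ℝ V]
  (hpos : ∀ x : V, x ≠ 0 → 0 < traceForm r x x)
include hc hJ hlam hpos

theorem triple_idem (i : Fin r) (z : V) :
    triple (c i) z (c i) = traceForm r (c i) z • c i := by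
  have hf := hc.idem i
  have e : triple (c i) z (c i) = (2 : ℝ) • (c i * (c i * z)) - c i * z := by
    rw [triple, mul_comm _ (c i), mul_comm z (c i), hf, mul_comm z]; module
  have h1 : c i * triple (c i) z (c i) = triple (c i) z (c i) := by
    rw [e, mul_sub, mul_smul_comm]
    linear_combination (norm := module) hJ.peirce_cubic hf z
  rw [hc.eq_traceForm_smul hJ hlam hpos h1, e]
  congr 1
  simp only [map_sub, map_smul, LinearMap.sub_apply, LinearMap.smul_apply, traceForm_mul_left hJ,
    hf, smul_eq_mul]
  rw [traceForm_symm]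
  ring

/-- Together with `triple_idem` and `triple_idem_zero` this evaluates `{c_i, z, v}` for `v` in each
Peirce space, as needed for the contraction in `sum_triple_eq_zero`. -/
theorem triple_idem_half {i : Fin r} {b : V} (hb : c i * b = (1 / 2 : ℝ) • b) (z : V) :
    triple (c i) z b =
      (1 / 2 : ℝ) • (traceForm r b z • c i + traceForm r (c i) z • b) := by
  have hf := hc.idem i
  have e (z : V) : triple (c i) z b = b * (c i * z) + c i * (b * z) - (1 / 2 : ℝ) • (b * z) := by
    rw [triple, mul_comm _ b, mul_comm z b, hb, mul_comm z, smul_mul_assoc]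
  obtain ⟨x, y, w, rfl, hx, hy, hw⟩ := peirce_decomposition hJ hf z
  have e1 : triple (c i) x b = (1 / 2 : ℝ) • (traceForm r (c i) x • b) := by
    have hx' := hc.eq_traceForm_smul hJ hlam hpos hx
    set s := traceForm r x (c i)
    rw [traceForm_symm r (c i) x, e, hx']
    simp only [mul_smul_comm, hf, mul_comm b (c i), hb, map_smul, LinearMap.smul_apply,
      hc.traceForm_self hJ hlam hpos, smul_eq_mul]
    module
  have e2 : triple (c i) y b = (1 / 2 : ℝ) • (traceForm r b y • c i) := by
    have h2 := hJ.peirce_half_mul_half hf hb hy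
    rw [e, hy, mul_smul_comm, add_sub_cancel_left, hc.eq_traceForm_smul hJ hlam hpos h2,
      traceForm_mul_left hJ, hf, traceForm_mul_left hJ, mul_comm b, hb, map_smul,
      traceForm_symm, smul_eq_mul, mul_smul]
  have e3 : triple (c i) w b = 0 := by
    have h2 := hJ.peirce_zero_commute hf hw b
    rw [e, hw, mul_zero, mul_comm b w, h2, hb, mul_smul_comm]
    module
  have o1 : traceForm r b x = 0 := by
    have := traceForm_mul_left hJ r (c i) x b
    rw [hx, hb, map_smul, smul_eq_mul, traceForm_symm] at this
    linarith
  have o2 : traceForm r b w = 0 := by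
    have := traceForm_mul_left hJ r (c i) b w
    rw [hw, hb, map_smul, LinearMap.smul_apply, smul_eq_mul, map_zero] at this
    linarith
  have o3 : traceForm r (c i) y = 0 := by
    have := traceForm_mul_left hJ r (c i) (c i) y
    rw [hf, hy, map_smul, smul_eq_mul] at this
    linarith
  have o4 : traceForm r (c i) w = 0 := by
    have := traceForm_mul_left hJ r (c i) (c i) w
    rwa [hf, hw, map_zero] at this
  simp only [triple_add_mid, e1, e2, e3, map_add, o1, o2, o3, o4]
  module

omit hlam hpos in
theorem triple_idem_zero {i : Fin r} {d : V} (hd : c i * d = 0) (z : V) :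
    triple (c i) z d = d * halfProj (c i) z := by
  have hf := hc.idem i
  have h1 := hJ.peirce_zero_commute hf hd
  obtain ⟨x, y, w, rfl, hx, hy, hw⟩ := peirce_decomposition hJ hf z
  have h2 := hJ.peirce_one_mul_zero hf hx hd
  rw [triple, hd, mul_zero, sub_zero, mul_comm _ d, mul_comm _ d, h1, halfProj_apply]
  simp only [mul_add, hx, hy, hw, mul_smul_comm, mul_sub, mul_comm d x, h2, mul_zero]
  module

variable {ι : Type*} [Fintype ι] {e : Module.Basis ι ℝ V}
  (he : IsOrthonormalBasis (traceForm r) e)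
include he

/-- Second-order data `(D, B)` satisfying the tangency relations of the orbit at `c_i` are
annihilated by the Bessel operators. -/
theorem sum_triple_eq_zero {i : Fin r} {B : V →ₗ[ℝ] V →ₗ[ℝ] ℂ} {D : V →ₗ[ℝ] ℂ}
    (hDc : D (c i) = 0) (hBc : B (c i) (c i) = 0)
    (hD : ∀ u, c i * u = (1 / 2 : ℝ) • u → D u = 0)
    (hB : ∀ u, c i * u = (1 / 2 : ℝ) • u → B (c i) u = 0)
    (hB' : ∀ u, c i * u = (1 / 2 : ℝ) • u → B u (c i) = 0)
    (hBD : ∀ u v, c i * u = (1 / 2 : ℝ) • u → c i * v = (1 / 2 : ℝ) • v →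
      B u v + 2 * D (u * v - c i * (u * v)) = 0) (v : V) :
    ∑ α, B (e α) (triple (c i) (e α) v) + lam * D v = 0 := by
  have hf := hc.idem i
  have hs (w z : V) : ∑ α, traceForm r w (e α) • B (e α) z = B w z := by
    conv_rhs => rw [← he.sum_eq w]
    simp
  obtain ⟨a, b, d, rfl, ha, hb, hd⟩ := peirce_decomposition hJ hf v
  have h1 : ∑ α, B (e α) (triple (c i) (e α) a) = 0 := by
    rw [hc.eq_traceForm_smul hJ hlam hpos ha]
    simp only [triple_smul_right, hc.triple_idem hJ hlam hpos, map_smul, ← Finset.smul_sum, hs, hBc,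
      smul_zero]
  have h1' : D a = 0 := by
    rw [hc.eq_traceForm_smul hJ hlam hpos ha, map_smul, hDc, smul_zero]
  have h2 : ∑ α, B (e α) (triple (c i) (e α) b) = 0 := by
    simp only [hc.triple_idem_half hJ hlam hpos hb, map_smul, map_add, ← Finset.smul_sum,
      Finset.sum_add_distrib, hs, hB b hb, hB' b hb, add_zero, smul_zero]
  -- The only component that sees `λ`. The half-space projection is moved onto both slots, tangency
  -- replaces `B` by `D`, and `sum_halfProj` evaluates the resulting sum.
  have h3 : ∑ α, B (e α) (triple (c i) (e α) d) = -(lam * D d) := by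
    set p := halfProj (c i) with hp
    have hup (x : V) : c i * p x = (1 / 2 : ℝ) • p x := mul_halfProj hJ hf x
    have hdu (x : V) : c i * (d * p x) = (1 / 2 : ℝ) • (d * p x) := by
      rw [hJ.peirce_zero_commute hf hd, hup, mul_smul_comm]
    have hpp (x : V) : p (p x) = p x := halfProj_of_mem (hup x)
    have h4 := he.sum_adjoint (B.compl₂ (leftMul ℝ d * p)) (A := p) (A' := p)
      (halfProj_symm hJ r (c i)) (traceForm_symm r)
    simp only [LinearMap.compl₂_apply, Module.End.mul_apply, leftMul_apply, hpp] at h4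
    simp only [hc.triple_idem_zero hJ hd]
    rw [← h4, Finset.sum_congr rfl fun α _ =>
      eq_neg_of_add_eq_zero_left (hBD _ _ (hup (e α)) (hdu (e α))), Finset.sum_neg_distrib]
    have h5 := congrArg D (hc.sum_halfProj hJ hlam hpos he hd)
    simp only [map_sum, map_smul, Complex.real_smul] at h5
    rw [← h5]
    simp only [Complex.ofReal_ofNat, hp]
  simp only [triple_add_right, map_add, Finset.sum_add_distrib, h1, h1', h2, h3, hD b hb]
  ring

omit he in
/-- The orbit is contained in the cone `P(x) y = (x | y) x`. -/
theorem triple_self_of_mem_orbit {e : Module.Basis ι ℝ V}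
    (he : IsOrthonormalBasis (traceForm r) e) {i : Fin r} {x : ℂ ⊗[ℝ] V} (hx : x ∈ orbitX r (c i))
    (y : ℂ ⊗[ℝ] V) : triple x y x = traceFormC r x y • x := by
  classical
  obtain ⟨g, hg, rfl⟩ := hx
  have hc1 (y : ℂ ⊗[ℝ] V) : triple (1 ⊗ₜ c i) y (1 ⊗ₜ c i) =
      traceFormC r (1 ⊗ₜ c i) y • ((1 : ℂ) ⊗ₜ[ℝ] c i) := by
    induction y using real_induction with
    | ha x y hx hy => simp only [triple_add_mid, map_add, hx, hy, add_smul]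
    | hs s x hx => simp only [triple_smul_mid, map_smul, hx, smul_smul, smul_eq_mul]
    | h1 v => rw [triple_one_tmul, hc.triple_idem hJ hlam hpos, one_tmul_smul, traceFormC_tmul]
  have h := ((mem_structureGroup_iff he).1 (structureGroupZero_subset he hg)).2 (1 ⊗ₜ c i)
  have h1 := congrArg (fun T => T y) h
  simp only [Module.End.mul_apply, hJ.complexify.quadRep_eq, hc1] at h1
  rw [h1, map_smul, traceFormC_symm, adjointMap_apply he.complexify (traceFormC_symm r),
    traceFormC_symm]

end IsJordanFrame

end

/-! ### Differentials of polynomials and tangentiality of the Bessel operators. -/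

section Curves

open MvPolynomial in
theorem derivative_aeval {ι R : Type*} [Fintype ι] [CommRing R] (f : ι → Polynomial R)
    (p : MvPolynomial ι R) : Polynomial.derivative (aeval f p) =
      ∑ α, aeval f (pderiv α p) * Polynomial.derivative (f α) := by
  classical
  induction p using MvPolynomial.induction_on with
  | C a => simp
  | add p q hp hq => simp only [map_add, hp, hq, add_mul, Finset.sum_add_distrib]
  | mul_X p β hp =>
    simp only [map_mul, Polynomial.derivative_mul, hp, Derivation.leibniz, aeval_X, pderiv_X,
      smul_eq_mul, map_add, add_mul, Finset.sum_add_distrib, Pi.single_apply, apply_ite (aeval f),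
      map_zero, mul_ite, ite_mul, mul_one, mul_zero, zero_mul,
      Finset.sum_ite_eq, Finset.mem_univ, if_true]
    rw [add_comm, Finset.sum_mul]
    exact congrArg₂ _ rfl (Finset.sum_congr rfl fun α _ => by ring)

variable {V : Type*} [NonAssocCommRing V] [Module ℝ V] [IsScalarTower ℝ V V] [SMulCommClass ℝ V V]
  {ι : Type*} [Fintype ι] (e : Module.Basis ι ℝ V)

/-- The derivative of polynomials on `V_ℂ` in direction `w`. -/
def derivAlong (w : ℂ ⊗[ℝ] V) : MvPolynomial ι ℂ →ₗ[ℂ] MvPolynomial ι ℂ :=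
  ∑ α, (e.baseChange ℂ).repr w α • (MvPolynomial.pderiv α).toLinearMap

theorem derivAlong_apply (w : ℂ ⊗[ℝ] V) (p : MvPolynomial ι ℂ) : derivAlong e w p =
    ∑ α, (e.baseChange ℂ).repr w α • MvPolynomial.pderiv α p := by
  simp [derivAlong]

theorem derivAlong_add (w w' : ℂ ⊗[ℝ] V) (p : MvPolynomial ι ℂ) :
    derivAlong e (w + w') p = derivAlong e w p + derivAlong e w' p := by
  simp only [derivAlong_apply, map_add, Finsupp.add_apply, add_smul, Finset.sum_add_distrib]

theorem derivAlong_smul (s : ℂ) (w : ℂ ⊗[ℝ] V) (p : MvPolynomial ι ℂ) :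
    derivAlong e (s • w) p = s • derivAlong e w p := by
  simp only [derivAlong_apply, map_smul, Finsupp.smul_apply, smul_assoc, Finset.smul_sum]

theorem derivAlong_mul (w : ℂ ⊗[ℝ] V) (p q : MvPolynomial ι ℂ) :
    derivAlong e w (p * q) = p * derivAlong e w q + q * derivAlong e w p := by
  simp only [derivAlong_apply, Derivation.leibniz, smul_eq_mul, smul_add, Finset.sum_add_distrib,
    Finset.mul_sum, mul_smul_comm]

theorem pderiv_comm (α β : ι) (p : MvPolynomial ι ℂ) :
    MvPolynomial.pderiv α (MvPolynomial.pderiv β p) =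
      MvPolynomial.pderiv β (MvPolynomial.pderiv α p) := by
  classical
  have h : ⁅MvPolynomial.pderiv (R := ℂ) α, MvPolynomial.pderiv (R := ℂ) β⁆ = 0 := by
    refine MvPolynomial.derivation_ext fun i => ?_
    rw [Derivation.commutator_apply, MvPolynomial.pderiv_X, MvPolynomial.pderiv_X]
    simp [Pi.single_apply, apply_ite]
  have h2 := congrArg (fun D => D p) h
  simpa [Derivation.commutator_apply, sub_eq_zero] using h2

theorem derivAlong_comm (w w' : ℂ ⊗[ℝ] V) (p : MvPolynomial ι ℂ) :
    derivAlong e w (derivAlong e w' p) = derivAlong e w' (derivAlong e w p) := by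
  simp only [derivAlong_apply, map_sum, Derivation.map_smul]
  rw [Finset.sum_comm]
  refine Finset.sum_congr rfl fun α _ => Finset.sum_congr rfl fun β _ => ?_
  rw [pderiv_comm, smul_comm]

/-- The differential of polynomials at a point, as a linear map in the direction. -/
def diffAt (x : ℂ ⊗[ℝ] V) (p : MvPolynomial ι ℂ) : (ℂ ⊗[ℝ] V) →ₗ[ℂ] ℂ where
  toFun w := evalAt e x (derivAlong e w p)
  map_add' w w' := by rw [derivAlong_add, map_add]
  map_smul' s w := by rw [derivAlong_smul, map_smul]; rfl

/-- The second differential of polynomials at a point. -/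
def diffAt₂ (x : ℂ ⊗[ℝ] V) (p : MvPolynomial ι ℂ) :
    (ℂ ⊗[ℝ] V) →ₗ[ℂ] (ℂ ⊗[ℝ] V) →ₗ[ℂ] ℂ :=
  LinearMap.mk₂ ℂ (fun w w' => evalAt e x (derivAlong e w (derivAlong e w' p)))
    (fun w w' w'' => by rw [derivAlong_add, map_add])
    (fun s w w' => by rw [derivAlong_smul, map_smul])
    (fun w w' w'' => by rw [derivAlong_add, map_add, map_add])
    (fun s w w' => by rw [derivAlong_smul, map_smul, map_smul])

theorem diffAt_apply (x w : ℂ ⊗[ℝ] V) (p : MvPolynomial ι ℂ) :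
    diffAt e x p w = evalAt e x (derivAlong e w p) := rfl

theorem diffAt₂_apply (x w w' : ℂ ⊗[ℝ] V) (p : MvPolynomial ι ℂ) :
    diffAt₂ e x p w w' = evalAt e x (derivAlong e w (derivAlong e w' p)) := rfl

theorem diffAt₂_symm (x w w' : ℂ ⊗[ℝ] V) (p : MvPolynomial ι ℂ) :
    diffAt₂ e x p w w' = diffAt₂ e x p w' w := by
  rw [diffAt₂_apply, derivAlong_comm, ← diffAt₂_apply]

/-- If `p` vanishes along the curve `x + t y + t² w`, so do its first two derivatives. -/
theorem diffAt_of_curve {x y w : ℂ ⊗[ℝ] V} {p : MvPolynomial ι ℂ} {S : Set ℂ} (hS : S.Infinite)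
    (h : ∀ t ∈ S, evalAt e (x + t • y + t ^ 2 • w) p = 0) :
    diffAt e x p y = 0 ∧ diffAt₂ e x p y y + 2 * diffAt e x p w = 0 := by
  classical
  set b := e.baseChange ℂ
  let f : ι → Polynomial ℂ := fun α => Polynomial.C (b.repr x α) +
    Polynomial.C (b.repr y α) * Polynomial.X + Polynomial.C (b.repr w α) * Polynomial.X ^ 2
  have hev (t : ℂ) (q : MvPolynomial ι ℂ) :
      (MvPolynomial.aeval f q).eval t = evalAt e (x + t • y + t ^ 2 • w) q := by
    have : (Polynomial.aeval t).comp (MvPolynomial.aeval f) =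
        evalAt e (x + t • y + t ^ 2 • w) := by
      refine MvPolynomial.algHom_ext fun α => ?_
      rw [AlgHom.comp_apply, MvPolynomial.aeval_X, evalAt, MvPolynomial.aeval_X]
      simp only [f, map_add, map_mul, map_pow, Polynomial.aeval_C, Polynomial.aeval_X, map_smul,
        Finsupp.add_apply, Finsupp.smul_apply, smul_eq_mul, Algebra.algebraMap_self, RingHom.id_apply]
      ring
    rw [← this]; rfl
  have hev0 (q : MvPolynomial ι ℂ) : (MvPolynomial.aeval f q).eval 0 = evalAt e x q := by
    rw [hev]; simp
  -- Along the curve `p` is a one-variable polynomial with infinitely many zeros; the claims are its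
  -- first two derivatives at `0`.
  have h0 : MvPolynomial.aeval f p = 0 :=
    Polynomial.eq_zero_of_infinite_isRoot _ (hS.mono fun t ht => (hev t p).trans (h t ht))
  have hf (α) : Polynomial.derivative (f α) = Polynomial.C (b.repr y α) +
      2 * Polynomial.C (b.repr w α) * Polynomial.X := by
    simp [f]; ring
  have hf2 (α) : Polynomial.derivative (Polynomial.derivative (f α)) =
      2 * Polynomial.C (b.repr w α) := by
    rw [hf]; simp
  have h1 := derivative_aeval f p
  have h2 := congrArg Polynomial.derivative h1
  rw [h0] at h1 h2
  rw [Polynomial.derivative_zero] at h1 h2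
  rw [Polynomial.derivative_zero] at h2
  constructor
  · have h3 := congrArg (Polynomial.eval 0) h1
    simp only [Polynomial.eval_zero, Polynomial.eval_finsetSum, Polynomial.eval_mul, hev0, hf] at h3
    simp only [diffAt_apply, derivAlong_apply, map_sum, map_smul, smul_eq_mul]
    rw [h3]
    exact Finset.sum_congr rfl fun α _ => by simp [b, mul_comm]
  · have h3 := congrArg (Polynomial.eval 0) h2
    simp only [Polynomial.derivative_sum, Polynomial.derivative_mul, derivative_aeval,
      Polynomial.eval_zero, Polynomial.eval_finsetSum, Polynomial.eval_mul, Polynomial.eval_add,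
      hev0, hf, Finset.sum_add_distrib, Finset.sum_mul] at h3
    simp only [diffAt_apply, diffAt₂_apply, derivAlong_apply, map_sum, map_smul, smul_eq_mul,
      Finset.mul_sum]
    rw [h3]
    congr 1
    · rw [Finset.sum_comm]
      refine Finset.sum_congr rfl fun α _ => Finset.sum_congr rfl fun β _ => ?_
      rw [pderiv_comm]
      simp only [Polynomial.eval_C, Polynomial.eval_X, mul_zero, add_zero]
      ring
    · exact Finset.sum_congr rfl fun α _ => by simp [b]; ring

end Curves

section

variable {V : Type*} [NonAssocCommRing V] [Module ℝ V] [IsScalarTower ℝ V V] [SMulCommClass ℝ V V]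
  {ι : Type*} [Fintype ι] {r : ℕ} {e : Module.Basis ι ℝ V}

theorem traceForm_triple (hJ : IsLinearJordan V) (r : ℕ) (u v x y : V) :
    traceForm r (triple u v x) y = traceForm r x (triple v u y) := by
  simp only [triple, map_add, map_sub, LinearMap.add_apply, LinearMap.sub_apply,
    traceForm_mul_left hJ, mul_comm v u]

theorem restrictX_eq_zero_iff {f : V} {p : MvPolynomial ι ℂ} :
    restrictX e r f p = 0 ↔ ∀ x ∈ orbitX r f, evalAt e x p = 0 := by
  rw [funext_iff]
  exact Subtype.forall

/-- The Euler operator `∑ z_α ∂/∂z_α`. -/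
def eulerOp (ι : Type*) [Fintype ι] : MvPolynomial ι ℂ →ₗ[ℂ] MvPolynomial ι ℂ :=
  ∑ α, LinearMap.mulLeft ℂ (MvPolynomial.X α) ∘ₗ (MvPolynomial.pderiv α).toLinearMap

theorem eulerOp_apply (p : MvPolynomial ι ℂ) :
    eulerOp ι p = ∑ α, MvPolynomial.X α * MvPolynomial.pderiv α p := by
  simp [eulerOp]

theorem evalAt_X (x : ℂ ⊗[ℝ] V) (α : ι) :
    evalAt e x (MvPolynomial.X α) = (e.baseChange ℂ).repr x α := by
  rw [evalAt, MvPolynomial.aeval_X]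

theorem derivAlong_X (w : ℂ ⊗[ℝ] V) (α : ι) :
    derivAlong e w (MvPolynomial.X α) = MvPolynomial.C ((e.baseChange ℂ).repr w α) := by
  classical
  simp [derivAlong_apply, MvPolynomial.pderiv_X, Pi.single_apply, MvPolynomial.C_eq_smul_one]

theorem derivAlong_pderiv (w : ℂ ⊗[ℝ] V) (α : ι) (p : MvPolynomial ι ℂ) :
    derivAlong e w (MvPolynomial.pderiv α p) = MvPolynomial.pderiv α (derivAlong e w p) := by
  simp only [derivAlong_apply, map_sum, Derivation.map_smul, pderiv_comm]

theorem evalAt_eulerOp (x : ℂ ⊗[ℝ] V) (p : MvPolynomial ι ℂ) :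
    evalAt e x (eulerOp ι p) = diffAt e x p x := by
  simp only [eulerOp_apply, diffAt_apply, derivAlong_apply, map_sum, map_mul, map_smul, evalAt_X,
    smul_eq_mul]

theorem diffAt_eulerOp (x w : ℂ ⊗[ℝ] V) (p : MvPolynomial ι ℂ) :
    diffAt e x (eulerOp ι p) w = diffAt₂ e x p x w + diffAt e x p w := by
  rw [diffAt_apply, eulerOp_apply, map_sum]
  simp only [derivAlong_mul, derivAlong_X, derivAlong_pderiv, map_add, map_sum,
    Finset.sum_add_distrib]
  rw [← map_sum, ← eulerOp_apply, evalAt_eulerOp, diffAt₂_apply, diffAt_apply, diffAt_apply]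
  congr 1
  simp only [derivAlong_apply e w, map_sum, map_mul, map_smul]
  exact Finset.sum_congr rfl fun α _ => by
    rw [mul_comm, evalAt, MvPolynomial.aeval_C]; rfl

variable (he : IsOrthonormalBasis (traceForm r) e)
include he

theorem smul_mem_orbitX {f : V} {x : ℂ ⊗[ℝ] V} (hx : x ∈ orbitX r f) {s : ℂ} (hs : s ≠ 0) :
    s • x ∈ orbitX r f := by
  classical
  obtain ⟨g, hg, rfl⟩ := hx
  exact ⟨s • g, smul_mem_structureGroupZero he hg hs, rfl⟩

theorem eulerOp_vanishing {f : V} {p : MvPolynomial ι ℂ}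
    (hp : ∀ x ∈ orbitX r f, evalAt e x p = 0) :
    ∀ x ∈ orbitX r f, evalAt e x (eulerOp ι p) = 0 := by
  intro x hx
  rw [evalAt_eulerOp]
  -- The ray `(1 + t) x` stays in the orbit except at the apex `t = -1`.
  refine (diffAt_of_curve e (w := 0) (S := {-1}ᶜ) (Set.finite_singleton _).infinite_compl
    fun t ht => ?_).1
  have h : x + t • x + t ^ 2 • (0 : ℂ ⊗[ℝ] V) = (1 + t) • x := by module
  rw [h]
  refine hp _ (smul_mem_orbitX he hx fun h0 => ht ?_)
  rw [Set.mem_singleton_iff]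
  linear_combination h0

/-- The coordinate-free form of the operator, from `(P(e_α, e_β) x | v) = (e_β | {x, e_α, v})`. -/
theorem evalAt_besselComponent (hJ : IsLinearJordan V) (lam : ℝ) (x : ℂ ⊗[ℝ] V) (v : V)
    (p : MvPolynomial ι ℂ) : evalAt e x (besselComponent e r lam v p) =
      ∑ α, diffAt₂ e x p (e.baseChange ℂ α) (triple x (e.baseChange ℂ α) (1 ⊗ₜ v)) +
        lam * diffAt e x p (1 ⊗ₜ v) := by
  have hb := he.complexify
  set b := e.baseChange ℂ with hbdef
  have hbe (α) : b α = 1 ⊗ₜ e α := Module.Basis.baseChange_apply _ _ _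
  have h1 (α) : derivAlong e (b α) = (MvPolynomial.pderiv α).toLinearMap := by
    classical
    refine LinearMap.ext fun q => ?_
    rw [derivAlong_apply, Finset.sum_eq_single α]
    · simp [← hbdef]
    · intro β _ h; simp [← hbdef, h.symm]
    · simp
  have h2 (α β) : ∑ γ, evalAt e x (MvPolynomial.C
      (traceForm r (quadRep₂ ℝ (e α) (e β) (e γ)) v : ℂ) * MvPolynomial.X γ) =
      b.repr (triple x (b α) (1 ⊗ₜ v)) β := by
    have h3 : triple x (b α) (1 ⊗ₜ v) = ∑ γ, b.repr x γ • triple (b γ) (b α) (1 ⊗ₜ v) := by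
      conv_lhs => rw [← b.sum_repr x]
      rw [triple, Finset.sum_mul, Finset.sum_mul, Finset.sum_mul, Finset.sum_mul, Finset.mul_sum,
        ← Finset.sum_add_distrib, ← Finset.sum_sub_distrib]
      exact Finset.sum_congr rfl fun γ _ => by
        rw [← triple_smul_left, triple]
    rw [h3, map_sum, Finsupp.finsetSum_apply]
    refine Finset.sum_congr rfl fun γ _ => ?_
    rw [map_mul, evalAt_X, map_smul, Finsupp.smul_apply, smul_eq_mul, mul_comm,
      hb.repr_eq (triple _ _ _), hbe, hbe, hbe, triple_one_tmul, traceFormC_tmul, evalAt,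
      MvPolynomial.aeval_C, ← hJ.triple_eq (K := ℝ), traceForm_triple hJ, traceForm_symm]
    rfl
  simp only [besselComponent, LinearMap.add_apply, LinearMap.smul_apply, LinearMap.sum_apply,
    LinearMap.comp_apply, LinearMap.mulLeft_apply, map_add, map_sum, map_mul, map_smul,
    Derivation.coeFn_coe, smul_eq_mul]
  congr 1
  · refine Finset.sum_congr rfl fun α _ => ?_
    rw [diffAt₂_apply, derivAlong_comm, derivAlong_apply, map_sum]
    refine Finset.sum_congr rfl fun β _ => ?_
    rw [map_smul, smul_eq_mul, ← hbdef, ← h2 α β, h1, pderiv_comm]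
    simp only [map_mul]
    rfl
  · rw [diffAt_apply, derivAlong_apply, map_sum]
    congr 1
    refine Finset.sum_congr rfl fun α _ => ?_
    rw [map_smul, smul_eq_mul, ← hbdef, hb.repr_eq, hbe, traceFormC_tmul, traceForm_symm]

/-- The tangency relations of first and second order for polynomials that vanish on the orbit. -/
theorem diffAt_tangent (hJ : IsLinearJordan V) {f : V} (hf : f * f = f) {p : MvPolynomial ι ℂ}
    (hp : ∀ x ∈ orbitX r f, evalAt e x p = 0) {g : Module.End ℂ (ℂ ⊗[ℝ] V)}
    (hg : g ∈ structureGroupZero V r) {u : V} (hu : f * u = (1 / 2 : ℝ) • u) :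
    diffAt e (g (1 ⊗ₜ f)) p (g (1 ⊗ₜ u)) = 0 ∧
    diffAt₂ e (g (1 ⊗ₜ f)) p (g (1 ⊗ₜ u)) (g (1 ⊗ₜ u)) +
      2 * diffAt e (g (1 ⊗ₜ f)) p (g (1 ⊗ₜ (u * u - f * (u * u)))) = 0 :=
  diffAt_of_curve e Set.infinite_univ fun t _ => hp _ (orbit_curve_mem he hJ hf hu hg t)

theorem diffAt₂_tangent (hJ : IsLinearJordan V) {f : V} (hf : f * f = f) {p : MvPolynomial ι ℂ}
    (hp : ∀ x ∈ orbitX r f, evalAt e x p = 0) {g : Module.End ℂ (ℂ ⊗[ℝ] V)}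
    (hg : g ∈ structureGroupZero V r) {u v : V} (hu : f * u = (1 / 2 : ℝ) • u)
    (hv : f * v = (1 / 2 : ℝ) • v) :
    diffAt₂ e (g (1 ⊗ₜ f)) p (g (1 ⊗ₜ u)) (g (1 ⊗ₜ v)) +
      2 * diffAt e (g (1 ⊗ₜ f)) p (g (1 ⊗ₜ (u * v - f * (u * v)))) = 0 := by
  have huv : f * (u + v) = (1 / 2 : ℝ) • (u + v) := by rw [mul_add, hu, hv, smul_add]
  have h := (diffAt_tangent he hJ hf hp hg huv).2
  have h1 := (diffAt_tangent he hJ hf hp hg hu).2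
  have h2 := (diffAt_tangent he hJ hf hp hg hv).2
  have e1 : (u + v) * (u + v) - f * ((u + v) * (u + v)) = (u * u - f * (u * u)) +
      (v * v - f * (v * v)) + ((u * v - f * (u * v)) + (u * v - f * (u * v))) := by
    simp only [add_mul, mul_add, mul_comm v u]; abel
  rw [e1] at h
  simp only [TensorProduct.tmul_add, map_add, LinearMap.add_apply] at h
  rw [diffAt₂_symm e _ (g (1 ⊗ₜ v)) (g (1 ⊗ₜ u))] at h
  linear_combination (h - h1 - h2) / 2

theorem triple_structureGroup [DecidableEq ι] (hJ : IsLinearJordan V)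
    {g : Module.End ℂ (ℂ ⊗[ℝ] V)} (hg : g ∈ structureGroup V r) (x y w : ℂ ⊗[ℝ] V) :
    triple (g x) y (g w) = g (triple x (adjointMap (e.baseChange ℂ) g y) w) := by
  have h (z : ℂ ⊗[ℝ] V) : triple (g z) y (g z) =
      g (triple z (adjointMap (e.baseChange ℂ) g y) z) := by
    have := congrArg (fun T => T y) (((mem_structureGroup_iff he).1 hg).2 z)
    simpa only [Module.End.mul_apply, hJ.complexify.quadRep_eq] using this
  have h1 := h (x + w)
  simp only [map_add, triple_add_left, triple_add_right, h x, h w,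
    hJ.complexify.triple_symm (g w) y (g x), hJ.complexify.triple_symm w _ x] at h1
  have h2 : (2 : ℂ) • (triple (g x) y (g w) -
      g (triple x (adjointMap (e.baseChange ℂ) g y) w)) = 0 := by
    linear_combination (norm := module) h1
  exact sub_eq_zero.1 ((smul_eq_zero.1 h2).resolve_left (by norm_num))

omit [Fintype ι] he in
theorem sum_diffAt_real [Fintype ι] (he : IsOrthonormalBasis (traceForm r) e) {c : Fin r → V}
    (hc : IsJordanFrame c) (hJ : IsLinearJordan V) {lam : ℝ}
    (hlam : ∀ i j, i ≠ j → (Module.finrank ℝ (peirceSpace (c i) (c j)) : ℝ) = 2 * lam)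
    [FiniteDimensional ℝ V] (i : Fin r) {p : MvPolynomial ι ℂ}
    (hp : ∀ x ∈ orbitX r (c i), evalAt e x p = 0) {g : Module.End ℂ (ℂ ⊗[ℝ] V)}
    (hg : g ∈ structureGroupZero V r) (v : V) :
    ∑ α, diffAt₂ e (g (1 ⊗ₜ c i)) p (g (1 ⊗ₜ e α)) (g (1 ⊗ₜ triple (c i) (e α) v)) +
      lam * diffAt e (g (1 ⊗ₜ c i)) p (g (1 ⊗ₜ v)) = 0 := by
  have hf := hc.idem i
  -- The polynomial `Ep`, with `E` the Euler operator, also vanishes on the orbit, and its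
  -- derivative along `w` is `p''(x, w) + p'(w)`. Tangency for both `p` and `Ep` yields the second
  -- derivatives with one radial direction.
  have hE := eulerOp_vanishing he hp
  have hx : g (1 ⊗ₜ c i) ∈ orbitX r (c i) := ⟨g, hg, rfl⟩
  have hx1 : diffAt e (g (1 ⊗ₜ c i)) p (g (1 ⊗ₜ c i)) = 0 := by
    rw [← evalAt_eulerOp]; exact hE _ hx
  have hx2 : diffAt₂ e (g (1 ⊗ₜ c i)) p (g (1 ⊗ₜ c i)) (g (1 ⊗ₜ c i)) = 0 := by
    have := diffAt_eulerOp (e := e) (g (1 ⊗ₜ c i)) (g (1 ⊗ₜ c i)) p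
    rwa [← evalAt_eulerOp, eulerOp_vanishing he hE _ hx, hx1, add_zero, eq_comm] at this
  have hxu (u : V) (hu : c i * u = (1 / 2 : ℝ) • u) :
      diffAt₂ e (g (1 ⊗ₜ c i)) p (g (1 ⊗ₜ c i)) (g (1 ⊗ₜ u)) = 0 := by
    have h1 := (diffAt_tangent he hJ hf hp hg hu).1
    have h2 := (diffAt_tangent he hJ hf hE hg hu).1
    rwa [diffAt_eulerOp, h1, add_zero] at h2
  let D : V →ₗ[ℝ] ℂ := (diffAt e (g (1 ⊗ₜ c i)) p ∘ₗ g).restrictScalars ℝ ∘ₗ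
    TensorProduct.mk ℝ ℂ V 1
  let B : V →ₗ[ℝ] V →ₗ[ℝ] ℂ := LinearMap.mk₂ ℝ
    (fun s t => diffAt₂ e (g (1 ⊗ₜ c i)) p (g (1 ⊗ₜ s)) (g (1 ⊗ₜ t)))
    (fun s t u => by rw [TensorProduct.tmul_add, map_add, map_add, LinearMap.add_apply])
    (fun s t u => by
      rw [one_tmul_smul, map_smul, map_smul, LinearMap.smul_apply, Complex.real_smul, smul_eq_mul])
    (fun s t u => by rw [TensorProduct.tmul_add, map_add, map_add])
    (fun s t u => by rw [one_tmul_smul, map_smul, map_smul, Complex.real_smul, smul_eq_mul])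
  have hB (s t : V) : B s t = diffAt₂ e (g (1 ⊗ₜ c i)) p (g (1 ⊗ₜ s)) (g (1 ⊗ₜ t)) := rfl
  have hD (s : V) : D s = diffAt e (g (1 ⊗ₜ c i)) p (g (1 ⊗ₜ s)) := rfl
  clear_value B D
  simp only [← hB, ← hD] at hx1 hx2 hxu ⊢
  refine hc.sum_triple_eq_zero hJ hlam he.pos he hx1 hx2 (fun u hu => ?_) hxu (fun u hu => ?_)
    (fun u v hu hv => ?_) v
  · rw [hD]; exact (diffAt_tangent he hJ hf hp hg hu).1
  · rw [hB, diffAt₂_symm, ← hB]; exact hxu u hu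
  · rw [hB, hD]; exact diffAt₂_tangent he hJ hf hp hg hu hv

/-- For the Wallach parameter, the Bessel operators are tangential to the orbit. -/
theorem IsJordanFrame.besselComponent_vanishing {c : Fin r → V} (hc : IsJordanFrame c)
    (hJ : IsLinearJordan V) {lam : ℝ}
    (hlam : ∀ i j, i ≠ j → (Module.finrank ℝ (peirceSpace (c i) (c j)) : ℝ) = 2 * lam)
    [FiniteDimensional ℝ V] (i : Fin r) (v : V) {p : MvPolynomial ι ℂ}
    (hp : ∀ x ∈ orbitX r (c i), evalAt e x p = 0) :
    ∀ x ∈ orbitX r (c i), evalAt e x (besselComponent e r lam v p) = 0 := by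
  classical
  rintro _ ⟨g, hg, rfl⟩
  have hb := he.complexify
  have hs := traceFormC_symm (V := V) r
  have hbe (α) : e.baseChange ℂ α = 1 ⊗ₜ e α := Module.Basis.baseChange_apply _ _ _
  have hgS := structureGroupZero_subset he hg
  have main (w : ℂ ⊗[ℝ] V) :
      ∑ α, diffAt₂ e (g (1 ⊗ₜ c i)) p (g (e.baseChange ℂ α))
        (g (triple (1 ⊗ₜ c i) (e.baseChange ℂ α) w)) +
        lam * diffAt e (g (1 ⊗ₜ c i)) p (g w) = 0 := by
    induction w using real_induction with
    | ha y z h h' =>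
      simp only [triple_add_right, map_add, Finset.sum_add_distrib]
      linear_combination h + h'
    | hs s y h =>
      simp only [triple_smul_right, map_smul, smul_eq_mul, ← Finset.mul_sum]
      linear_combination s * h
    | h1 v =>
      simp only [hbe, triple_one_tmul]
      exact sum_diffAt_real he hc hJ hlam i hp hg v
  obtain ⟨w, hw⟩ : ∃ w, g w = (1 : ℂ) ⊗ₜ[ℝ] v := by
    obtain ⟨gi, h1⟩ := hgS.1.exists_right_inv
    exact ⟨gi (1 ⊗ₜ v), by rw [← Module.End.mul_apply, h1, Module.End.one_apply]⟩
  rw [evalAt_besselComponent he hJ, ← hw]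
  refine Eq.trans ?_ (main w)
  -- Covariance: `{g x, e_α, g w} = g {x, g^* e_α, w}`, and the `g^*` moves to the other slot of
  -- `p''` as `g`, which reduces the claim to `main`.
  have h := hb.sum_adjoint ((diffAt₂ e (g (1 ⊗ₜ c i)) p).compl₂ (g * quadRep₂ ℂ (1 ⊗ₜ c i) w))
    (A := g) (A' := adjointMap (e.baseChange ℂ) g)
    (fun x y => by rw [hs, ← adjointMap_apply hb hs, hs]) hs
  simp only [LinearMap.compl₂_apply, Module.End.mul_apply] at h
  rw [← Finset.sum_congr rfl fun α _ => by
    rw [triple_structureGroup he hJ hgS, hJ.complexify.triple_eq (K := ℂ)]]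
  simp only [hJ.complexify.triple_eq (K := ℂ)]
  rw [h]

end

/-! ### Abstract lowest weight representations of `sl₂`. -/

/-- A raising and a lowering operator of a graded space that satisfy
`B A - A B = 2 m + ρ` in degree `m`. -/
structure IsLadder {Q : Type*} [AddCommGroup Q] [Module ℂ Q] (U : ℕ → Submodule ℂ Q)
    (A B : Module.End ℂ Q) (ρ : ℝ) : Prop where
  pos : 0 < ρ
  raise : ∀ m, ∀ q ∈ U m, A q ∈ U (m + 1)
  lower : ∀ m, ∀ q ∈ U (m + 1), B q ∈ U m
  lower_zero : ∀ q ∈ U 0, B q = 0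
  comm : ∀ m, ∀ q ∈ U m, B (A q) = A (B q) + (2 * m + ρ : ℂ) • q

/-- The coefficients of the projection to the harmonic parts. -/
def ladderCoeff (ρ : ℝ) (m k j : ℕ) : ℝ :=
  (-1) ^ j * Real.Gamma (ρ + 2 * m - 2 * k) /
      ((j.factorial : ℝ) * (k.factorial : ℝ) * Real.Gamma (ρ + 2 * m - k)) *
    gammaQuot (ρ + 2 * m - 2 * k - 1) j

theorem ladderCoeff_zero {ρ : ℝ} (hρ : 0 < ρ) (m : ℕ) : ladderCoeff ρ m 0 0 = 1 := by
  have h : Real.Gamma (ρ + 2 * m) ≠ 0 := (Real.Gamma_pos_of_pos (by positivity)).ne'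
  simp [ladderCoeff, gammaQuot, h]

theorem gammaQuot_succ {a : ℝ} {j : ℕ} (h : 0 < a - j - 1) :
    (a - j - 1) * gammaQuot a (j + 1) = gammaQuot a j := by
  have ha : 0 < a := by have : (0 : ℝ) ≤ j := by positivity
                        linarith
  have h1 : Real.Gamma (a - j) = (a - j - 1) * Real.Gamma (a - (j + 1 : ℕ)) := by
    have := Real.Gamma_add_one h.ne'
    rw [sub_add_cancel] at this
    rw [this]; push_cast; ring_nf
  rw [gammaQuot, if_neg (Nat.succ_ne_zero j), gammaQuot, ← mul_div_assoc, ← h1]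
  split_ifs with hj
  · rw [hj, Nat.cast_zero, sub_zero, div_self (Real.Gamma_pos_of_pos ha).ne']
  · rfl

/-- The relation that makes `B` of a ladder part telescope; the factor is the one of
`lower_raise_pow` in degree `m - k - j - 1`. -/
theorem ladderCoeff_succ {ρ : ℝ} (hρ : 0 < ρ) {m k j : ℕ} (h : k + j + 1 ≤ m) :
    ladderCoeff ρ m k (j + 1) * ((j + 1) * (2 * (m - k - j - 1 : ℕ) + ρ + j)) =
      -ladderCoeff ρ m k j := by
  obtain ⟨s, rfl⟩ := Nat.exists_eq_add_of_le h
  have e : k + j + 1 + s - k - j - 1 = s := by omega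
  rw [e]
  have h1 := gammaQuot_succ (a := ρ + 2 * (k + j + 1 + s : ℕ) - 2 * k - 1) (j := j)
    (by push_cast; ring_nf; positivity)
  rw [ladderCoeff, ladderCoeff, ← h1, Nat.factorial_succ, pow_succ]
  have h2 : (j.factorial : ℝ) ≠ 0 := by positivity
  have h3 : ((j : ℝ) + 1) ≠ 0 := by positivity
  have h4 : (k.factorial : ℝ) ≠ 0 := by positivity
  have h5 : Real.Gamma (ρ + 2 * (k + j + 1 + s : ℕ) - k) ≠ 0 :=
    (Real.Gamma_pos_of_pos (by push_cast; ring_nf; positivity)).ne'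
  push_cast at *
  field_simp
  ring

/-- The factor is the one by which `B` lowers `A^(k+1) h` for `h` harmonic of degree `m - k`. -/
theorem ladderCoeff_shift {ρ : ℝ} (hρ : 0 < ρ) {m k : ℕ} (h : k ≤ m) (j : ℕ) :
    ((k + 1) * (2 * (m - k : ℕ) + ρ + k)) * ladderCoeff ρ (m + 1) (k + 1) j =
      ladderCoeff ρ m k j := by
  obtain ⟨s, rfl⟩ := Nat.exists_eq_add_of_le h
  rw [Nat.add_sub_cancel_left, ladderCoeff, ladderCoeff, Nat.factorial_succ]
  have e1 : ρ + 2 * (k + s + 1 : ℕ) - 2 * (k + 1 : ℕ) = ρ + 2 * (k + s : ℕ) - 2 * k := by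
    push_cast; ring
  have e2 : ρ + 2 * (k + s + 1 : ℕ) - (k + 1 : ℕ) = (ρ + 2 * (k + s : ℕ) - k) + 1 := by
    push_cast; ring
  have h0 : 0 < ρ + 2 * (k + s : ℕ) - k := by push_cast; ring_nf; positivity
  rw [e1, e2, Real.Gamma_add_one h0.ne']
  have h2 : (j.factorial : ℝ) ≠ 0 := by positivity
  have h3 : ((k : ℝ) + 1) ≠ 0 := by positivity
  have h4 : (k.factorial : ℝ) ≠ 0 := by positivity
  have h5 := (Real.Gamma_pos_of_pos h0).ne'
  have h6 := h0.ne'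
  have e3 : 2 * (s : ℝ) + ρ + k = ρ + 2 * (k + s : ℕ) - k := by push_cast; ring
  rw [e3]
  push_cast at *
  field_simp

namespace IsLadder

variable {Q : Type*} [AddCommGroup Q] [Module ℂ Q] {U : ℕ → Submodule ℂ Q}
  {A B : Module.End ℂ Q} {ρ : ℝ} (hL : IsLadder U A B ρ)
include hL

/-- Positivity of `AB` without an inner product: if `ABq = μ q`, then `Bq` is an eigenvector of `AB`
in one degree less, with the still smaller eigenvalue `μ - (2m + ρ)`. The descent ends in degree
`0`, where `B` vanishes. -/
theorem eq_zero_of_neg {m : ℕ} {q : Q} (hq : q ∈ U m) {μ : ℝ} (hμ : μ < 0)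
    (h : A (B q) = (μ : ℂ) • q) : q = 0 := by
  have hμ' : (μ : ℂ) ≠ 0 := by exact_mod_cast hμ.ne
  induction m generalizing q μ with
  | zero =>
    rw [hL.lower_zero q hq, map_zero] at h
    exact (smul_eq_zero.1 h.symm).resolve_left hμ'
  | succ m ih =>
    have hB := hL.lower m q hq
    have h1 := congrArg B h
    rw [hL.comm m _ hB, map_smul] at h1
    have hρ := hL.pos
    have hneg : μ - (2 * m + ρ) < 0 := by
      have : (0 : ℝ) ≤ m := by positivity
      linarith
    have h2 := ih hB hneg (by push_cast; linear_combination (norm := module) h1)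
      (by exact_mod_cast hneg.ne)
    rw [h2, map_zero] at h
    exact (smul_eq_zero.1 h.symm).resolve_left hμ'

theorem eq_zero_of_lower_raise {m : ℕ} {q : Q} (hq : q ∈ U m) (h : B (A q) = 0) : q = 0 := by
  have hρ := hL.pos
  refine hL.eq_zero_of_neg hq (μ := -(2 * m + ρ)) (by linarith [(Nat.cast_nonneg m : (0 : ℝ) ≤ m)]) ?_
  rw [hL.comm m q hq] at h
  push_cast
  linear_combination (norm := module) h

theorem raise_pow {m : ℕ} {q : Q} (hq : q ∈ U m) (j : ℕ) : (A ^ j) q ∈ U (m + j) := by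
  induction j with
  | zero => exact hq
  | succ j ih => rw [pow_succ', Module.End.mul_apply, ← add_assoc]; exact hL.raise _ _ ih

theorem lower_pow {m j : ℕ} {q : Q} (hq : q ∈ U (m + j)) : (B ^ j) q ∈ U m := by
  induction j generalizing q with
  | zero => exact hq
  | succ j ih => rw [pow_succ, Module.End.mul_apply]; exact ih (hL.lower _ _ hq)

theorem lower_pow_eq_zero {m : ℕ} {q : Q} (hq : q ∈ U m) : (B ^ (m + 1)) q = 0 := by
  rw [pow_succ', Module.End.mul_apply]
  exact hL.lower_zero _ (hL.lower_pow (by rwa [zero_add]))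

theorem lower_raise_pow {m : ℕ} {q : Q} (hq : q ∈ U m) (j : ℕ) :
    B ((A ^ (j + 1)) q) = (A ^ (j + 1)) (B q) +
      ((j + 1) * (2 * m + ρ + j) : ℂ) • (A ^ j) q := by
  induction j with
  | zero => simpa using hL.comm m q hq
  | succ j ih =>
    have h1 : A ((A ^ (j + 1)) (B q)) = (A ^ (j + 1 + 1)) (B q) := by rw [pow_succ' A (j + 1)]; rfl
    have h2 : A ((A ^ j) q) = (A ^ (j + 1)) q := by rw [pow_succ' A j]; rfl
    rw [pow_succ' A (j + 1), Module.End.mul_apply, hL.comm _ _ (hL.raise_pow hq (j + 1)), ih,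
      map_add, map_smul, h1, h2, ← pow_succ' A (j + 1)]
    push_cast
    module

/-- The harmonic parts of an element of degree `m`. -/
def _root_.JordanFock.ladderPart (A B : Module.End ℂ Q) (ρ : ℝ) (m k : ℕ) (q : Q) : Q :=
  ∑ j ∈ Finset.range (m - k + 1), (ladderCoeff ρ m k j : ℂ) • (A ^ j) ((B ^ (k + j)) q)

theorem ladderPart_mem {m k : ℕ} (h : k ≤ m) {q : Q} (hq : q ∈ U m) :
    ladderPart A B ρ m k q ∈ U (m - k) := by
  refine Submodule.sum_mem _ fun j hj => Submodule.smul_mem _ _ ?_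
  rw [Finset.mem_range] at hj
  obtain ⟨s, rfl⟩ := Nat.exists_eq_add_of_le (show k + j ≤ m by omega)
  have e : k + j + s - k = s + j := by omega
  rw [e]
  exact hL.raise_pow (hL.lower_pow (by rwa [add_comm])) j

theorem lower_ladderPart {m k : ℕ} (h : k ≤ m) {q : Q} (hq : q ∈ U m) :
    B (ladderPart A B ρ m k q) = 0 := by
  have h1 (j : ℕ) (hj : j < m - k) : B ((A ^ (j + 1)) ((B ^ (k + (j + 1))) q)) =
      (A ^ (j + 1)) ((B ^ (k + (j + 1) + 1)) q) +
      ((j + 1) * (2 * (m - k - j - 1 : ℕ) + ρ + j) : ℂ) • (A ^ j) ((B ^ (k + j + 1)) q) := by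
    have h2 : (B ^ (k + (j + 1))) q ∈ U (m - k - j - 1) := hL.lower_pow (by
      rwa [show m - k - j - 1 + (k + (j + 1)) = m by omega])
    rw [hL.lower_raise_pow h2, ← Module.End.mul_apply B, ← pow_succ', ← add_assoc k]
  rw [ladderPart, Finset.sum_range_succ', map_add, map_sum]
  have h3 : ∀ j ∈ Finset.range (m - k), B ((ladderCoeff ρ m k (j + 1) : ℂ) •
      (A ^ (j + 1)) ((B ^ (k + (j + 1))) q)) =
      (ladderCoeff ρ m k (j + 1) : ℂ) • (A ^ (j + 1)) ((B ^ (k + (j + 1) + 1)) q) -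
      (ladderCoeff ρ m k j : ℂ) • (A ^ j) ((B ^ (k + j + 1)) q) := by
    intro j hj
    rw [Finset.mem_range] at hj
    have h4 := ladderCoeff_succ hL.pos (show k + j + 1 ≤ m by omega)
    have h5 : (ladderCoeff ρ m k (j + 1) : ℂ) *
        ((j + 1) * (2 * (m - k - j - 1 : ℕ) + ρ + j)) = -(ladderCoeff ρ m k j : ℂ) := by
      exact_mod_cast h4
    rw [map_smul, h1 j hj, smul_add, smul_smul, h5, neg_smul, sub_eq_add_neg]
  -- The sum telescopes: its top term contains `B^(m+1) q = 0`, and its bottom term cancels the `j =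
  -- 0` summand.
  rw [Finset.sum_congr rfl h3, Finset.sum_range_sub fun j =>
    (ladderCoeff ρ m k j : ℂ) • (A ^ j) ((B ^ (k + j + 1)) q)]
  rw [Nat.add_sub_cancel' h, hL.lower_pow_eq_zero hq, map_zero, smul_zero]
  simp [pow_succ']

theorem ladderPart_succ {m k : ℕ} (h : k ≤ m) (q : Q) :
    ((k + 1) * (2 * (m - k : ℕ) + ρ + k) : ℂ) • ladderPart A B ρ (m + 1) (k + 1) q =
      ladderPart A B ρ m k (B q) := by
  rw [ladderPart, ladderPart, Nat.add_sub_add_right, Finset.smul_sum]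
  refine Finset.sum_congr rfl fun j _ => ?_
  have h4 := ladderCoeff_shift hL.pos h j
  have h5 : ((k + 1) * (2 * (m - k : ℕ) + ρ + k) : ℂ) * ladderCoeff ρ (m + 1) (k + 1) j =
    ladderCoeff ρ m k j := by exact_mod_cast h4
  rw [smul_smul, h5, ← Module.End.mul_apply (B ^ (k + j)), ← pow_succ, Nat.add_right_comm]

/-- No identity between Gamma quotients is summed. By induction and `ladderPart_succ` the two sides
have the same image under `B`. Their difference lies in the range of `A`, as only the term `k = j =
0` has no factor `A`, and `BA` is injective. -/
theorem sum_ladderPart {m : ℕ} {q : Q} (hq : q ∈ U m) :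
    ∑ k ∈ Finset.range (m + 1), (A ^ k) (ladderPart A B ρ m k q) = q := by
  induction m generalizing q with
  | zero => simp [ladderPart, ladderCoeff_zero hL.pos]
  | succ m ih =>
    have hA0 : ladderPart A B ρ (m + 1) 0 q = q + A (∑ j ∈ Finset.range (m + 1),
        (ladderCoeff ρ (m + 1) 0 (j + 1) : ℂ) • (A ^ j) ((B ^ (j + 1)) q)) := by
      rw [ladderPart, Nat.sub_zero, Finset.sum_range_succ', ladderCoeff_zero hL.pos, map_sum,
        add_comm]
      simp [pow_succ']
    set s₁ := ∑ j ∈ Finset.range (m + 1),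
        (ladderCoeff ρ (m + 1) 0 (j + 1) : ℂ) • (A ^ j) ((B ^ (j + 1)) q)
    set s₂ := ∑ k ∈ Finset.range (m + 1), (A ^ k) (ladderPart A B ρ (m + 1) (k + 1) q) with hs₂
    have h1 : s₁ ∈ U m := Submodule.sum_mem _ fun j hj => Submodule.smul_mem _ _ (by
      rw [Finset.mem_range] at hj
      have := hL.raise_pow (hL.lower_pow (m := m - j) (j := j + 1) (q := q)
        (by rwa [show m - j + (j + 1) = m + 1 by omega])) j
      rwa [show m - j + j = m by omega] at this)
    have h2 : s₂ ∈ U m := Submodule.sum_mem _ fun k hk => by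
      rw [Finset.mem_range] at hk
      have := hL.raise_pow (hL.ladderPart_mem (k := k + 1) (by omega) hq) k
      rwa [show m + 1 - (k + 1) + k = m by omega] at this
    have hsum : ∑ k ∈ Finset.range (m + 1 + 1), (A ^ k) (ladderPart A B ρ (m + 1) k q) =
        q + A (s₁ + s₂) := by
      have h3 : ∑ k ∈ Finset.range (m + 1), (A ^ (k + 1)) (ladderPart A B ρ (m + 1) (k + 1) q) =
          A s₂ := by
        rw [hs₂, map_sum]
        simp only [pow_succ', Module.End.mul_apply]
      rw [Finset.sum_range_succ', pow_zero, Module.End.one_apply, hA0, h3, map_add]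
      abel
    have hB : B (∑ k ∈ Finset.range (m + 1 + 1), (A ^ k) (ladderPart A B ρ (m + 1) k q)) =
        B q := by
      rw [Finset.sum_range_succ', pow_zero, Module.End.one_apply, map_add,
        hL.lower_ladderPart (Nat.zero_le _) hq, add_zero, map_sum]
      conv_rhs => rw [← ih (hL.lower m q hq)]
      refine Finset.sum_congr rfl fun k hk => ?_
      rw [Finset.mem_range] at hk
      have hk' : k ≤ m := by omega
      have hmem := hL.ladderPart_mem (k := k + 1) (by omega) hq
      rw [hL.lower_raise_pow hmem, hL.lower_ladderPart (by omega) hq, map_zero, zero_add,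
        ← hL.ladderPart_succ hk' q, map_smul, Nat.add_sub_add_right]
    rw [hsum, map_add, add_eq_left] at hB
    rw [hsum, hL.eq_zero_of_lower_raise (Submodule.add_mem _ h1 h2) hB, map_zero, add_zero]

theorem raise_pow_injective {m : ℕ} {q : Q} (hq : q ∈ U m) (hB : B q = 0) (k : ℕ)
    (h : (A ^ k) q = 0) : q = 0 := by
  induction k with
  | zero => exact h
  | succ k ih =>
    have h1 := hL.lower_raise_pow hq k
    rw [h, hB, map_zero, map_zero, zero_add] at h1
    refine ih ((smul_eq_zero.1 h1.symm).resolve_left ?_)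
    have hρ := hL.pos
    have : ((k + 1) * (2 * m + ρ + k) : ℝ) ≠ 0 := by positivity
    exact_mod_cast this

/-- The summands are eigenspaces of `AB + iE`, where `E` is the degree, for the eigenvalues `k(2m +
ρ + k - 1) + i(k + m)`; these are distinct for distinct `(k, m)`. -/
theorem iSupIndep_harmonic {E : Module.End ℂ Q} (hE : ∀ m, ∀ q ∈ U m, E q = (m : ℂ) • q) :
    iSupIndep fun km : ℕ × ℕ => (U km.2 ⊓ LinearMap.ker B).map (A ^ km.1) := by
  let μ : ℕ × ℕ → ℂ := fun km =>
    ((km.1 * (2 * km.2 + ρ + km.1 - 1) : ℝ) : ℂ) + ((km.1 + km.2 : ℝ) : ℂ) * Complex.I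
  have hμ : Function.Injective μ := by
    rintro ⟨k, m⟩ ⟨k', m'⟩ h
    have hre := congrArg Complex.re h
    have him := congrArg Complex.im h
    simp only [μ, Complex.add_re, Complex.ofReal_re, Complex.mul_re, Complex.ofReal_im,
      Complex.I_re, Complex.I_im, Complex.add_im, Complex.mul_im, mul_zero, mul_one,
      sub_zero, add_zero, zero_add] at hre him
    have hN : k + m = k' + m' := by exact_mod_cast him
    by_contra hne
    have hk : k ≠ k' := fun hk => hne (by subst hk; simpa using hN)
    -- With equal degrees, the difference of the real parts is `(k - k')(ρ + m + m' - 1)`. The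
    -- second factor is positive, as `m = m' = 0` would force `k = k'`.
    have h1 : ((k : ℝ) - k') * (ρ + (k + m) + (k' + m') - k - k' - 1) = 0 := by
      linear_combination hre + (-(k + k') : ℝ) * him
    have h2 := (mul_eq_zero.1 h1).resolve_left (sub_ne_zero.2 (by exact_mod_cast hk))
    have hρ := hL.pos
    have h3 : 1 ≤ m + m' := by omega
    have h4 : (1 : ℝ) ≤ m + m' := by exact_mod_cast h3
    linarith
  refine ((Module.End.eigenspaces_iSupIndep (A * B + Complex.I • E)).comp hμ).mono ?_
  rintro ⟨k, m⟩ _ ⟨q, ⟨hq, hB⟩, rfl⟩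
  rw [SetLike.mem_coe, LinearMap.mem_ker] at hB
  rw [Function.comp_apply, Module.End.mem_eigenspace_iff, LinearMap.add_apply, LinearMap.smul_apply,
    Module.End.mul_apply, hE _ _ (hL.raise_pow hq k)]
  have h1 : A (B ((A ^ k) q)) = (k * (2 * m + ρ + k - 1) : ℂ) • (A ^ k) q := by
    cases k with
    | zero => simp [hB]
    | succ k =>
      rw [hL.lower_raise_pow hq, hB, map_zero, zero_add, map_smul, ← Module.End.mul_apply,
        ← pow_succ']
      congr 1; push_cast; ring
  rw [h1, smul_smul, ← add_smul]
  congr 1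
  simp only [μ]
  push_cast
  ring

/-- Injectivity of `BA` on the finite-dimensional `U m` makes `B` surjective from `U (m + 1)`, and
rank-nullity applies. -/
theorem finrank_harmonic [∀ m, FiniteDimensional ℂ (U m)] (m : ℕ) :
    Module.finrank ℂ (U m ⊓ LinearMap.ker B : Submodule ℂ Q) +
      (if m = 0 then 0 else Module.finrank ℂ (U (m - 1))) = Module.finrank ℂ (U m) := by
  cases m with
  | zero =>
    rw [if_pos rfl, add_zero, inf_eq_left.2 fun q hq => hL.lower_zero q hq]
  | succ m =>
    rw [if_neg (Nat.succ_ne_zero m), Nat.add_sub_cancel]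
    let b := B.restrict (hL.lower m)
    let a := A.restrict (hL.raise m)
    have hinj : Function.Injective (b ∘ₗ a) := by
      rw [injective_iff_map_eq_zero]
      rintro ⟨q, hq⟩ h
      exact Subtype.ext (hL.eq_zero_of_lower_raise hq (congrArg Subtype.val h))
    have hsurj : Function.Surjective b := by
      have := LinearMap.surjective_of_injective hinj
      exact Function.Surjective.of_comp this
    have h1 := b.finrank_range_add_finrank_ker
    rw [LinearMap.range_eq_top.2 hsurj, finrank_top] at h1
    have h2 : (U (m + 1) ⊓ LinearMap.ker B : Submodule ℂ Q) =
        (LinearMap.ker b).map (U (m + 1)).subtype := by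
      ext q
      simp only [Submodule.mem_inf, LinearMap.mem_ker, Submodule.mem_map]
      constructor
      · rintro ⟨hq, h⟩
        exact ⟨⟨q, hq⟩, Subtype.ext h, rfl⟩
      · rintro ⟨⟨q, hq⟩, h, rfl⟩
        exact ⟨hq, congrArg Subtype.val h⟩
    rw [h2, Submodule.finrank_map_subtype_eq, add_comm, h1]

end IsLadder

/-! ### Commutation relations with linear polynomials. -/

section

variable {V : Type*} [NonAssocCommRing V] [Module ℝ V] [IsScalarTower ℝ V V] [SMulCommClass ℝ V V]
  {ι : Type*} [Fintype ι] {r : ℕ} {e : Module.Basis ι ℝ V}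

/-- The linear polynomial `z ↦ (z | y)`. -/
def linPoly (e : Module.Basis ι ℝ V) (r : ℕ) (y : ℂ ⊗[ℝ] V) : MvPolynomial ι ℂ :=
  ∑ α, MvPolynomial.C (traceFormC r (e.baseChange ℂ α) y) * MvPolynomial.X α

theorem evalAt_linPoly (x y : ℂ ⊗[ℝ] V) : evalAt e x (linPoly e r y) = traceFormC r x y := by
  conv_rhs => rw [← (e.baseChange ℂ).sum_repr x]
  simp only [linPoly, map_sum, map_mul, evalAt_X, LinearMap.sum_apply, map_smul,
    LinearMap.smul_apply, smul_eq_mul]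
  exact Finset.sum_congr rfl fun α _ => by rw [evalAt, MvPolynomial.aeval_C, mul_comm]; rfl

theorem derivAlong_linPoly (w y : ℂ ⊗[ℝ] V) :
    derivAlong e w (linPoly e r y) = MvPolynomial.C (traceFormC r w y) := by
  conv_rhs => rw [← (e.baseChange ℂ).sum_repr w]
  simp only [linPoly, map_sum, LinearMap.sum_apply]
  exact Finset.sum_congr rfl fun α _ => by
    rw [← MvPolynomial.smul_eq_C_mul, map_smul, derivAlong_X, MvPolynomial.smul_eq_C_mul,
      ← MvPolynomial.C_mul, map_smul, LinearMap.smul_apply, smul_eq_mul, mul_comm]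

theorem isHomogeneous_linPoly (y : ℂ ⊗[ℝ] V) : (linPoly e r y).IsHomogeneous 1 :=
  MvPolynomial.IsHomogeneous.sum _ _ _ fun _ _ => MvPolynomial.isHomogeneous_C_mul_X _ _

theorem trPoly_eq_linPoly : trPoly e r = linPoly e r (1 ⊗ₜ 1) :=
  Finset.sum_congr rfl fun α _ => by
    rw [Module.Basis.baseChange_apply, traceFormC_tmul, traceForm_one]

theorem evalAt_linPoly_mul (x y : ℂ ⊗[ℝ] V) (p : MvPolynomial ι ℂ) :
    evalAt e x (linPoly e r y * p) = traceFormC r x y * evalAt e x p := by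
  rw [map_mul, evalAt_linPoly]

theorem diffAt_linPoly_mul (x y w : ℂ ⊗[ℝ] V) (p : MvPolynomial ι ℂ) :
    diffAt e x (linPoly e r y * p) w =
      traceFormC r w y * evalAt e x p + traceFormC r x y * diffAt e x p w := by
  rw [diffAt_apply, derivAlong_mul, derivAlong_linPoly, map_add, map_mul, map_mul, evalAt_linPoly,
    diffAt_apply, evalAt, MvPolynomial.aeval_C]
  simp only [Algebra.algebraMap_self, RingHom.id_apply]
  ring

theorem diffAt₂_linPoly_mul (x y u w : ℂ ⊗[ℝ] V) (p : MvPolynomial ι ℂ) :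
    diffAt₂ e x (linPoly e r y * p) u w = traceFormC r w y * diffAt e x p u +
      traceFormC r u y * diffAt e x p w + traceFormC r x y * diffAt₂ e x p u w := by
  rw [diffAt₂_apply, derivAlong_mul, derivAlong_linPoly, mul_comm p, ← MvPolynomial.smul_eq_C_mul,
    map_add, map_smul, map_add, map_smul, ← diffAt_apply, diffAt_linPoly_mul, diffAt₂_apply,
    smul_eq_mul]
  simp only [diffAt_apply]
  ring

variable (he : IsOrthonormalBasis (traceForm r) e)
include he

theorem X_eq_linPoly (α : ι) : MvPolynomial.X α = linPoly e r (e.baseChange ℂ α) := by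
  rw [linPoly, Finset.sum_eq_single α]
  · rw [he.complexify.1, MvPolynomial.C_1, one_mul]
  · intro β _ h; rw [he.complexify.2 β α h]; simp
  · simp

/-- The commutation relation between the Bessel operators and multiplication by linear
polynomials. -/
theorem evalAt_besselComponent_linPoly_mul (hJ : IsLinearJordan V) (lam : ℝ) (x y : ℂ ⊗[ℝ] V)
    (v : V) (p : MvPolynomial ι ℂ) :
    evalAt e x (besselComponent e r lam v (linPoly e r y * p)) =
      traceFormC r x y * evalAt e x (besselComponent e r lam v p) +
        2 * diffAt e x p (triple x y (1 ⊗ₜ v)) +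
        lam * traceFormC r (1 ⊗ₜ v) y * evalAt e x p := by
  have hb := he.complexify
  have h1 : ∑ α, traceFormC r (e.baseChange ℂ α) y *
      diffAt e x p (triple x (e.baseChange ℂ α) (1 ⊗ₜ v)) =
      diffAt e x p (triple x y (1 ⊗ₜ v)) := by
    conv_rhs => rw [← hb.sum_eq y]
    have h (u : ℂ ⊗[ℝ] V) : diffAt e x p (triple x u (1 ⊗ₜ v)) =
        (diffAt e x p ∘ₗ quadRep₂ ℂ x (1 ⊗ₜ v)) u := by
      rw [hJ.complexify.triple_eq (K := ℂ)]; rfl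
    simp only [h, map_sum, map_smul, smul_eq_mul, traceFormC_symm r y]
  have h2 : ∑ α, traceFormC r (triple x (e.baseChange ℂ α) (1 ⊗ₜ v)) y *
      diffAt e x p (e.baseChange ℂ α) = diffAt e x p (triple x y (1 ⊗ₜ v)) := by
    conv_rhs => rw [← hb.sum_eq (triple x y (1 ⊗ₜ v))]
    rw [map_sum]
    exact Finset.sum_congr rfl fun α _ => by
      rw [map_smul, smul_eq_mul, traceFormC_triple hJ, hJ.complexify.triple_symm _ x y,
        traceFormC_symm, traceFormC_triple hJ, traceFormC_symm]
  rw [evalAt_besselComponent he hJ, evalAt_besselComponent he hJ, diffAt_linPoly_mul]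
  simp only [diffAt₂_linPoly_mul, Finset.sum_add_distrib, ← Finset.mul_sum, h1, h2]
  ring

/-- The case `y = v = 𝐞` of the general relation: `{x, 𝐞, 𝐞} = x` produces the Euler operator and
`(𝐞|𝐞) = r` the constant. -/
theorem evalAt_besselE_trPoly_mul (hJ : IsLinearJordan V) (hr : jordanTrace r (1 : V) = r)
    (lam : ℝ) (x : ℂ ⊗[ℝ] V) (p : MvPolynomial ι ℂ) :
    evalAt e x (besselE e r lam (trPoly e r * p)) =
      evalAt e x (trPoly e r * besselE e r lam p) +
        2 * evalAt e x (eulerOp ι p) + r * lam * evalAt e x p := by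
  have h : triple x (1 ⊗ₜ[ℝ] (1 : V)) ((1 : ℂ) ⊗ₜ[ℝ] (1 : V)) = x := by
    have h1 (z : ℂ ⊗[ℝ] V) : (1 : ℂ) ⊗ₜ[ℝ] (1 : V) * z = z := one_mul z
    have h2 (z : ℂ ⊗[ℝ] V) : z * (1 : ℂ) ⊗ₜ[ℝ] (1 : V) = z := mul_one z
    simp only [triple, h1, h2]; abel
  rw [besselE, trPoly_eq_linPoly, evalAt_besselComponent_linPoly_mul he hJ, evalAt_linPoly_mul, h,
    evalAt_eulerOp, traceFormC_tmul, traceForm_one, hr]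
  push_cast
  ring

/-- Pairing with `y` gives `Tr L(y)`, so the constant is the normalization of the trace form. -/
theorem sum_basis_mul_self [FiniteDimensional ℝ V] (hJ : IsLinearJordan V) (hr : r ≠ 0)
    [Nontrivial V] : ∑ α, e α * e α = ((Module.finrank ℝ V : ℝ) / r) • (1 : V) := by
  refine eq_of_forall_form he (traceForm_symm r) fun y => ?_
  have hn : (Module.finrank ℝ V : ℝ) ≠ 0 := by exact_mod_cast Module.finrank_pos.ne'
  have hr' : (r : ℝ) ≠ 0 := by exact_mod_cast hr
  have h := he.trace_eq (leftMul ℝ y)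
  rw [map_smul, LinearMap.smul_apply, traceForm_symm r 1 y, traceForm_one, map_sum,
    LinearMap.sum_apply]
  have h1 : jordanTrace r y = (r : ℝ) / Module.finrank ℝ V * LinearMap.trace ℝ V (leftMul ℝ y) := rfl
  rw [h1, h, smul_eq_mul]
  field_simp
  exact Finset.sum_congr rfl fun α _ => by
    rw [traceForm_mul_left hJ, leftMul_apply, mul_comm y, traceForm_symm r (e α)]

theorem sum_triple_basis [FiniteDimensional ℝ V] (hJ : IsLinearJordan V) (hr : r ≠ 0)
    [Nontrivial V] (x : ℂ ⊗[ℝ] V) : ∑ α, triple x (e.baseChange ℂ α) (1 ⊗ₜ e α) =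
      ((Module.finrank ℝ V : ℂ) / r) • x := by
  have h (α) : triple x (e.baseChange ℂ α) (1 ⊗ₜ e α) = x * 1 ⊗ₜ (e α * e α) := by
    rw [Module.Basis.baseChange_apply, triple, one_tmul_mul,
      hJ.complexify.comm (x * _) (1 ⊗ₜ e α)]
    abel
  simp only [h, ← Finset.mul_sum, ← TensorProduct.tmul_sum, sum_basis_mul_self he hJ hr,
    one_tmul_smul, mul_smul_comm]
  rw [show x * (1 : ℂ) ⊗ₜ[ℝ] (1 : V) = x from mul_one x]
  push_cast
  rfl

theorem sum_evalAt_besselComponent_X_mul [FiniteDimensional ℝ V] (hJ : IsLinearJordan V)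
    (hr : r ≠ 0) [Nontrivial V] (lam : ℝ) (x : ℂ ⊗[ℝ] V) (p : MvPolynomial ι ℂ) :
    ∑ α, evalAt e x (besselComponent e r lam (e α) (MvPolynomial.X α * p)) =
      ∑ α, evalAt e x (MvPolynomial.X α * besselComponent e r lam (e α) p) +
        2 * ((Module.finrank ℝ V : ℂ) / r) * evalAt e x (eulerOp ι p) +
        lam * Module.finrank ℝ V * evalAt e x p := by
  have h := fun α => X_eq_linPoly he α
  simp only [h, evalAt_besselComponent_linPoly_mul he hJ, evalAt_linPoly_mul,
    Finset.sum_add_distrib, ← Finset.mul_sum, ← Finset.sum_mul, ← map_sum, sum_triple_basis he hJ hr,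
    map_smul, evalAt_eulerOp, smul_eq_mul]
  have h1 (α) : traceFormC r (1 ⊗ₜ[ℝ] e α) (e.baseChange ℂ α) = 1 := by
    rw [← Module.Basis.baseChange_apply, he.complexify.1]
  simp only [h1, Finset.sum_const, Finset.card_univ, Module.finrank_eq_card_basis e]
  simp
  ring

/-- The sum contracts the direction of the operator to `v = x`. The cone equation replaces `{x, e_β,
x}` by `(x | e_β) x`, and a second contraction leaves only radial derivatives. -/
theorem sum_evalAt_X_mul_besselComponent (hJ : IsLinearJordan V) (lam : ℝ) {x : ℂ ⊗[ℝ] V}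
    (hx : ∀ y, triple x y x = traceFormC r x y • x) (p : MvPolynomial ι ℂ) :
    ∑ α, evalAt e x (MvPolynomial.X α * besselComponent e r lam (e α) p) =
      diffAt₂ e x p x x + lam * diffAt e x p x := by
  have hb := he.complexify
  let Φ : (ℂ ⊗[ℝ] V) →ₗ[ℂ] ℂ :=
    { toFun := fun v => ∑ β, diffAt₂ e x p (e.baseChange ℂ β) (triple x (e.baseChange ℂ β) v) +
        lam * diffAt e x p v
      map_add' := fun v w => by
        simp only [triple_add_right, map_add, Finset.sum_add_distrib]; ring
      map_smul' := fun s v => by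
        simp only [triple_smul_right, map_smul, smul_eq_mul, ← Finset.mul_sum, RingHom.id_apply]
        ring }
  have hΦ (v : ℂ ⊗[ℝ] V) : Φ v =
      ∑ β, diffAt₂ e x p (e.baseChange ℂ β) (triple x (e.baseChange ℂ β) v) +
        lam * diffAt e x p v := rfl
  have h1 (α) : evalAt e x (MvPolynomial.X α * besselComponent e r lam (e α) p) =
      Φ (traceFormC r x (e.baseChange ℂ α) • e.baseChange ℂ α) := by
    rw [map_mul, evalAt_besselComponent he hJ, evalAt_X, hb.repr_eq, map_smul, hΦ, smul_eq_mul,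
      Module.Basis.baseChange_apply _ e α]
  rw [Finset.sum_congr rfl fun α _ => h1 α, ← map_sum, hb.sum_eq, hΦ]
  congr 1
  have h2 (β) : diffAt₂ e x p (e.baseChange ℂ β) (triple x (e.baseChange ℂ β) x) =
      (diffAt₂ e x p).flip x (traceFormC r x (e.baseChange ℂ β) • e.baseChange ℂ β) := by
    rw [hx, map_smul, map_smul, LinearMap.flip_apply]
  rw [Finset.sum_congr rfl fun β _ => h2 β, ← map_sum, hb.sum_eq, LinearMap.flip_apply]

end

/-! ### The coordinate ring of the orbit and its Hilbert function. -/

section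

variable {V : Type*} [NonAssocCommRing V] [Module ℝ V] [IsScalarTower ℝ V V] [SMulCommClass ℝ V V]
  {ι : Type*} [Fintype ι]

theorem isHomogeneous_eulerOp {p : MvPolynomial ι ℂ} {m : ℕ} (hp : p.IsHomogeneous m) :
    eulerOp ι p = (m : ℂ) • p := by
  rw [eulerOp_apply, hp.sum_X_mul_pderiv, Nat.cast_smul_eq_nsmul]

theorem isHomogeneous_besselComponent (e : Module.Basis ι ℝ V) (r : ℕ) (lam : ℝ) (v : V)
    {p : MvPolynomial ι ℂ} {m : ℕ} (hp : p.IsHomogeneous m) :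
    (besselComponent e r lam v p).IsHomogeneous (m - 1) := by
  rw [besselComponent, LinearMap.add_apply]
  refine MvPolynomial.IsHomogeneous.add ?_ ?_
  · rw [LinearMap.sum_apply]
    refine MvPolynomial.IsHomogeneous.sum _ _ _ fun α _ => ?_
    rw [LinearMap.sum_apply]
    refine MvPolynomial.IsHomogeneous.sum _ _ _ fun β _ => ?_
    simp only [LinearMap.comp_apply, LinearMap.mulLeft_apply, Derivation.coeFn_coe]
    have h1 : (∑ γ, MvPolynomial.C (traceForm r (quadRep₂ ℝ (e α) (e β) (e γ)) v : ℂ) *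
        MvPolynomial.X γ).IsHomogeneous 1 :=
      MvPolynomial.IsHomogeneous.sum _ _ _ fun _ _ => MvPolynomial.isHomogeneous_C_mul_X _ _
    obtain hm | hm := le_or_gt m 1
    · have h2 : (MvPolynomial.pderiv β p).IsHomogeneous 0 := by
        simpa [Nat.sub_eq_zero_of_le hm] using hp.pderiv (i := β)
      rw [← MvPolynomial.totalDegree_zero_iff_isHomogeneous,
        MvPolynomial.totalDegree_eq_zero_iff_eq_C] at h2
      rw [h2, MvPolynomial.pderiv_C, mul_zero]
      exact MvPolynomial.isHomogeneous_zero _ _ _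
    · have h2 := h1.mul ((hp.pderiv (i := β)).pderiv (i := α))
      rwa [show 1 + (m - 1 - 1) = m - 1 by omega] at h2
  · rw [LinearMap.smul_apply, LinearMap.sum_apply]
    refine Submodule.smul_mem (MvPolynomial.homogeneousSubmodule ι ℂ (m - 1)) _
      (Submodule.sum_mem _ fun α _ => ?_)
    rw [LinearMap.smul_apply]
    exact Submodule.smul_mem _ _ hp.pderiv

theorem besselComponent_eq_zero (e : Module.Basis ι ℝ V) (r : ℕ) (lam : ℝ) (v : V)
    {p : MvPolynomial ι ℂ} (hp : p.IsHomogeneous 0) : besselComponent e r lam v p = 0 := by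
  rw [← MvPolynomial.totalDegree_zero_iff_isHomogeneous,
    MvPolynomial.totalDegree_eq_zero_iff_eq_C] at hp
  rw [hp]
  simp [besselComponent]

variable (e : Module.Basis ι ℝ V) (r : ℕ) (f : V)

/-- The coordinate ring of the orbit, as a vector space. -/
abbrev CoordSpace : Type _ := MvPolynomial ι ℂ ⧸ LinearMap.ker (restrictX e r f)

/-- The elements of degree `m` of the coordinate ring. -/
def gradedPart (m : ℕ) : Submodule ℂ (CoordSpace e r f) :=
  (MvPolynomial.homogeneousSubmodule ι ℂ m).map (Submodule.mkQ _)

variable {e r f}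

instance (m : ℕ) : FiniteDimensional ℂ (gradedPart e r f m) := by
  have := Module.Finite.iff_fg.2 (MvPolynomial.homogeneousSubmodule_fg (σ := ι) (R := ℂ) m)
  exact Module.Finite.map _ _

/-- The restriction to the orbit as an injective map on the coordinate ring. -/
def coordFun : CoordSpace e r f →ₗ[ℂ] (orbitX r f → ℂ) :=
  Submodule.liftQ _ (restrictX e r f) le_rfl

theorem coordFun_mk (p : MvPolynomial ι ℂ) :
    coordFun (Submodule.mkQ (LinearMap.ker (restrictX e r f)) p) = restrictX e r f p := rfl

theorem coordFun_injective : Function.Injective (coordFun (e := e) (r := r) (f := f)) := by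
  rw [← LinearMap.ker_eq_bot, coordFun, Submodule.ker_liftQ, Submodule.mkQ_map_self]

theorem mkQ_eq_iff {p q : MvPolynomial ι ℂ} :
    Submodule.mkQ (LinearMap.ker (restrictX e r f)) p = Submodule.mkQ _ q ↔
      ∀ x ∈ orbitX r f, evalAt e x p = evalAt e x q := by
  rw [← coordFun_injective.eq_iff, coordFun_mk, coordFun_mk, ← sub_eq_zero, ← map_sub,
    restrictX_eq_zero_iff]
  simp only [map_sub, sub_eq_zero]

/-- The operator induced on the coordinate ring by an operator that preserves vanishing on the
orbit. -/
def descend (T : MvPolynomial ι ℂ →ₗ[ℂ] MvPolynomial ι ℂ)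
    (hT : ∀ p, (∀ x ∈ orbitX r f, evalAt e x p = 0) → ∀ x ∈ orbitX r f, evalAt e x (T p) = 0) :
    Module.End ℂ (CoordSpace e r f) :=
  Submodule.mapQ _ _ T fun p hp => by
    rw [Submodule.mem_comap, LinearMap.mem_ker, restrictX_eq_zero_iff]
    exact hT p (restrictX_eq_zero_iff.1 (LinearMap.mem_ker.1 hp))

theorem descend_mk {T : MvPolynomial ι ℂ →ₗ[ℂ] MvPolynomial ι ℂ}
    (hT : ∀ p, (∀ x ∈ orbitX r f, evalAt e x p = 0) → ∀ x ∈ orbitX r f, evalAt e x (T p) = 0)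
    (p : MvPolynomial ι ℂ) : descend T hT (Submodule.mkQ _ p) = Submodule.mkQ _ (T p) := rfl

theorem descend_pow_mk {T : MvPolynomial ι ℂ →ₗ[ℂ] MvPolynomial ι ℂ}
    (hT : ∀ p, (∀ x ∈ orbitX r f, evalAt e x p = 0) → ∀ x ∈ orbitX r f, evalAt e x (T p) = 0)
    (k : ℕ) (p : MvPolynomial ι ℂ) :
    (descend T hT ^ k) (Submodule.mkQ _ p) = Submodule.mkQ _ ((T ^ k) p) := by
  induction k with
  | zero => rfl
  | succ k ih => rw [pow_succ', Module.End.mul_apply, ih, descend_mk, pow_succ',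
      Module.End.mul_apply]

theorem mulLeft_vanishing (q : MvPolynomial ι ℂ) (p : MvPolynomial ι ℂ)
    (hp : ∀ x ∈ orbitX r f, evalAt e x p = 0) :
    ∀ x ∈ orbitX r f, evalAt e x (LinearMap.mulLeft ℂ q p) = 0 := fun x hx => by
  rw [LinearMap.mulLeft_apply, map_mul, hp x hx, mul_zero]

variable (e r f) in
/-- Multiplication by a polynomial on the coordinate ring. -/
def mulOp (q : MvPolynomial ι ℂ) : Module.End ℂ (CoordSpace e r f) :=
  descend (LinearMap.mulLeft ℂ q) (mulLeft_vanishing q)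

theorem mulOp_mk (q p : MvPolynomial ι ℂ) :
    mulOp e r f q (Submodule.mkQ _ p) = Submodule.mkQ _ (q * p) := rfl

theorem mulOp_pow_mk (q p : MvPolynomial ι ℂ) (k : ℕ) :
    (mulOp e r f q ^ k) (Submodule.mkQ _ p) = Submodule.mkQ _ (q ^ k * p) := by
  rw [mulOp, descend_pow_mk, LinearMap.pow_mulLeft, LinearMap.mulLeft_apply]

theorem coordFun_mulOp_pow (q : MvPolynomial ι ℂ) (k : ℕ) (u : CoordSpace e r f) :
    coordFun ((mulOp e r f q ^ k) u) = restrictX e r f q ^ k * coordFun u := by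
  obtain ⟨p, rfl⟩ := Submodule.mkQ_surjective _ u
  rw [mulOp_pow_mk, coordFun_mk, coordFun_mk]
  funext x
  exact (map_mul (evalAt e (x : ℂ ⊗[ℝ] V)) _ _).trans (by rw [map_pow]; rfl)

theorem mulOp_mem {q : MvPolynomial ι ℂ} (hq : q.IsHomogeneous 1) {m : ℕ} {u : CoordSpace e r f}
    (hu : u ∈ gradedPart e r f m) : mulOp e r f q u ∈ gradedPart e r f (m + 1) := by
  obtain ⟨p, hp, rfl⟩ := hu
  refine ⟨q * p, ?_, (mulOp_mk q p).symm⟩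
  rw [add_comm]
  exact hq.mul hp

end

section

variable {V : Type*} [NonAssocCommRing V] [Module ℝ V] [IsScalarTower ℝ V V] [SMulCommClass ℝ V V]
  {ι : Type*} [Fintype ι] {r : ℕ} {e : Module.Basis ι ℝ V}
  (he : IsOrthonormalBasis (traceForm r) e) {c : Fin r → V} (hc : IsJordanFrame c)
  (hJ : IsLinearJordan V) {lam : ℝ}
  (hlam : ∀ i j, i ≠ j → (Module.finrank ℝ (peirceSpace (c i) (c j)) : ℝ) = 2 * lam)
  [FiniteDimensional ℝ V] (i : Fin r)

/-- The Bessel operators on the coordinate ring of the orbit. -/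
def besselOp (v : V) : Module.End ℂ (CoordSpace e r (c i)) :=
  descend (besselComponent e r lam v) fun _ hp => hc.besselComponent_vanishing he hJ hlam i v hp

theorem besselOp_mk (v : V) (p : MvPolynomial ι ℂ) :
    besselOp he hc hJ hlam i v (Submodule.mkQ _ p) =
      Submodule.mkQ _ (besselComponent e r lam v p) := rfl

theorem besselOp_mem (v : V) {m : ℕ} {u : CoordSpace e r (c i)}
    (hu : u ∈ gradedPart e r (c i) m) :
    besselOp he hc hJ hlam i v u ∈ gradedPart e r (c i) (m - 1) := by
  obtain ⟨p, hp, rfl⟩ := hu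
  exact ⟨_, isHomogeneous_besselComponent e r lam v hp, (besselOp_mk he hc hJ hlam i v p).symm⟩

theorem isLadder_besselOp (hpos : 0 < lam) :
    IsLadder (gradedPart e r (c i)) (mulOp e r (c i) (trPoly e r)) (besselOp he hc hJ hlam i 1)
      (r * lam) where
  pos := by
    have := i.pos
    positivity
  raise m u hu := mulOp_mem (by rw [trPoly_eq_linPoly]; exact isHomogeneous_linPoly _) hu
  lower m u hu := besselOp_mem he hc hJ hlam i 1 hu
  lower_zero u hu := by
    obtain ⟨p, hp, rfl⟩ := hu
    rw [besselOp_mk, besselComponent_eq_zero e r lam 1 hp, map_zero]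
  comm m u hu := by
    obtain ⟨p, hp, rfl⟩ := hu
    rw [mulOp_mk, besselOp_mk, besselOp_mk, mulOp_mk, ← map_smul, ← map_add, mkQ_eq_iff]
    intro x _
    have h := evalAt_besselE_trPoly_mul he hJ (hc.jordanTrace_one hJ hlam he.pos) lam x p
    rw [isHomogeneous_eulerOp hp] at h
    rw [← besselE, h]
    simp only [map_add, map_smul, smul_eq_mul]
    push_cast
    ring

theorem sum_mulOp_besselOp {m : ℕ} {u : CoordSpace e r (c i)} (hu : u ∈ gradedPart e r (c i) m) :
    ∑ α, mulOp e r (c i) (MvPolynomial.X α) (besselOp he hc hJ hlam i (e α) u) =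
      (m * (m - 1 + lam) : ℂ) • u := by
  obtain ⟨p, hp, rfl⟩ := hu
  simp only [besselOp_mk, mulOp_mk, ← map_sum, ← map_smul]
  rw [mkQ_eq_iff]
  intro x hx
  have h2 := diffAt_eulerOp (e := e) x x p
  rw [map_sum, sum_evalAt_X_mul_besselComponent he hJ lam
    (fun y => hc.triple_self_of_mem_orbit hJ hlam he.pos he hx y) p]
  rw [isHomogeneous_eulerOp hp] at h2
  have h3 : diffAt e x p x = m * evalAt e x p := by
    rw [← evalAt_eulerOp, isHomogeneous_eulerOp hp, map_smul, smul_eq_mul]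
  have h4 : diffAt e x ((m : ℂ) • p) x = m * (m * evalAt e x p) := by
    rw [← evalAt_eulerOp, map_smul, isHomogeneous_eulerOp hp, map_smul, map_smul, smul_eq_mul,
      smul_eq_mul]
  rw [h4, h3] at h2
  rw [h3, map_smul, smul_eq_mul]
  linear_combination -h2

theorem sum_besselOp_mulOp {m : ℕ} {u : CoordSpace e r (c i)} (hu : u ∈ gradedPart e r (c i) m) :
    ∑ α, besselOp he hc hJ hlam i (e α) (mulOp e r (c i) (MvPolynomial.X α) u) =
      ((1 + (r - 1) * lam + m) * (r * lam + m) : ℂ) • u := by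
  have h1 := sum_mulOp_besselOp he hc hJ hlam i hu
  obtain ⟨p, hp, rfl⟩ := hu
  simp only [besselOp_mk, mulOp_mk, ← map_sum, ← map_smul] at h1 ⊢
  rw [mkQ_eq_iff] at h1 ⊢
  intro x hx
  have h2 := h1 x hx
  have : Nontrivial V := ⟨c i, 0, hc.ne_zero i⟩
  have hr : (r : ℂ) ≠ 0 := by exact_mod_cast i.pos.ne'
  rw [map_sum, map_smul, smul_eq_mul] at h2 ⊢
  rw [sum_evalAt_besselComponent_X_mul he hJ i.pos.ne', h2, isHomogeneous_eulerOp hp, map_smul,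
    smul_eq_mul]
  have h3 : (Module.finrank ℝ V : ℂ) = r * (1 + (r - 1) * lam) := by
    exact_mod_cast congrArg (fun t : ℝ => (t : ℂ)) (hc.finrank_eq_mul hJ hlam he.pos)
  rw [h3]
  field_simp
  ring

end

/-- If the sums of the products of two families of operators are scalar in both orders, the
dimensions are inversely proportional to the scalars. -/
theorem mul_finrank_eq_of_sum_comp {K W W' ι : Type*} [Field K] [AddCommGroup W] [Module K W]
    [FiniteDimensional K W] [AddCommGroup W'] [Module K W'] [FiniteDimensional K W'] [Fintype ι]
    (z : ι → W →ₗ[K] W') (b : ι → W' →ₗ[K] W) {s t : K}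
    (hs : ∑ α, z α ∘ₗ b α = s • (1 : Module.End K W'))
    (ht : ∑ α, b α ∘ₗ z α = t • (1 : Module.End K W)) :
    s * Module.finrank K W' = t * Module.finrank K W := by
  have h1 := congrArg (LinearMap.trace K W') hs
  have h2 := congrArg (LinearMap.trace K W) ht
  rw [map_smul, LinearMap.trace_one, map_sum, smul_eq_mul] at h1 h2
  rw [← h1, ← h2]
  exact Finset.sum_congr rfl fun α _ => LinearMap.trace_comp_comm' _ _

section

variable {V : Type*} [NonAssocCommRing V] [Module ℝ V] [IsScalarTower ℝ V V] [SMulCommClass ℝ V V]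
  {ι : Type*} [Fintype ι] {r : ℕ} {e : Module.Basis ι ℝ V}
  (he : IsOrthonormalBasis (traceForm r) e) {c : Fin r → V} (hc : IsJordanFrame c)
  (hJ : IsLinearJordan V) {lam : ℝ}
  (hlam : ∀ i j, i ≠ j → (Module.finrank ℝ (peirceSpace (c i) (c j)) : ℝ) = 2 * lam)
  [FiniteDimensional ℝ V] (i : Fin r)
include he hc hJ hlam

theorem finrank_gradedPart_succ (m : ℕ) :
    ((m + 1) * (m + lam) : ℝ) * Module.finrank ℂ (gradedPart e r (c i) (m + 1)) =
      ((1 + (r - 1) * lam + m) * (r * lam + m)) * Module.finrank ℂ (gradedPart e r (c i) m) := by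
  have h := mul_finrank_eq_of_sum_comp
    (fun α => (mulOp e r (c i) (MvPolynomial.X α)).restrict
      (p := gradedPart e r (c i) m) (q := gradedPart e r (c i) (m + 1))
      fun u hu => mulOp_mem (MvPolynomial.isHomogeneous_X ℂ α) hu)
    (fun α => (besselOp he hc hJ hlam i (e α)).restrict
      (p := gradedPart e r (c i) (m + 1)) (q := gradedPart e r (c i) m)
      fun u hu => besselOp_mem he hc hJ hlam i (e α) hu)
    (s := ((m + 1) * (m + lam) : ℂ)) (t := ((1 + (r - 1) * lam + m) * (r * lam + m) : ℂ))
    (LinearMap.ext fun u => Subtype.ext ?_) (LinearMap.ext fun u => Subtype.ext ?_)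
  · exact_mod_cast h
  · have := sum_mulOp_besselOp he hc hJ hlam i u.2
    rw [show ((m + 1 : ℕ) * ((m + 1 : ℕ) - 1 + lam) : ℂ) = (m + 1) * (m + lam) by
      push_cast; ring] at this
    rw [LinearMap.sum_apply, AddSubmonoidClass.coe_finsetSum]
    exact this
  · rw [LinearMap.sum_apply, AddSubmonoidClass.coe_finsetSum]
    exact sum_besselOp_mulOp he hc hJ hlam i u.2

omit he hc hJ hlam in
theorem finrank_gradedPart_zero (he : IsOrthonormalBasis (traceForm r) e) :
    Module.finrank ℂ (gradedPart e r (c i) 0) = 1 := by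
  rw [gradedPart, MvPolynomial.homogeneousSubmodule_zero, Submodule.one_eq_span, Submodule.map_span,
    Set.image_singleton]
  refine finrank_span_singleton fun h => ?_
  rw [← map_zero (Submodule.mkQ _), mkQ_eq_iff] at h
  classical
  have := h _ ⟨1, one_mem_structureGroupZero he, rfl⟩
  simp at this

theorem finrank_gradedPart (hpos : 0 < lam) (m : ℕ) :
    (Module.finrank ℂ (gradedPart e r (c i) m) : ℝ) =
      (ascPochhammer ℝ m).eval ((Module.finrank ℝ V : ℝ) / r) *
          (ascPochhammer ℝ m).eval (r * lam) /
        ((m.factorial : ℝ) * (ascPochhammer ℝ m).eval lam) := by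
  have hr : (r : ℝ) ≠ 0 := by exact_mod_cast i.pos.ne'
  rw [hc.finrank_eq_mul hJ hlam he.pos, mul_div_cancel_left₀ _ hr]
  induction m with
  | zero => simp [finrank_gradedPart_zero i he]
  | succ m ih =>
    have h := finrank_gradedPart_succ he hc hJ hlam i m
    have h1 : (0 : ℝ) < m + lam := by positivity
    have h2 := ascPochhammer_pos m lam hpos
    have h3 : (m.factorial : ℝ) ≠ 0 := by positivity
    rw [ih] at h
    rw [ascPochhammer_succ_eval, ascPochhammer_succ_eval, ascPochhammer_succ_eval,
      Nat.factorial_succ]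
    push_cast
    have h4 := h1.ne'
    have h5 : lam + m ≠ 0 := by rwa [add_comm]
    rw [← mul_right_inj' (show ((m + 1) * (m + lam) : ℝ) ≠ 0 by positivity), h]
    field_simp
    ring

end

section

variable {ι : Type*} [Fintype ι]

/-- The projection of polynomials to their homogeneous component of degree `m`. -/
def homogeneousProj (ι : Type*) (m : ℕ) :
    MvPolynomial ι ℂ →ₗ[ℂ] MvPolynomial.homogeneousSubmodule ι ℂ m :=
  (MvPolynomial.homogeneousComponent m).codRestrict _
    fun p => MvPolynomial.homogeneousComponent_isHomogeneous m p

theorem homogeneousProj_coe {m : ℕ} (p : MvPolynomial.homogeneousSubmodule ι ℂ m) :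
    homogeneousProj ι m p = p :=
  Subtype.ext (MvPolynomial.homogeneousComponent_eq_self p.2)

open Classical in
/-- The Fischer duality that identifies linear forms on the homogeneous polynomials of degree `m`
with homogeneous polynomials of degree `m`. -/
def fischerMap (ι : Type*) [Fintype ι] (m : ℕ) :
    Module.Dual ℂ (MvPolynomial.homogeneousSubmodule ι ℂ m) →ₗ[ℂ] MvPolynomial ι ℂ where
  toFun φ := ∑ s ∈ Finset.univ.piAntidiag m, ((Nat.multinomial Finset.univ s : ℂ) *
    φ (homogeneousProj ι m (MvPolynomial.monomial (Finsupp.equivFunOnFinite.symm s) 1))) •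
      MvPolynomial.monomial (Finsupp.equivFunOnFinite.symm s) (1 : ℂ)
  map_add' φ ψ := by
    simp only [LinearMap.add_apply, mul_add, add_smul, Finset.sum_add_distrib]
  map_smul' a φ := by
    simp only [LinearMap.smul_apply, smul_eq_mul, RingHom.id_apply, Finset.smul_sum, smul_smul]
    exact Finset.sum_congr rfl fun s _ => by rw [mul_left_comm]

theorem fischerMap_injective (m : ℕ) : Function.Injective (fischerMap ι m) := by
  classical
  rw [injective_iff_map_eq_zero]
  intro φ hφ
  have h0 (s : ι →₀ ℕ) (hs : s.degree = m) :
      φ (homogeneousProj ι m (MvPolynomial.monomial s 1)) = 0 := by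
    have h1 := congrArg (MvPolynomial.coeff s) hφ
    have hmem : (s : ι → ℕ) ∈ Finset.univ.piAntidiag m := by
      rw [Finset.mem_piAntidiag]
      exact ⟨by rw [← hs, Finsupp.degree_eq_sum], fun _ _ => Finset.mem_univ _⟩
    rw [fischerMap, LinearMap.coe_mk, AddHom.coe_mk, MvPolynomial.coeff_sum,
      Finset.sum_eq_single_of_mem _ hmem] at h1
    · rw [MvPolynomial.coeff_smul, Finsupp.equivFunOnFinite_symm_coe, MvPolynomial.coeff_monomial,
        if_pos rfl, smul_eq_mul, mul_one, MvPolynomial.coeff_zero] at h1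
      refine (mul_eq_zero.1 h1).resolve_left ?_
      exact_mod_cast (Nat.multinomial_pos _ _).ne'
    · intro t _ ht
      rw [MvPolynomial.coeff_smul, MvPolynomial.coeff_monomial, if_neg, smul_zero]
      rintro rfl
      exact ht rfl
  refine LinearMap.ext fun p => ?_
  rw [← homogeneousProj_coe p]
  conv_lhs => rw [MvPolynomial.as_sum (p : MvPolynomial ι ℂ)]
  rw [map_sum, map_sum]
  refine Finset.sum_eq_zero fun s hs => ?_
  have h1 : s.degree = m := by
    by_contra h
    exact MvPolynomial.mem_support_iff.1 hs
      (MvPolynomial.IsHomogeneous.coeff_eq_zero (n := m) p.2 h)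
  rw [← mul_one (MvPolynomial.coeff s (p : MvPolynomial ι ℂ)), ← smul_eq_mul,
    ← MvPolynomial.smul_monomial, map_smul, map_smul, h0 s h1, smul_zero]

variable {V : Type*} [NonAssocCommRing V] [Module ℝ V] [IsScalarTower ℝ V V] [SMulCommClass ℝ V V]
  {r : ℕ} {e : Module.Basis ι ℝ V}

theorem eq_of_forall_evalAt {p q : MvPolynomial ι ℂ} (h : ∀ z, evalAt e z p = evalAt e z q) :
    p = q := by
  refine MvPolynomial.funext fun x => ?_
  have h1 := h ((e.baseChange ℂ).equivFun.symm x)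
  have h2 (α) : (e.baseChange ℂ).repr ((e.baseChange ℂ).equivFun.symm x) α = x α := by
    rw [← Module.Basis.equivFun_apply, LinearEquiv.apply_symm_apply]
  simpa only [evalAt, h2, MvPolynomial.aeval_eq_eval, MvPolynomial.coe_aeval_eq_eval] using h1

variable (e) in
/-- Evaluation at a point as a linear form on the homogeneous polynomials of degree `m`. -/
def evalForm (m : ℕ) (x : ℂ ⊗[ℝ] V) :
    Module.Dual ℂ (MvPolynomial.homogeneousSubmodule ι ℂ m) :=
  (evalAt e x).toLinearMap ∘ₗ Submodule.subtype _

theorem evalForm_apply (m : ℕ) (x : ℂ ⊗[ℝ] V) (p : MvPolynomial.homogeneousSubmodule ι ℂ m) :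
    evalForm e m x p = evalAt e x (p : MvPolynomial ι ℂ) := rfl

theorem fischerMap_evalForm (he : IsOrthonormalBasis (traceForm r) e) (m : ℕ) (x : ℂ ⊗[ℝ] V) :
    fischerMap ι m (evalForm e m x) = linPoly e r x ^ m := by
  classical
  rw [linPoly, Finset.sum_pow_eq_sum_piAntidiag, fischerMap, LinearMap.coe_mk, AddHom.coe_mk]
  refine Finset.sum_congr rfl fun s hs => ?_
  have hdeg : (Finsupp.equivFunOnFinite.symm s).degree = m := by
    rw [Finsupp.degree_eq_sum]
    exact (Finset.mem_piAntidiag.1 hs).1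
  have h1 : MvPolynomial.monomial (Finsupp.equivFunOnFinite.symm s) (1 : ℂ) =
      ∏ α, MvPolynomial.X α ^ s α := by
    rw [MvPolynomial.monomial_eq, Finsupp.prod_fintype _ _ fun _ => pow_zero _, MvPolynomial.C_1,
      one_mul]
    rfl
  have h2 : (homogeneousProj ι m (MvPolynomial.monomial (Finsupp.equivFunOnFinite.symm s) 1) :
      MvPolynomial ι ℂ) = ∏ α, MvPolynomial.X α ^ s α :=
    (MvPolynomial.homogeneousComponent_eq_self
      (MvPolynomial.isHomogeneous_monomial (1 : ℂ) hdeg)).trans h1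
  rw [evalForm_apply, h2, h1, map_prod]
  simp only [mul_pow, Finset.prod_mul_distrib, map_pow, evalAt_X, he.complexify.repr_eq,
    traceFormC_symm r x, MvPolynomial.smul_eq_C_mul, MvPolynomial.C_mul, map_prod, mul_assoc,
    map_natCast]

variable (he : IsOrthonormalBasis (traceForm r) e) (hJ : IsLinearJordan V)
include he hJ

theorem polyTop_eq_map (f : V) (m : ℕ) : polyTop e r f m =
    (Submodule.span ℂ (evalForm e m '' orbitX r f)).map (fischerMap ι m) := by
  classical
  rw [polyTop, Submodule.map_span]
  congr 1
  have hs := traceFormC_symm (V := V) r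
  have hadj := adjointMap_apply he.complexify hs
  ext q
  constructor
  · rintro ⟨g, hg, h⟩
    refine ⟨_, ⟨_, ⟨_, adjoint_mem_structureGroupZero he hJ hg, rfl⟩, rfl⟩, ?_⟩
    rw [fischerMap_evalForm he]
    refine eq_of_forall_evalAt (e := e) fun z => ?_
    rw [map_pow, evalAt_linPoly, h, hs, hadj, hs]
  · rintro ⟨_, ⟨_, ⟨g, hg, rfl⟩, rfl⟩, rfl⟩
    refine ⟨_, adjoint_mem_structureGroupZero he hJ hg, fun z => ?_⟩
    rw [fischerMap_evalForm he, map_pow, evalAt_linPoly, hadj]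

theorem finrank_polyTop (f : V) (m : ℕ) : FiniteDimensional ℂ (polyTop e r f m) ∧
    Module.finrank ℂ (polyTop e r f m) = Module.finrank ℂ (gradedPart e r f m) := by
  have := Module.Finite.iff_fg.2 (MvPolynomial.homogeneousSubmodule_fg (σ := ι) (R := ℂ) m)
  rw [polyTop_eq_map he hJ]
  refine ⟨Module.Finite.map _ _, ?_⟩
  rw [← (Submodule.equivMapOfInjective _ (fischerMap_injective m) _).finrank_eq]
  let π := (Submodule.mkQ (LinearMap.ker (restrictX e r f))) ∘ₗ
    (MvPolynomial.homogeneousSubmodule ι ℂ m).subtype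
  have h1 : (Submodule.span ℂ (evalForm e m '' orbitX r f)).dualCoannihilator =
      LinearMap.ker π := by
    ext p
    rw [Submodule.mem_dualCoannihilator, LinearMap.mem_ker]
    have h2 : π p = 0 ↔ ∀ x ∈ orbitX r f, evalAt e x (p : MvPolynomial ι ℂ) = 0 := by
      rw [LinearMap.comp_apply, ← map_zero (Submodule.mkQ _), mkQ_eq_iff]
      simp only [map_zero, Submodule.subtype_apply]
    rw [h2]
    constructor
    · intro h x hx
      exact h _ (Submodule.subset_span ⟨x, hx, rfl⟩)
    · intro h φ hφ
      induction hφ using Submodule.span_induction with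
      | mem φ hφ => obtain ⟨x, hx, rfl⟩ := hφ; exact h x hx
      | zero => rfl
      | add φ ψ _ _ h h' => rw [LinearMap.add_apply, h, h', add_zero]
      | smul a φ _ h => rw [LinearMap.smul_apply, h, smul_zero]
  have h3 := Subspace.finrank_add_finrank_dualCoannihilator_eq
    (Submodule.span ℂ (evalForm e m '' orbitX r f))
  have h4 := π.finrank_range_add_finrank_ker
  have h5 : LinearMap.range π = gradedPart e r f m := by
    rw [LinearMap.range_comp, Submodule.range_subtype]; rfl
  rw [h1] at h3
  rw [h5] at h4
  exact Nat.add_right_cancel (h3.trans h4.symm)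

end

section

variable {Q : Type*} [AddCommGroup Q] [Module ℂ Q] {U : ℕ → Submodule ℂ Q}
  {A B E : Module.End ℂ Q} {ρ : ℝ}

theorem IsLadder.eq_ladderPart (hL : IsLadder U A B ρ)
    (hE : ∀ m, ∀ q ∈ U m, E q = (m : ℂ) • q) {m : ℕ} {q : Q} (hq : q ∈ U m) {u : ℕ → Q}
    (hu : ∀ k ≤ m, u k ∈ U (m - k) ⊓ LinearMap.ker B)
    (h : q = ∑ k ∈ Finset.range (m + 1), (A ^ k) (u k)) {k : ℕ} (hk : k ≤ m) :
    u k = ladderPart A B ρ m k q := by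
  have hmem : ∀ k ≤ m, u k - ladderPart A B ρ m k q ∈ U (m - k) ⊓ LinearMap.ker B := fun k hk =>
    Submodule.sub_mem _ (hu k hk) ⟨hL.ladderPart_mem hk hq, hL.lower_ladderPart hk hq⟩
  have hinj : Function.Injective fun k : ℕ => (k, m - k) := fun a b hab => (Prod.ext_iff.1 hab).1
  have hind := (iSupIndep_iff_finsetSum_eq_zero_imp_eq_zero _).1 ((hL.iSupIndep_harmonic hE).comp hinj)
    (Finset.range (m + 1)) (fun k => (A ^ k) (u k - ladderPart A B ρ m k q))
    (fun k hk => ⟨_, hmem k (Nat.lt_succ_iff.1 (Finset.mem_range.1 hk)), rfl⟩)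
    (by simp only [map_sub, Finset.sum_sub_distrib]
        rw [← h, hL.sum_ladderPart hq, sub_self]) k (Finset.mem_range.2 (Nat.lt_succ_iff.2 hk))
  have h1 := hmem k hk
  exact sub_eq_zero.1 (hL.raise_pow_injective h1.1 h1.2 k hind)

theorem IsLadder.iSup_harmonic (hL : IsLadder U A B ρ) :
    ⨆ km : ℕ × ℕ, (U km.2 ⊓ LinearMap.ker B).map (A ^ km.1) = ⨆ m, U m := by
  refine le_antisymm (iSup_le fun km => ?_) (iSup_le fun m q hq => ?_)
  · rintro _ ⟨q, hq, rfl⟩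
    exact Submodule.mem_iSup_of_mem _ (hL.raise_pow hq.1 _)
  · rw [← hL.sum_ladderPart hq]
    refine Submodule.sum_mem _ fun k hk => Submodule.mem_iSup_of_mem (k, m - k) ?_
    have hk' := Nat.lt_succ_iff.1 (Finset.mem_range.1 hk)
    exact ⟨_, ⟨hL.ladderPart_mem hk' hq, hL.lower_ladderPart hk' hq⟩, rfl⟩

end

section

variable {V : Type*} [NonAssocCommRing V] [Module ℝ V] [IsScalarTower ℝ V V] [SMulCommClass ℝ V V]
  {ι : Type*} [Fintype ι] {r : ℕ} {e : Module.Basis ι ℝ V}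

theorem iSup_gradedPart (f : V) : ⨆ m, gradedPart e r f m = ⊤ := by
  rw [eq_top_iff]
  rintro u -
  obtain ⟨p, rfl⟩ := Submodule.mkQ_surjective _ u
  rw [← MvPolynomial.sum_homogeneousComponent p, map_sum]
  exact Submodule.sum_mem _ fun m _ => Submodule.mem_iSup_of_mem m
    ⟨_, MvPolynomial.homogeneousComponent_isHomogeneous m p, rfl⟩

theorem range_coordFun (f : V) :
    LinearMap.range (coordFun (e := e) (r := r) (f := f)) = polyX e r f := by
  rw [coordFun, Submodule.range_liftQ]; rfl

variable (he : IsOrthonormalBasis (traceForm r) e) {c : Fin r → V} (hc : IsJordanFrame c)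
  (hJ : IsLinearJordan V) {lam : ℝ}
  (hlam : ∀ i j, i ≠ j → (Module.finrank ℝ (peirceSpace (c i) (c j)) : ℝ) = 2 * lam)
  [FiniteDimensional ℝ V] (i : Fin r)

theorem harmonicX_eq_map (m : ℕ) : harmonicX e r (c i) lam m =
    (gradedPart e r (c i) m ⊓ LinearMap.ker (besselOp he hc hJ hlam i 1)).map coordFun := by
  have hker (p : MvPolynomial ι ℂ) : besselOp he hc hJ hlam i 1 (Submodule.mkQ _ p) = 0 ↔
      restrictX e r (c i) (besselE e r lam p) = 0 := by
    rw [besselOp_mk, ← (map_eq_zero_iff _ coordFun_injective), coordFun_mk]; rfl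
  ext h
  constructor
  · rintro ⟨p, ⟨hp, hB⟩, rfl⟩
    exact ⟨_, ⟨⟨p, hp, rfl⟩, (hker p).2 hB⟩, coordFun_mk p⟩
  · rintro ⟨_, ⟨⟨p, hp, rfl⟩, hB⟩, rfl⟩
    exact ⟨p, ⟨hp, (hker p).1 hB⟩, rfl⟩

theorem trHarmonicX_eq_map (k m : ℕ) : trHarmonicX e r (c i) lam k m =
    ((gradedPart e r (c i) m ⊓ LinearMap.ker (besselOp he hc hJ hlam i 1)).map
      (mulOp e r (c i) (trPoly e r) ^ k)).map coordFun := by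
  rw [trHarmonicX, harmonicX_eq_map he hc hJ hlam, ← Submodule.map_comp, ← Submodule.map_comp]
  congr 1
  exact LinearMap.ext fun u => (coordFun_mulOp_pow _ k u).symm

theorem mkQ_harmonicPart (m k : ℕ) (p : MvPolynomial ι ℂ) :
    Submodule.mkQ (LinearMap.ker (restrictX e r (c i))) (harmonicPart e r lam m k p) =
      ladderPart (mulOp e r (c i) (trPoly e r)) (besselOp he hc hJ hlam i 1) (r * lam) m k
        (Submodule.mkQ _ p) := by
  rw [harmonicPart, map_sum, ladderPart]
  refine Finset.sum_congr rfl fun j _ => ?_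
  rw [map_smul, besselOp, descend_pow_mk, mulOp_pow_mk]
  rfl

/-- The Euler operator on the coordinate ring of the orbit. -/
def coordEuler (f : V) : Module.End ℂ (CoordSpace e r f) :=
  descend (eulerOp ι) fun _ hp => eulerOp_vanishing he hp

theorem coordEuler_apply (f : V) {m : ℕ} {u : CoordSpace e r f} (hu : u ∈ gradedPart e r f m) :
    coordEuler he f u = (m : ℂ) • u := by
  obtain ⟨p, hp, rfl⟩ := hu
  rw [coordEuler, descend_mk, isHomogeneous_eulerOp hp, map_smul]

end

theorem IsWallachParameter.finrank_peirceSpace {V : Type*} [NonAssocCommRing V] [Module ℝ V]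
    [IsScalarTower ℝ V V] [SMulCommClass ℝ V V] [FiniteDimensional ℝ V] [IsSimpleRing V]
    (hJ : IsLinearJordan V) {r : ℕ} [NeZero r] {c : Fin r → V} (hc : IsJordanFrame c) {lam : ℝ}
    (hpos : ∀ x : V, x ≠ 0 → 0 < traceForm r x x) (hlam : IsWallachParameter c lam) :
    0 < lam ∧
      ∀ i j, i ≠ j → (Module.finrank ℝ (peirceSpace (c i) (c j)) : ℝ) = 2 * lam := by
  obtain ⟨hr, rfl⟩ | ⟨rfl, h⟩ := hlam
  · have h01 : (0 : Fin r) ≠ 1 := by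
      rw [Ne, Fin.ext_iff, Fin.val_zero, Fin.coe_ofNat_eq_mod, Nat.mod_eq_of_lt hr]
      exact zero_ne_one
    constructor
    · have h1 := hc.peirceSpace_ne_bot hJ hpos h01
      have h2 : 0 < Module.finrank ℝ (peirceSpace (c 0) (c 1)) :=
        Nat.pos_of_ne_zero fun h0 => h1 (Submodule.finrank_eq_zero.1 h0)
      positivity
    · intro i j hij
      rw [hc.finrank_eq hJ hpos hij h01]
      ring
  · exact ⟨h, fun i j hij => absurd (Subsingleton.elim i j) hij⟩

end JordanFock

end

open JordanFock in
theorem proposition2p17 {V : Type*} [NonAssocCommRing V] [Module ℝ V]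
    [IsScalarTower ℝ V V] [SMulCommClass ℝ V V] (hV : IsSimpleEuclideanJordan V)
    {r : ℕ} [NeZero r] (c : Fin r → V) (hc : IsJordanFrame c)
    (lam : ℝ) (hlam : IsWallachParameter c lam)
    {ι : Type*} [Fintype ι] (e : Module.Basis ι ℝ V)
    (he : ∀ α, traceForm r (e α) (e α) = 1)
    (he' : ∀ α β, α ≠ β → traceForm r (e α) (e β) = 0) :
    -- `ℬ_𝐞` descends to an operator on `𝒫(𝕏)`
    (∀ p, restrictX e r (c 0) p = 0 → restrictX e r (c 0) (besselE e r lam p) = 0) ∧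
    -- existence (with the explicit formula) and uniqueness of the decomposition on `𝒫^m(𝕏)`
    (∀ m : ℕ, ∀ p ∈ MvPolynomial.homogeneousSubmodule ι ℂ m,
      (∀ k ≤ m, restrictX e r (c 0) (harmonicPart e r lam m k p) ∈
        harmonicX e r (c 0) lam (m - k)) ∧
      restrictX e r (c 0) p = ∑ k ∈ Finset.range (m + 1),
        trX e r (c 0) ^ k * restrictX e r (c 0) (harmonicPart e r lam m k p) ∧
      ∀ h : ℕ → orbitX r (c 0) → ℂ, (∀ k ≤ m, h (m - k) ∈ harmonicX e r (c 0) lam (m - k)) →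
        restrictX e r (c 0) p = ∑ k ∈ Finset.range (m + 1), trX e r (c 0) ^ k * h (m - k) →
        ∀ k ≤ m, h (m - k) = restrictX e r (c 0) (harmonicPart e r lam m k p)) ∧
    -- `𝒫(𝕏)` is the direct sum of the spaces `tr^k ℋ^m(𝕏)`
    (iSupIndep (fun km : ℕ × ℕ => trHarmonicX e r (c 0) lam km.1 km.2) ∧
      ⨆ km : ℕ × ℕ, trHarmonicX e r (c 0) lam km.1 km.2 = polyX e r (c 0)) ∧
    -- dimensions
    (∀ m : ℕ, FiniteDimensional ℂ (polyTop e r (c 0) m) ∧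
      (dimTop e r (c 0) m : ℝ) =
        (ascPochhammer ℝ m).eval ((Module.finrank ℝ V : ℝ) / r) *
            (ascPochhammer ℝ m).eval (r * lam) /
          ((m.factorial : ℝ) * (ascPochhammer ℝ m).eval lam)) ∧
    (∀ m : ℕ, FiniteDimensional ℂ (harmonicX e r (c 0) lam m) ∧
      (Module.finrank ℂ (harmonicX e r (c 0) lam m) : ℤ) =
        (dimTop e r (c 0) m : ℤ) - if m = 0 then 0 else (dimTop e r (c 0) (m - 1) : ℤ)) := by
  have hfin := hV.finiteDimensional
  have hsimple := hV.simple
  have hJ := hV.isLinearJordan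
  have hb : IsOrthonormalBasis (traceForm r) e := ⟨he, he'⟩
  obtain ⟨hpos, hdim⟩ := hlam.finrank_peirceSpace hJ hc hb.pos
  have hL := isLadder_besselOp hb hc hJ hdim 0 hpos
  have hE := fun m (u : CoordSpace e r (c 0)) (hu : u ∈ gradedPart e r (c 0) m) =>
    coordEuler_apply hb (c 0) hu
  have hH := harmonicX_eq_map hb hc hJ hdim 0
  have htop (m : ℕ) := finrank_polyTop hb hJ (c 0) m
  refine ⟨fun p hp => ?_, fun m p hp => ⟨fun k hk => ?_, ?_, fun h hh hsum k hk => ?_⟩,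
    ⟨?_, ?_⟩, fun m => ⟨(htop m).1, ?_⟩, fun m => ?_⟩
  · rw [restrictX_eq_zero_iff] at hp ⊢
    exact hc.besselComponent_vanishing hb hJ hdim 0 1 hp
  · rw [hH, ← coordFun_mk, mkQ_harmonicPart hb hc hJ hdim]
    exact ⟨_, ⟨hL.ladderPart_mem hk ⟨p, hp, rfl⟩, hL.lower_ladderPart hk ⟨p, hp, rfl⟩⟩, rfl⟩
  · have h1 (k : ℕ) : trX e r (c 0) ^ k * restrictX e r (c 0) (harmonicPart e r lam m k p) =
        coordFun ((mulOp e r (c 0) (trPoly e r) ^ k) (ladderPart (mulOp e r (c 0) (trPoly e r))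
          (besselOp hb hc hJ hdim 0 1) (r * lam) m k (Submodule.mkQ _ p))) := by
      rw [coordFun_mulOp_pow, ← mkQ_harmonicPart hb hc hJ hdim, coordFun_mk]; rfl
    rw [Finset.sum_congr rfl fun k _ => h1 k, ← map_sum, hL.sum_ladderPart ⟨p, hp, rfl⟩,
      coordFun_mk]
  · have hex : ∀ k, ∃ u : CoordSpace e r (c 0), k ≤ m →
        u ∈ gradedPart e r (c 0) (m - k) ⊓ LinearMap.ker (besselOp hb hc hJ hdim 0 1) ∧
          coordFun u = h (m - k) := by
      intro k
      by_cases hk : k ≤ m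
      · have h1 := hh k hk
        rw [hH] at h1
        obtain ⟨u, hu, hu'⟩ := h1
        exact ⟨u, fun _ => ⟨hu, hu'⟩⟩
      · exact ⟨0, fun h' => absurd h' hk⟩
    choose u hu using hex
    have h2 : Submodule.mkQ _ p = ∑ k ∈ Finset.range (m + 1),
        (mulOp e r (c 0) (trPoly e r) ^ k) (u k) := by
      refine coordFun_injective ?_
      rw [coordFun_mk, hsum, map_sum]
      refine Finset.sum_congr rfl fun k hk => ?_
      rw [coordFun_mulOp_pow, (hu k (Nat.lt_succ_iff.1 (Finset.mem_range.1 hk))).2]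
      rfl
    rw [← (hu k hk).2, hL.eq_ladderPart hE ⟨p, hp, rfl⟩ (fun k hk => (hu k hk).1) h2 hk,
      ← mkQ_harmonicPart hb hc hJ hdim, coordFun_mk]
  · simp only [trHarmonicX_eq_map hb hc hJ hdim]
    exact LinearMap.iSupIndep_map _ coordFun_injective (hL.iSupIndep_harmonic hE)
  · simp only [trHarmonicX_eq_map hb hc hJ hdim]
    rw [← Submodule.map_iSup, hL.iSup_harmonic, iSup_gradedPart, Submodule.map_top, range_coordFun]
  · rw [dimTop, (htop m).2, finrank_gradedPart hb hc hJ hdim 0 hpos]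
  · rw [hH]
    refine ⟨Module.Finite.map _ _, ?_⟩
    rw [← (Submodule.equivMapOfInjective _ coordFun_injective _).finrank_eq, dimTop, dimTop,
      (htop m).2, (htop (m - 1)).2, ← hL.finrank_harmonic m]
    split_ifs <;> push_cast <;> ring
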